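/- For integers $p,q\ge 1$ let $D_{p,q}$ be the standard diagram of the torus link $T_{p,q}$, i.e. the closure of the $p$-strand positive braid $(\sigma_1\sigma_2\cdots\sigma_{p-1})^q$ (for $p=1$: a circle without crossings). For a link diagram $D$ with $n$ ordered crossings let $C(D)$ be Khovanov's cube-of-resolutions complex over $\mathbb{Z}$ without the final shift by the numbers of positive and negative crossings: $C^i(D)=\bigoplus_{\epsilon\in\{0,1\}^n,\ |\epsilon|=i}V_\epsilon\{i\}$, where $V_\epsilon$ is the tensor product of one copy of $V=\mathbb{Z}1\oplus\mathbb{Z}X$, $\deg 1=1$, $\deg X=-1$, for each circle of the resolution $D_\epsilon$ (for a positive crossing the $0$-resolution is the oriented one), $\{i\}$ raises degrees by $i$, and the differential is the sum, with signs $(-1)^{\#\{1\text{'s before the changed crossing}\}}$, of the per-edge maps given by $m(1\otimes 1)=1$, $m(1\otimes X)=m(X\otimes 1)=X$, $m(X\otimes X)=0$ when two circles merge and by $\Delta(1)=1\otimes X+X\otimes 1$, $\Delta(X)=X\otimes X$ when a circle splits. Let $H^{i,j}(D)$ be the degree-$j$ part of its $i$-th homology group (the unnormalized Khovanov homology; it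 is $0$ for $i<0$). Below, $\cong$ means isomorphism of abelian groups. (1) If $2\le p<q$ and $i<p+q-3$ are integers, then for every $j\in\mathbb{Z}$ $$H^{i,j}(D_{p,q})\cong H^{i,j}(D_{p,q-1}).$$ (2) If $2\le p<q$ and $i<2p-1$ are integers, then for every $j\in\mathbb{Z}$ $$H^{i,j}(D_{p,p+1})\cong H^{i,j}(D_{p,p+2})\cong\cdots\cong H^{i,j}(D_{p,q}).$$ (3) If $p\ge 2$ and $i<2p-3$ are integers, then for every $j\in\mathbb{Z}$ $$H^{i,j}(D_{p,p})\cong H^{i,j+1}(D_{p-1,p}).$$ -/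

import Mathlib

open scoped BigOperators

namespace Khovanov

/-- The combinatorial content of an unoriented link diagram: finitely many marked points on the
diagram, the crossingless arcs between marked points, and an ordered list of crossings. Each
crossing has four marked points as its corners, named so that the strands of its `0`-resolution
run `nw -- sw` and `ne -- se`, and those of its `1`-resolution run `nw -- ne` and `sw -- se`. -/
structure Diagram where
  Pt : Type
  finite_pt : Finite Pt
  arc : Pt → Pt → Prop
  n : ℕ
  nw : Fin n → Pt
  ne : Fin n → Pt
  sw : Fin n → Pt
  se : Fin n → Pt

attribute [instance] Diagram.finite_pt

/-- The homogeneous basis `1`, `X` of the graded module `V`. -/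
inductive Gen where
  | one : Gen
  | X : Gen

instance : Finite Gen :=
  Finite.of_injective (fun g : Gen => match g with | .one => true | .X => false) (by
    rintro ⟨⟩ ⟨⟩ h <;> simp_all)

/-- `deg 1 = 1` and `deg X = -1`. -/
def Gen.deg : Gen → ℤ
  | .one => 1
  | .X => -1

/-- `mulCoeff a b c` is the coefficient of `c` in `m (a ⊗ b)`, where
`m (1 ⊗ 1) = 1`, `m (1 ⊗ X) = m (X ⊗ 1) = X`, `m (X ⊗ X) = 0`. -/
def mulCoeff : Gen → Gen → Gen → ℤ
  | .one, .one, .one => 1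
  | .one, .X, .X => 1
  | .X, .one, .X => 1
  | _, _, _ => 0

/-- `comulCoeff a b c` is the coefficient of `b ⊗ c` in `Δ a`, where
`Δ 1 = 1 ⊗ X + X ⊗ 1`, `Δ X = X ⊗ X`. -/
def comulCoeff : Gen → Gen → Gen → ℤ
  | .one, .one, .X => 1
  | .one, .X, .one => 1
  | .X, .X, .X => 1
  | _, _, _ => 0

namespace Diagram

variable (D : Diagram)

/-- Two marked points are adjacent in the total resolution `ε` if they are joined by a
crossingless arc or by a strand of a resolved crossing (`false` means `0`, `true` means `1`). -/
inductive Adj (ε : Fin D.n → Bool) : D.Pt → D.Pt → Prop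
  | arc {a b : D.Pt} : D.arc a b → Adj ε a b
  | zero_left (c : Fin D.n) : ε c = false → Adj ε (D.nw c) (D.sw c)
  | zero_right (c : Fin D.n) : ε c = false → Adj ε (D.ne c) (D.se c)
  | one_top (c : Fin D.n) : ε c = true → Adj ε (D.nw c) (D.ne c)
  | one_bot (c : Fin D.n) : ε c = true → Adj ε (D.sw c) (D.se c)

/-- The circles of the total resolution `ε`: the connected components, i.e. the classes of marked
points under the equivalence relation generated by adjacency. -/
def Circle (ε : Fin D.n → Bool) : Type := Quot (D.Adj ε)

/-- The circle of the total resolution `ε` through a marked point. -/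
def circ (ε : Fin D.n → Bool) (a : D.Pt) : D.Circle ε := Quot.mk _ a

instance (ε : Fin D.n → Bool) : Finite (D.Circle ε) :=
  inferInstanceAs (Finite (Quot (D.Adj ε)))

noncomputable instance (ε : Fin D.n → Bool) : Fintype (D.Circle ε) := Fintype.ofFinite _

/-- The number `|ε|` of crossings with a `1`-resolution. -/
def height (ε : Fin D.n → Bool) : ℕ := (Finset.univ.filter fun c => ε c = true).card

/-- The standard basis of the direct sum over all `ε` of `V_ε`, where `V_ε` is the tensor product
of copies of `V` over the circles of `ε`: a basis vector of `V_ε` labels each circle by `1` or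
`X`. -/
def Basis : Type := Σ ε : Fin D.n → Bool, (D.Circle ε → Gen)

instance : Finite D.Basis :=
  inferInstanceAs (Finite (Σ ε : Fin D.n → Bool, (D.Circle ε → Gen)))

/-- The degree of a basis vector in `V_ε{|ε|}`. -/
noncomputable def qdeg (x : D.Basis) : ℤ := D.height x.1 + ∑ γ, (x.2 γ).deg

/-- The basis of `C^{i,j}(D)`, the part of degree `j` of the direct sum of the `V_ε{i}` with
`|ε| = i`. -/
def BasisAt (i j : ℤ) : Type := {x : D.Basis // (D.height x.1 : ℤ) = i ∧ D.qdeg x = j}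

instance (i j : ℤ) : Finite (D.BasisAt i j) :=
  inferInstanceAs (Finite {x : D.Basis // (D.height x.1 : ℤ) = i ∧ D.qdeg x = j})

noncomputable instance (i j : ℤ) : Fintype (D.BasisAt i j) := Fintype.ofFinite _

/-- The chain group `C^{i,j}(D)`: the free abelian group on the (finite) set `BasisAt i j`. -/
abbrev Chain (i j : ℤ) : Type := D.BasisAt i j → ℤ

open Classical in
/-- The coefficient of `y` in the image of `x` under the per-edge map at the crossing `c`, which
is changed from `0` to `1`. Circles not passing through `c` keep their labels. If the two strands
at `c` lie on different circles, these merge and the map is `m`; if they lie on one circle, it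
splits and the map is `Δ`. -/
noncomputable def edgeCoeff (c : Fin D.n) (x y : D.Basis) : ℤ :=
  if x.1 c = false ∧ y.1 = Function.update x.1 c true ∧
      ∀ a : D.Pt, D.circ x.1 a ≠ D.circ x.1 (D.nw c) → D.circ x.1 a ≠ D.circ x.1 (D.ne c) →
        y.2 (D.circ y.1 a) = x.2 (D.circ x.1 a) then
    if D.circ x.1 (D.nw c) ≠ D.circ x.1 (D.ne c) then
      mulCoeff (x.2 (D.circ x.1 (D.nw c))) (x.2 (D.circ x.1 (D.ne c)))
        (y.2 (D.circ y.1 (D.nw c)))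
    else if D.circ y.1 (D.nw c) ≠ D.circ y.1 (D.sw c) then
      comulCoeff (x.2 (D.circ x.1 (D.nw c)))
        (y.2 (D.circ y.1 (D.nw c))) (y.2 (D.circ y.1 (D.sw c)))
    else 0
  else 0

/-- The sign `(-1)^f`, where `f` is the number of `1`s of `ε` ordered before `c`. -/
def edgeSign (ε : Fin D.n → Bool) (c : Fin D.n) : ℤ :=
  (-1) ^ (Finset.univ.filter fun k => k < c ∧ ε k = true).card

/-- The component `C^{i,j}(D) → C^{i',j}(D)` of the signed sum of all per-edge maps. Since an edge
raises `|ε|` by one, this is the differential `d^i` if `i' = i + 1`, and zero otherwise. -/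
noncomputable def d (i i' j : ℤ) : D.Chain i j →ₗ[ℤ] D.Chain i' j :=
  Matrix.mulVecLin (Matrix.of fun (y : D.BasisAt i' j) (x : D.BasisAt i j) =>
    ∑ c : Fin D.n, D.edgeSign x.1.1 c * D.edgeCoeff c x.1 y.1)

/-- The unnormalized Khovanov homology `H^{i,j}(D) = ker d^i / im d^{i-1}` in degree `j`. -/
abbrev H (i j : ℤ) : Type :=
  LinearMap.ker (D.d i (i + 1) j) ⧸
    (LinearMap.range (D.d (i - 1) i j)).submoduleOf (LinearMap.ker (D.d i (i + 1) j))

end Diagram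

/-- The diagram of the closure of the positive braid word `w` on `p` strands; the letter `i`
(counted from `0`) lets the strands in positions `i` and `i + 1` cross. The marked points are the
strand positions at the levels `0, …, w.length` above, between and below the letters. The
crossings are ordered as in the word. The `0`-resolution of a positive crossing consists of two
vertical strands, its `1`-resolution of a cup and a cap. -/
def braidClosure (p : ℕ) (w : List (Fin (p - 1))) : Diagram where
  Pt := Fin (w.length + 1) × Fin p
  finite_pt := inferInstance
  arc a b :=
    (∃ k : Fin w.length, a.1 = k.castSucc ∧ b.1 = k.succ ∧ a.2 = b.2 ∧
      (a.2 : ℕ) ≠ (w.get k : ℕ) ∧ (a.2 : ℕ) ≠ (w.get k : ℕ) + 1) ∨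
    (a.1 = Fin.last w.length ∧ b.1 = 0 ∧ a.2 = b.2)
  n := w.length
  nw k := (k.castSucc, ⟨w.get k, by have := (w.get k).isLt; omega⟩)
  ne k := (k.castSucc, ⟨w.get k + 1, by have := (w.get k).isLt; omega⟩)
  sw k := (k.succ, ⟨w.get k, by have := (w.get k).isLt; omega⟩)
  se k := (k.succ, ⟨w.get k + 1, by have := (w.get k).isLt; omega⟩)

/-- The standard diagram `D_{p,q}` of the torus link `T_{p,q}`: the closure of the `p`-strand
braid `(σ_1 σ_2 ⋯ σ_{p-1})^q`. -/
def torusDiagram (p q : ℕ) : Diagram :=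
  braidClosure p (List.replicate q (List.finRange (p - 1))).flatten

end Khovanov

/-! ### Homological algebra of complexes with a basis -/

namespace Khovanov

/-! Put M = p - 2 and let Δ = σ_0 σ_1 ⋯ σ_M be the full staircase, so that D_{p,q} is the closure of
Δ^q. The 0-resolution of a letter σ_k deletes it; its 1-resolution replaces it by a turnback U_k.
The 1-resolved part of the complex is a subcomplex with the 0-resolved part as quotient. Hence σ_k
may be deleted without changing H^i as soon as the word with U_k in its place has no homology in
degrees i and i+1 (`whom_resolve_zero`). The theorem thus reduces to vanishing statements for words
that contain a turnback.

Such words simplify by Gaussian elimination (`Based.elim`) of a small circle between two turnbacks.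
The word σ_k U_k becomes U_k at the cost of a homological shift by one (`whom_absorb`). The word σ_k
σ_l U_k with |k - l| = 1 becomes U_l U_k in the same homological degree, and its mirror image
behaves alike (`whom_slide_down`, `whom_slide_up`). Measure degrees relative to the number of
turnbacks, below which there are no chains. Then both moves enlarge the range of vanishing by one.
Consequently a turnback behind a staircase gains one degree per staircase
(`TurnVanishes.staircase`), and U_M behind Δ σ_0 ⋯ σ_{M-1} gains M+1 while turning into U_0 ⋯ U_M
(`Vanishes.two_staircases`).

For (1), delete the letters of the last staircase of Δ^q one at a time. The word to be killed is
Δ^{q-1} U_k r. Here U_k travels leftwards through M-k staircases and becomes U_M (`vanishes_push`).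
The two staircases now in front of it gain M+2 degrees, and the other q-3 gain one each, which makes
M+q-1 = p+q-3 (`vanishes_last_block`). Part (2) is (1) applied repeatedly, since i < 2p-1 is within
range at each stage.

For (3), delete σ_M from all staircases of Δ^p but the first, starting with the last one. Each
deletion is justified in degrees i < 2M+1 = 2p-3 by `vanishes_short_blocks`. There remains a diagram
of D_{p-1,p} with one additional kink, and `whom_kink` removes the kink together with the last
strand, which shifts the quantum degree by one.

Three general facts support these moves. Resolutions of a braid closure can be oriented with
alternating columns, so every edge of the cube is a merge or a split (`good_braidClosure`). Edge
maps are linear over the action of X on all circles and are therefore determined by the unit, which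
yields commuting squares (`Diagram.Good.square`). Sign conventions coming from different orders of
the crossings differ by a gauge (`Diagram.exists_face_gauge`). -/

/-- Two subquotients are isomorphic if a linear map matches cycles and boundaries. -/
theorem nonempty_subquotient_equiv {M N : Type*} [AddCommGroup M] [AddCommGroup N]
    {Z Bd : Submodule ℤ M} {Z' Bd' : Submodule ℤ N} (T : M →ₗ[ℤ] N)
    (h1 : ∀ z ∈ Z, T z ∈ Z') (h2 : ∀ z ∈ Z, T z ∈ Bd' ↔ z ∈ Bd)
    (h3 : ∀ z' ∈ Z', ∃ z ∈ Z, z' - T z ∈ Bd') :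
    Nonempty ((Z ⧸ Bd.submoduleOf Z) ≃ₗ[ℤ] (Z' ⧸ Bd'.submoduleOf Z')) := by
  let g : Z →ₗ[ℤ] Z' := T.restrict h1
  have hle : Bd.submoduleOf Z ≤ (Bd'.submoduleOf Z').comap g := by
    intro z hz
    exact (h2 z z.2).2 hz
  refine ⟨LinearEquiv.ofBijective (Submodule.mapQ _ _ g hle) ⟨?_, ?_⟩⟩
  · rw [← LinearMap.ker_eq_bot, LinearMap.ker_eq_bot']
    intro m hm
    obtain ⟨z, rfl⟩ := Submodule.Quotient.mk_surjective _ m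
    rw [Submodule.mapQ_apply, Submodule.Quotient.mk_eq_zero] at hm
    rw [Submodule.Quotient.mk_eq_zero]
    exact (h2 z z.2).1 hm
  · intro m
    obtain ⟨z, rfl⟩ := Submodule.Quotient.mk_surjective _ m
    obtain ⟨y, hy, hyz⟩ := h3 z z.2
    refine ⟨Submodule.Quotient.mk ⟨y, hy⟩, ?_⟩
    rw [Submodule.mapQ_apply, eq_comm, Submodule.Quotient.eq]
    exact hyz

/-- A finite set graded by a homological and a quantum degree, with the coefficients of an
endomorphism of the free abelian group on it. -/
structure Based where
  B : Type
  finite_B : Finite B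
  ht : B → ℤ
  qd : B → ℤ
  coeff : B → B → ℤ

namespace Based

attribute [instance] Based.finite_B

variable (C : Based)

noncomputable instance : Fintype C.B := Fintype.ofFinite _

open Classical in
/-- Restriction of a chain to a set of basis elements. -/
noncomputable def proj (S : Set C.B) : (C.B → ℤ) →ₗ[ℤ] (C.B → ℤ) where
  toFun f x := if x ∈ S then f x else 0
  map_add' f g := by ext x; by_cases h : x ∈ S <;> simp [h]
  map_smul' r f := by ext x; by_cases h : x ∈ S <;> simp [h]

open Classical in
/-- The differential of the subquotient spanned by a set of basis elements. -/
noncomputable def diff (S : Set C.B) : (C.B → ℤ) →ₗ[ℤ] (C.B → ℤ) :=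
  Matrix.mulVecLin (Matrix.of fun y x => if x ∈ S ∧ y ∈ S then C.coeff x y else 0)

/-- Chains of bidegree `(i, j)` supported in `S`. -/
def grp (S : Set C.B) (i j : ℤ) : Submodule ℤ (C.B → ℤ) where
  carrier := {f | ∀ x, f x ≠ 0 → x ∈ S ∧ C.ht x = i ∧ C.qd x = j}
  zero_mem' x hx := absurd rfl hx
  add_mem' {f g} hf hg x hx := by
    by_cases h : f x = 0
    · exact hg x fun h' => hx (by simp [h, h'])
    · exact hf x h
  smul_mem' r f hf x hx := hf x fun h => hx (by simp [h])

noncomputable def cyc (S : Set C.B) (i j : ℤ) : Submodule ℤ (C.B → ℤ) :=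
  C.grp S i j ⊓ LinearMap.ker (C.diff S)

noncomputable def bdry (S : Set C.B) (i j : ℤ) : Submodule ℤ (C.B → ℤ) :=
  (C.grp S (i - 1) j).map (C.diff S)

/-- The homology of the subquotient spanned by `S`. -/
abbrev Hom (S : Set C.B) (i j : ℤ) : Type :=
  C.cyc S i j ⧸ (C.bdry S i j).submoduleOf (C.cyc S i j)

/-- The coefficients between elements of `S` have bidegree `(1, 0)`. -/
def Homogeneous (S : Set C.B) : Prop :=
  ∀ x ∈ S, ∀ y ∈ S, C.coeff x y ≠ 0 → C.ht y = C.ht x + 1 ∧ C.qd y = C.qd x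

def SqZero (S : Set C.B) : Prop := ∀ f, C.diff S (C.diff S f) = 0

variable {C} {S : Set C.B}

open Classical in
theorem proj_apply (f : C.B → ℤ) (x : C.B) : C.proj S f x = if x ∈ S then f x else 0 := rfl

theorem proj_mem {f : C.B → ℤ} {x : C.B} (h : x ∈ S) : C.proj S f x = f x := by
  simp [proj_apply, h]

theorem proj_not_mem {f : C.B → ℤ} {x : C.B} (h : x ∉ S) : C.proj S f x = 0 := by
  simp [proj_apply, h]

open Classical in
theorem diff_apply (f : C.B → ℤ) (y : C.B) :
    C.diff S f y = ∑ x, (if x ∈ S ∧ y ∈ S then C.coeff x y else 0) * f x := rfl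

theorem diff_not_mem {f : C.B → ℤ} {y : C.B} (h : y ∉ S) : C.diff S f y = 0 := by
  simp [diff_apply, h]

open Classical in
theorem diff_mem {f : C.B → ℤ} {y : C.B} (h : y ∈ S) :
    C.diff S f y = ∑ x, (if x ∈ S then C.coeff x y * f x else 0) := by
  simp [diff_apply, h]

theorem grp_mono {T : Set C.B} (h : S ⊆ T) {i j : ℤ} : C.grp S i j ≤ C.grp T i j :=
  fun _ hf x hx => ⟨h (hf x hx).1, (hf x hx).2⟩

theorem proj_eq_self {f : C.B → ℤ} {i j : ℤ} (hf : f ∈ C.grp S i j) : C.proj S f = f := by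
  ext x
  by_cases h : x ∈ S
  · exact proj_mem h
  · rw [proj_not_mem h]
    by_contra h'
    exact h (hf x (Ne.symm h')).1

theorem proj_grp {T : Set C.B} (f : C.B → ℤ) {i j : ℤ} (hf : f ∈ C.grp S i j) :
    C.proj T f ∈ C.grp T i j := by
  intro x hx
  by_cases h : x ∈ T
  · rw [proj_mem h] at hx
    exact ⟨h, (hf x hx).2⟩
  · exact absurd (proj_not_mem h) hx

theorem diff_grp (hS : C.Homogeneous S) {f : C.B → ℤ} {i j : ℤ} (hf : f ∈ C.grp S i j) :
    C.diff S f ∈ C.grp S (i + 1) j := by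
  classical
  intro y hy
  have hyS : y ∈ S := by
    by_contra h
    exact hy (diff_not_mem h)
  rw [diff_mem hyS] at hy
  obtain ⟨x, -, hx⟩ := Finset.exists_ne_zero_of_sum_ne_zero hy
  by_cases hxS : x ∈ S
  · rw [if_pos hxS] at hx
    obtain ⟨h1, h2⟩ := hS x hxS y hyS (left_ne_zero_of_mul hx)
    obtain ⟨-, h3, h4⟩ := hf x (right_ne_zero_of_mul hx)
    exact ⟨hyS, by omega, by omega⟩
  · simp [hxS] at hx

/-- The differential of a smaller set is the compression of that of a larger one. -/
theorem diff_subset {T : Set C.B} (h : T ⊆ S) (f : C.B → ℤ) :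
    C.diff T f = C.proj T (C.diff S (C.proj T f)) := by
  classical
  ext y
  by_cases hy : y ∈ T
  · rw [proj_mem hy, diff_mem hy, diff_mem (h hy)]
    refine Finset.sum_congr rfl fun x _ => ?_
    by_cases hx : x ∈ T
    · simp [hx, h hx, proj_apply]
    · simp [hx, proj_apply]
  · rw [proj_not_mem hy, diff_not_mem hy]

theorem subsingleton_hom_iff {i j : ℤ} :
    Subsingleton (C.Hom S i j) ↔ C.cyc S i j ≤ C.bdry S i j := by
  rw [Submodule.Quotient.subsingleton_iff, Submodule.submoduleOf_eq_top]

/-- Gaussian elimination of a matching `φ : P ≃ Q`. -/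
theorem elim {M P Q : Set C.B} (hS : C.Homogeneous S) (hd : C.SqZero S)
    (hcov : ∀ x, x ∈ S ↔ x ∈ M ∨ x ∈ P ∨ x ∈ Q) (hMP : ∀ x ∈ M, x ∉ P) (hMQ : ∀ x ∈ M, x ∉ Q)
    (hPQ : ∀ x ∈ P, x ∉ Q) (φ ψ : C.B → C.B) (hφ : ∀ x ∈ P, φ x ∈ Q) (hψ : ∀ x ∈ Q, ψ x ∈ P)
    (hψφ : ∀ x ∈ P, ψ (φ x) = x) (hφψ : ∀ x ∈ Q, φ (ψ x) = x)
    (hunit : ∀ x ∈ P, C.coeff x (φ x) * C.coeff x (φ x) = 1)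
    (hoff : ∀ x ∈ P, ∀ y ∈ Q, y ≠ φ x → C.coeff x y = 0)
    (hzig : ∀ m ∈ M, ∀ x ∈ P, ∀ m' ∈ M, C.coeff m (φ x) * C.coeff x m' = 0) (i j : ℤ) :
    Nonempty (C.Hom M i j ≃ₗ[ℤ] C.Hom S i j) := by
  classical
  have hMS : M ⊆ S := fun x hx => (hcov x).2 (Or.inl hx)
  have hPS : P ⊆ S := fun x hx => (hcov x).2 (Or.inr (Or.inl hx))
  have hQS : Q ⊆ S := fun x hx => (hcov x).2 (Or.inr (Or.inr hx))
  -- `h` inverts the block of the differential from `P` to `Q`: this block is diagonal along `φ`,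
  -- with entries ±1 that are their own inverses.
  let h : (C.B → ℤ) →ₗ[ℤ] (C.B → ℤ) :=
    { toFun := fun f x => if x ∈ P then C.coeff x (φ x) * f (φ x) else 0
      map_add' := fun f g => by ext x; by_cases hx : x ∈ P <;> simp [hx, mul_add]
      map_smul' := fun r f => by ext x; by_cases hx : x ∈ P <;> simp [hx, mul_left_comm] }
  have hP : ∀ f x, x ∈ P → h f x = C.coeff x (φ x) * f (φ x) := fun f x hx => if_pos hx
  have hnP : ∀ f x, x ∉ P → h f x = 0 := fun f x hx => if_neg hx
  have hgrp : ∀ f i j, f ∈ C.grp S i j → h f ∈ C.grp S (i - 1) j := by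
    intro f i j hf x hx
    have hxP : x ∈ P := by
      by_contra hxP
      exact hx (hnP f x hxP)
    rw [hP f x hxP] at hx
    obtain ⟨h1, h2⟩ := hS x (hPS hxP) (φ x) (hQS (hφ x hxP)) (left_ne_zero_of_mul hx)
    obtain ⟨-, h3, h4⟩ := hf _ (right_ne_zero_of_mul hx)
    exact ⟨hPS hxP, by omega, by omega⟩
  set d := C.diff S with hd_def
  have H1 : ∀ f, ∀ q ∈ Q, d (h f) q = f q := by
    intro f q hq
    rw [hd_def, diff_mem (hQS hq), Finset.sum_eq_single (ψ q)]
    · have := hψ q hq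
      rw [if_pos (hPS this), hP f _ this]
      have h2 := hunit _ this
      rw [hφψ q hq] at h2 ⊢
      rw [← mul_assoc, h2, one_mul]
    · intro x _ hx
      by_cases hxP : x ∈ P
      · rw [if_pos (hPS hxP), hoff x hxP q hq, zero_mul]
        rintro rfl
        exact hx (hψφ x hxP).symm
      · rw [hnP f x hxP]; simp
    · simp
  have H2 : ∀ f, ∀ x ∈ P, h (d (C.proj P f)) x = f x := by
    intro f x hx
    rw [hP _ x hx, hd_def, diff_mem (hQS (hφ x hx)), Finset.sum_eq_single x]
    · rw [if_pos (hPS hx), proj_mem hx, ← mul_assoc, hunit x hx, one_mul]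
    · intro y _ hy
      by_cases hyP : y ∈ P
      · rw [if_pos (hPS hyP), hoff y hyP _ (hφ x hx), zero_mul]
        intro h'
        exact hy (by rw [← hψφ y hyP, ← h', hψφ x hx])
      · rw [proj_not_mem hyP]; simp
    · simp
  -- In general, elimination adds this zigzag term to the differential on `M`. By `hzig` it
  -- vanishes, so the reduced differential is the plain compression of `d` to `M`.
  have H4 : ∀ f, ∀ m ∈ M, d (h (d (C.proj M f))) m = 0 := by
    intro f m' hm'
    rw [hd_def, diff_mem (hMS hm')]
    refine Finset.sum_eq_zero fun x _ => ?_
    by_cases hx : x ∈ P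
    · rw [if_pos (hPS hx), hP _ x hx, diff_mem (hQS (hφ x hx)), Finset.mul_sum, Finset.mul_sum]
      refine Finset.sum_eq_zero fun m _ => ?_
      by_cases hm : m ∈ M
      · have := hzig m hm x hx m' hm'
        rw [if_pos (hMS hm), proj_mem hm]
        linear_combination (C.coeff x (φ x) * f m) * this
      · rw [proj_not_mem hm]; simp
    · rw [hnP _ x hx]; simp
  have hcongr : ∀ f g, (∀ q ∈ Q, f q = g q) → h f = h g := by
    intro f g hfg
    ext x
    by_cases hx : x ∈ P
    · rw [hP f x hx, hP g x hx, hfg _ (hφ x hx)]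
    · rw [hnP f x hx, hnP g x hx]
  -- A chain on `M` is completed by the unique chain on `P` that cancels the `Q`-component of its
  -- boundary.
  let T : (C.B → ℤ) →ₗ[ℤ] (C.B → ℤ) := C.proj M - h ∘ₗ d ∘ₗ C.proj M
  have hT : ∀ f, T f = C.proj M f - h (d (C.proj M f)) := fun f => rfl
  have hTM : ∀ f, ∀ m ∈ M, d (T f) m = d (C.proj M f) m := by
    intro f m hm
    rw [hT, map_sub, Pi.sub_apply, H4 f m hm, sub_zero]
  have hTQ : ∀ f, ∀ q ∈ Q, d (T f) q = 0 := by
    intro f q hq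
    rw [hT, map_sub, Pi.sub_apply, H1 _ q hq, sub_self]
  -- Chains for which neither `c` nor `d c` has a `Q`-component form the image of `T`: the `P`-part
  -- is forced by the `M`-part, because the block from `P` to `Q` is invertible.
  have key : ∀ c, (∀ x, x ∉ S → c x = 0) → (∀ q ∈ Q, c q = 0) → (∀ q ∈ Q, d c q = 0) →
      c = T c := by
    intro c hcS hcQ hdc
    have hc : c = C.proj M c + C.proj P c := by
      ext x
      by_cases hxM : x ∈ M
      · simp [proj_mem hxM, proj_not_mem (hMP x hxM)]
      · by_cases hxP : x ∈ P
        · simp [proj_mem hxP, proj_not_mem hxM]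
        · rw [Pi.add_apply, proj_not_mem hxM, proj_not_mem hxP, add_zero]
          by_cases hxQ : x ∈ Q
          · exact hcQ x hxQ
          · refine hcS x fun hx => ?_
            rcases (hcov x).1 hx with h | h | h <;> contradiction
    have h0 : h (d c) = 0 := by
      rw [hcongr (d c) 0 hdc, map_zero]
    have h1 : h (d (C.proj P c)) = C.proj P c := by
      ext x
      by_cases hx : x ∈ P
      · rw [H2 c x hx, proj_mem hx]
      · rw [hnP _ x hx, proj_not_mem hx]
    have h2 : h (d (C.proj M c)) + C.proj P c = 0 := by
      rw [← h1, ← map_add, ← map_add, ← hc, h0]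
    rw [hT]
    nth_rewrite 1 [hc]
    rw [← sub_eq_zero] at *
    linear_combination h2
  have hTgrp : ∀ i j f, f ∈ C.grp M i j → T f ∈ C.grp S i j := by
    intro i j f hf
    rw [hT, proj_eq_self hf]
    have hf' := grp_mono hMS hf
    have := hgrp _ _ _ (diff_grp hS hf')
    rw [add_sub_cancel_right] at this
    exact Submodule.sub_mem _ hf' this
  have hTproj : ∀ f, T (C.proj M f) = T f := by
    intro f
    have : C.proj M (C.proj M f) = C.proj M f := by
      ext x
      by_cases hx : x ∈ M
      · rw [proj_mem hx]
      · rw [proj_not_mem hx, proj_not_mem hx]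
    rw [hT, hT, this]
  have hout : ∀ f i j, f ∈ C.grp S i j → ∀ x, x ∉ S → f x = 0 := by
    intro f i j hf x hx
    by_contra h'
    exact hx (hf x h').1
  have hdd : ∀ f, d (d f) = 0 := hd
  have hTmem : ∀ f, ∀ q ∈ Q, T f q = 0 := by
    intro f q hq
    rw [hT, Pi.sub_apply, proj_not_mem fun h' => hMQ q h' hq,
      hnP _ q fun h' => hPQ q h' hq, sub_zero]
  have hTmemM : ∀ f, ∀ m ∈ M, T f m = f m := by
    intro f m hm
    rw [hT, Pi.sub_apply, proj_mem hm, hnP _ m (hMP m hm), sub_zero]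
  refine nonempty_subquotient_equiv T ?_ ?_ ?_
  · rintro z ⟨hz, hdz⟩
    refine ⟨hTgrp i j z hz, ?_⟩
    have hdz' : ∀ m ∈ M, d z m = 0 := by
      intro m hm
      have := congrFun (show C.diff M z = 0 from hdz) m
      rwa [diff_subset hMS, proj_eq_self hz, proj_mem hm] at this
    have hk := key (d (T z)) (fun x hx => diff_not_mem hx) (hTQ z) (fun q _ => by rw [hdd]; rfl)
    have hM : C.proj M (d (T z)) = 0 := by
      ext m
      by_cases hm : m ∈ M
      · rw [proj_mem hm, hTM z m hm, proj_eq_self hz, hdz' m hm]; rfl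
      · rw [proj_not_mem hm]; rfl
    rw [← hTproj (d (T z)), hM, map_zero] at hk
    exact hk
  · intro z hz
    constructor
    · rintro ⟨y, hy, hyz⟩
      -- Subtracting `d (h y)` leaves the boundary unchanged and removes the `Q`-component of `y`.
      have hy' : y - d (h y) ∈ C.grp S (i - 1) j := by
        refine Submodule.sub_mem _ hy ?_
        have := diff_grp hS (hgrp _ _ _ hy)
        rwa [sub_add_cancel] at this
      have hdy : d (y - d (h y)) = T z := by rw [map_sub, hdd, sub_zero, hyz]
      have hk := key (y - d (h y)) (hout _ _ _ hy')
        (fun q hq => by rw [Pi.sub_apply, H1 y q hq, sub_self])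
        (fun q hq => by rw [hdy, hTmem z q hq])
      refine ⟨C.proj M (y - d (h y)), proj_grp _ hy', ?_⟩
      ext m
      by_cases hm : m ∈ M
      · rw [diff_subset hMS, proj_mem hm, proj_eq_self (proj_grp _ hy'), ← hTM _ m hm, ← hk, hdy,
          hTmemM z m hm]
      · rw [diff_not_mem hm]
        by_contra h'
        exact hm (hz.1 m (Ne.symm h')).1
    · rintro ⟨y, hy, rfl⟩
      refine ⟨T y, hTgrp _ _ _ hy, ?_⟩
      have hk := key (d (T y)) (fun x hx => diff_not_mem hx) (hTQ y) (fun q _ => by rw [hdd]; rfl)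
      show d (T y) = _
      rw [hk, ← hTproj (d (T y))]
      congr 1
      ext m
      by_cases hm : m ∈ M
      · rw [proj_mem hm, hTM y m hm, diff_subset hMS, proj_mem hm]
      · rw [proj_not_mem hm, diff_not_mem hm]
  · rintro z ⟨hz, hdz⟩
    have hdz' : d z = 0 := hdz
    -- A cycle `z` is homologous to `z - d (h z)`, which has no `Q`-component and hence lies in the
    -- image of `T`.
    have hdh : d (h z) ∈ C.grp S i j := by
      have := diff_grp hS (hgrp _ _ _ hz)
      rwa [sub_add_cancel] at this
    have hz' : z - d (h z) ∈ C.grp S i j := Submodule.sub_mem _ hz hdh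
    have hd0 : d (z - d (h z)) = 0 := by rw [map_sub, hdd, hdz', sub_zero]
    have hk := key (z - d (h z)) (hout _ _ _ hz')
      (fun q hq => by rw [Pi.sub_apply, H1 z q hq, sub_self])
      (fun q hq => by rw [hd0]; rfl)
    refine ⟨C.proj M (z - d (h z)), ⟨proj_grp _ hz', ?_⟩, ?_⟩
    · show C.diff M _ = 0
      ext m
      by_cases hm : m ∈ M
      · rw [diff_subset hMS, proj_mem hm, proj_eq_self (proj_grp _ hz'), ← hTM _ m hm, ← hk, hd0]
      · rw [diff_not_mem hm]; rfl
    · rw [hTproj, ← hk, sub_sub_cancel]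
      exact ⟨h z, hgrp _ _ _ hz, rfl⟩

section Cone

variable {S₀ S₁ : Set C.B}

/-- If `S₁` spans an exact subcomplex, the homology is that of the quotient. -/
theorem cone (hS : C.Homogeneous S) (hd : C.SqZero S)
    (hcov : ∀ x, x ∈ S ↔ x ∈ S₀ ∨ x ∈ S₁) (hdisj : ∀ x ∈ S₀, x ∉ S₁)
    (hsub : ∀ x ∈ S₁, ∀ y ∈ S₀, C.coeff x y = 0) {i j : ℤ}
    (h0 : Subsingleton (C.Hom S₁ i j)) (h1 : Subsingleton (C.Hom S₁ (i + 1) j)) :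
    Nonempty (C.Hom S i j ≃ₗ[ℤ] C.Hom S₀ i j) := by
  classical
  have hS0 : S₀ ⊆ S := fun x hx => (hcov x).2 (Or.inl hx)
  have hS1 : S₁ ⊆ S := fun x hx => (hcov x).2 (Or.inr hx)
  rw [subsingleton_hom_iff] at h0 h1
  have hdd : ∀ f, C.diff S (C.diff S f) = 0 := hd
  have hquot : ∀ f, C.diff S₀ (C.proj S₀ f) = C.proj S₀ (C.diff S f) := by
    intro f
    ext y
    by_cases hy : y ∈ S₀
    · rw [proj_mem hy, diff_mem hy, diff_mem (hS0 hy)]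
      refine Finset.sum_congr rfl fun x _ => ?_
      by_cases hx : x ∈ S₀
      · rw [if_pos hx, if_pos (hS0 hx), proj_mem hx]
      · rw [if_neg hx]
        by_cases hx1 : x ∈ S
        · rw [if_pos hx1, hsub x (((hcov x).1 hx1).resolve_left hx) y hy, zero_mul]
        · rw [if_neg hx1]
    · rw [proj_not_mem hy, diff_not_mem hy]
  have hincl : ∀ f i j, f ∈ C.grp S₁ i j → C.diff S₁ f = C.diff S f := by
    intro f i j hf
    ext y
    by_cases hy : y ∈ S₁
    · rw [diff_subset hS1, proj_mem hy, proj_eq_self hf]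
    · rw [diff_not_mem hy]
      by_cases hyS : y ∈ S
      · rw [diff_mem hyS]
        refine (Finset.sum_eq_zero fun x _ => ?_).symm
        by_cases hx : f x = 0
        · simp [hx]
        · rw [hsub x (hf x hx).1 y (((hcov y).1 hyS).resolve_right hy)]; simp
      · rw [diff_not_mem hyS]
  have hpart : ∀ f i j, f ∈ C.grp S i j → C.proj S₀ f = 0 → f ∈ C.grp S₁ i j := by
    intro f i j hf h x hx
    obtain ⟨h1, h2⟩ := hf x hx
    refine ⟨((hcov x).1 h1).resolve_left fun h3 => hx ?_, h2⟩
    rw [← proj_mem (f := f) h3, h]; rfl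
  refine nonempty_subquotient_equiv (C.proj S₀) ?_ ?_ ?_
  · rintro z ⟨hz, hdz⟩
    refine ⟨proj_grp _ hz, ?_⟩
    show C.diff S₀ _ = 0
    rw [hquot, show C.diff S z = 0 from hdz, map_zero]
  · rintro z ⟨hz, hdz⟩
    constructor
    · rintro ⟨y, hy, hyz⟩
      have hy' := grp_mono hS0 hy
      have hdy : C.diff S y ∈ C.grp S i j := by
        have := diff_grp hS hy'
        rwa [sub_add_cancel] at this
      have h2 : z - C.diff S y ∈ C.grp S₁ i j := by
        refine hpart _ _ _ (Submodule.sub_mem _ hz hdy) ?_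
        rw [map_sub, ← hquot, proj_eq_self hy, hyz, sub_self]
      have h3 : z - C.diff S y ∈ C.cyc S₁ i j := by
        refine ⟨h2, ?_⟩
        show C.diff S₁ _ = 0
        rw [hincl _ _ _ h2, map_sub, hdd, show C.diff S z = 0 from hdz, sub_zero]
      -- Exactness of the subcomplex in degree `i` gives injectivity.
      obtain ⟨w, hw, hwz⟩ := h0 h3
      refine ⟨w + y, Submodule.add_mem _ (grp_mono hS1 hw) hy', ?_⟩
      rw [map_add, ← hincl _ _ _ hw, hwz, sub_add_cancel]
    · rintro ⟨y, hy, rfl⟩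
      exact ⟨C.proj S₀ y, proj_grp _ hy, hquot y⟩
  · rintro z ⟨hz, hdz⟩
    have hz' := grp_mono hS0 hz
    have h2 : C.diff S z ∈ C.grp S₁ (i + 1) j := by
      refine hpart _ _ _ (diff_grp hS hz') ?_
      rw [← hquot, proj_eq_self hz]
      exact hdz
    have h3 : C.diff S z ∈ C.cyc S₁ (i + 1) j := by
      refine ⟨h2, ?_⟩
      show C.diff S₁ _ = 0
      rw [hincl _ _ _ h2, hdd]
    -- Exactness in degree `i + 1` gives surjectivity: a cycle of the quotient is corrected to a
    -- cycle of the whole complex.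
    obtain ⟨w, hw, hwz⟩ := h1 h3
    rw [add_sub_cancel_right] at hw
    refine ⟨z - w, ⟨Submodule.sub_mem _ hz' (grp_mono hS1 hw), ?_⟩, ?_⟩
    · show C.diff S _ = 0
      rw [map_sub, ← hincl _ _ _ hw, hwz, sub_self]
    · have : C.proj S₀ w = 0 := by
        ext x
        by_cases hx : x ∈ S₀
        · rw [proj_mem hx]
          by_contra h'
          exact hdisj x hx (hw x h').1
        · rw [proj_not_mem hx]; rfl
      rw [map_sub, this, sub_zero, proj_eq_self hz, sub_self]
      exact Submodule.zero_mem _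

/-- This is exactness at the middle term of the long exact sequence. A boundary is subtracted to
kill the `S₀`-part of a cycle; what is left is a cycle of the subcomplex `S₁`, hence a boundary
there. -/
theorem cone_subsingleton (hS : C.Homogeneous S) (hd : C.SqZero S)
    (hcov : ∀ x, x ∈ S ↔ x ∈ S₀ ∨ x ∈ S₁)
    (hsub : ∀ x ∈ S₁, ∀ y ∈ S₀, C.coeff x y = 0) {i j : ℤ}
    (h0 : Subsingleton (C.Hom S₀ i j)) (h1 : Subsingleton (C.Hom S₁ i j)) :
    Subsingleton (C.Hom S i j) := by
  classical
  have hS0 : S₀ ⊆ S := fun x hx => (hcov x).2 (Or.inl hx)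
  have hS1 : S₁ ⊆ S := fun x hx => (hcov x).2 (Or.inr hx)
  rw [subsingleton_hom_iff] at h0 h1 ⊢
  rintro z ⟨hz, hdz⟩
  have hdd : ∀ f, C.diff S (C.diff S f) = 0 := hd
  have hquot : ∀ f, C.diff S₀ (C.proj S₀ f) = C.proj S₀ (C.diff S f) := by
    intro f
    ext y
    by_cases hy : y ∈ S₀
    · rw [proj_mem hy, diff_mem hy, diff_mem (hS0 hy)]
      refine Finset.sum_congr rfl fun x _ => ?_
      by_cases hx : x ∈ S₀
      · rw [if_pos hx, if_pos (hS0 hx), proj_mem hx]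
      · rw [if_neg hx]
        by_cases hx1 : x ∈ S
        · rw [if_pos hx1, hsub x (((hcov x).1 hx1).resolve_left hx) y hy, zero_mul]
        · rw [if_neg hx1]
    · rw [proj_not_mem hy, diff_not_mem hy]
  obtain ⟨y, hy, hyz⟩ := h0 (x := C.proj S₀ z) ⟨proj_grp _ hz, by
    show C.diff S₀ _ = 0
    rw [hquot, show C.diff S z = 0 from hdz, map_zero]⟩
  have hy' := grp_mono hS0 hy
  have hdy : C.diff S y ∈ C.grp S i j := by
    have := diff_grp hS hy'
    rwa [sub_add_cancel] at this
  have hw : z - C.diff S y ∈ C.grp S₁ i j := by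
    intro x hx
    obtain ⟨h2, h3⟩ := Submodule.sub_mem _ hz hdy x hx
    refine ⟨((hcov x).1 h2).resolve_left fun h4 => hx ?_, h3⟩
    have := congrFun hyz x
    rw [← proj_eq_self hy, hquot, proj_mem h4, proj_mem h4] at this
    rw [Pi.sub_apply, this, sub_self]
  have hincl : ∀ f i j, f ∈ C.grp S₁ i j → C.diff S₁ f = C.proj S₁ (C.diff S f) := by
    intro f i j hf
    rw [diff_subset hS1, proj_eq_self hf]
  have hdw : C.diff S (z - C.diff S y) = 0 := by
    rw [map_sub, hdd, show C.diff S z = 0 from hdz, sub_zero]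
  obtain ⟨w, hw1, hw2⟩ := h1 (x := z - C.diff S y) ⟨hw, by
    show C.diff S₁ _ = 0
    rw [hincl _ _ _ hw, hdw, map_zero]⟩
  refine ⟨w + y, Submodule.add_mem _ (grp_mono hS1 hw1) hy', ?_⟩
  rw [map_add]
  have : C.diff S w = C.diff S₁ w := by
    ext x
    by_cases hx : x ∈ S₁
    · rw [hincl _ _ _ hw1, proj_mem hx]
    · rw [diff_not_mem hx]
      by_cases hxS : x ∈ S
      · rw [diff_mem hxS]
        refine Finset.sum_eq_zero fun x' _ => ?_
        by_cases hx' : w x' = 0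
        · simp [hx']
        · rw [hsub x' (hw1 x' hx').1 x (((hcov x).1 hxS).resolve_right hx)]; simp
      · exact diff_not_mem hxS
  rw [this, hw2, sub_add_cancel]

end Cone

/-- A bijection of bases that preserves coefficients up to a change of signs, and shifts degrees
by constants, gives an isomorphism in homology. -/
theorem compare {C' : Based} {S' : Set C'.B} (e : C.B → C'.B) (e' : C'.B → C.B)
    (he : ∀ x ∈ S, e x ∈ S') (he' : ∀ x ∈ S', e' x ∈ S) (hee' : ∀ x ∈ S, e' (e x) = x)
    (he'e : ∀ x ∈ S', e (e' x) = x) (γ : C.B → ℤ) (hγ : ∀ x, γ x * γ x = 1)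
    (hcoeff : ∀ x ∈ S, ∀ y ∈ S, C'.coeff (e x) (e y) = γ x * γ y * C.coeff x y) {a b : ℤ}
    (hht : ∀ x ∈ S, C'.ht (e x) = C.ht x + a) (hqd : ∀ x ∈ S, C'.qd (e x) = C.qd x + b)
    {i j i' j' : ℤ} (hi : i' = i + a) (hj : j' = j + b) :
    Nonempty (C.Hom S i j ≃ₗ[ℤ] C'.Hom S' i' j') := by
  classical
  let T : (C.B → ℤ) →ₗ[ℤ] (C'.B → ℤ) :=
    { toFun := fun f x => if x ∈ S' then γ (e' x) * f (e' x) else 0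
      map_add' := fun f g => by ext x; by_cases hx : x ∈ S' <;> simp [hx, mul_add]
      map_smul' := fun r f => by ext x; by_cases hx : x ∈ S' <;> simp [hx, mul_left_comm] }
  have hT : ∀ f x, x ∈ S' → T f x = γ (e' x) * f (e' x) := fun f x hx => if_pos hx
  have hnT : ∀ f x, x ∉ S' → T f x = 0 := fun f x hx => if_neg hx
  have hTgrp : ∀ i j f, f ∈ C.grp S i j → T f ∈ C'.grp S' (i + a) (j + b) := by
    intro i j f hf x hx
    have hx' : x ∈ S' := by
      by_contra h
      exact hx (hnT f x h)
    rw [hT f x hx'] at hx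
    obtain ⟨h1, h2, h3⟩ := hf _ (right_ne_zero_of_mul hx)
    have h4 := hht _ h1
    have h5 := hqd _ h1
    rw [he'e x hx'] at h4 h5
    exact ⟨hx', by omega, by omega⟩
  have hTsurj : ∀ i j g, g ∈ C'.grp S' (i + a) (j + b) → ∃ f ∈ C.grp S i j, T f = g := by
    intro i j g hg
    refine ⟨fun x => if x ∈ S then γ x * g (e x) else 0, ?_, ?_⟩
    · intro x hx
      by_cases hxS : x ∈ S
      · simp only [hxS, if_true] at hx
        obtain ⟨h1, h2, h3⟩ := hg _ (right_ne_zero_of_mul hx)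
        have h4 := hht _ hxS
        have h5 := hqd _ hxS
        exact ⟨hxS, by omega, by omega⟩
      · simp [hxS] at hx
    · ext x
      by_cases hx : x ∈ S'
      · rw [hT _ x hx]
        simp only [he' x hx, if_true]
        rw [he'e x hx, ← mul_assoc, hγ, one_mul]
      · rw [hnT _ x hx]
        by_contra h
        exact hx (hg x (Ne.symm h)).1
  -- The sign at the source of a coefficient occurs twice and cancels by `hγ`; the sign at the
  -- target is the one built into `T`.
  have hTd : ∀ f, C'.diff S' (T f) = T (C.diff S f) := by
    intro f
    ext y
    by_cases hy : y ∈ S'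
    · rw [hT _ y hy, diff_mem hy, diff_mem (he' y hy), ← Finset.sum_filter, ← Finset.sum_filter,
        Finset.mul_sum]
      refine Finset.sum_nbij' e' e ?_ ?_ ?_ ?_ ?_
      · intro x hx
        simp only [Finset.mem_filter, Finset.mem_univ, true_and] at hx ⊢
        exact he' x hx
      · intro x hx
        simp only [Finset.mem_filter, Finset.mem_univ, true_and] at hx ⊢
        exact he x hx
      · intro x hx
        simp only [Finset.mem_filter, Finset.mem_univ, true_and] at hx
        exact he'e x hx
      · intro x hx
        simp only [Finset.mem_filter, Finset.mem_univ, true_and] at hx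
        exact hee' x hx
      · intro x hx
        simp only [Finset.mem_filter, Finset.mem_univ, true_and] at hx
        have h1 := hcoeff _ (he' x hx) _ (he' y hy)
        rw [he'e x hx, he'e y hy] at h1
        rw [hT _ x hx, h1]
        linear_combination (γ (e' y) * C.coeff (e' x) (e' y) * f (e' x)) * hγ (e' x)
    · rw [diff_not_mem hy, hnT _ y hy]
  have hTinj : ∀ i j f, f ∈ C.grp S i j → T f = 0 → f = 0 := by
    intro i j f hf h
    ext x
    by_contra hx
    have hxS := (hf x hx).1
    have h1 := congrFun h (e x)
    rw [hT f _ (he x hxS), hee' x hxS] at h1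
    have h2 : γ x ≠ 0 := by
      intro h0
      have := hγ x
      simp [h0] at this
    exact (mul_ne_zero h2 hx) h1
  subst hi hj
  refine nonempty_subquotient_equiv T ?_ ?_ ?_
  · rintro z ⟨hz, hdz⟩
    refine ⟨hTgrp i j z hz, ?_⟩
    show C'.diff S' _ = 0
    rw [hTd, show C.diff S z = 0 from hdz, map_zero]
  · rintro z ⟨hz, hdz⟩
    constructor
    · rintro ⟨y, hy, hyz⟩
      rw [add_sub_right_comm] at hy
      obtain ⟨w, hw, rfl⟩ := hTsurj _ _ y hy
      refine ⟨w, hw, ?_⟩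
      rw [hTd] at hyz
      ext x
      by_cases hx : x ∈ S
      · have h1 := congrFun hyz (e x)
        rw [hT _ _ (he x hx), hT _ _ (he x hx), hee' x hx] at h1
        have h2 : γ x ≠ 0 := by
          intro h0
          have := hγ x
          simp [h0] at this
        exact mul_left_cancel₀ h2 h1
      · rw [diff_not_mem hx]
        by_contra h
        exact hx (hz x (Ne.symm h)).1
    · rintro ⟨y, hy, rfl⟩
      refine ⟨T y, ?_, hTd y⟩
      rw [add_sub_right_comm]
      exact hTgrp _ _ _ hy
  · rintro z ⟨hz, hdz⟩
    obtain ⟨w, hw, rfl⟩ := hTsurj _ _ z hz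
    refine ⟨w, ⟨hw, ?_⟩, by rw [sub_self]; exact Submodule.zero_mem _⟩
    show C.diff S w = 0
    have h1 : T (C.diff S w) = 0 := by rw [← hTd]; exact hdz
    ext x
    by_cases hx : x ∈ S
    · have h2 := congrFun h1 (e x)
      rw [hT _ _ (he x hx), hee' x hx] at h2
      refine (mul_eq_zero.1 h2).resolve_left fun h0 => ?_
      have := hγ x
      simp [h0] at this
    · rw [diff_not_mem hx]; rfl

end Based

end Khovanov

/-! ### Merging and splitting circles -/

namespace Khovanov

namespace Diagram

variable (D : Diagram)

variable {D} in
theorem circ_surjective {ε : Fin D.n → Bool} (γ : D.Circle ε) : ∃ a, D.circ ε a = γ :=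
  Quot.exists_rep γ

variable {D} in
theorem circ_eq_of_adj {ε : Fin D.n → Bool} {a b : D.Pt} (h : D.Adj ε a b) :
    D.circ ε a = D.circ ε b := Quot.sound h

variable {D} in
/-- A function on marked points that is constant along adjacencies is constant on circles. -/
theorem circ_factor {ε : Fin D.n → Bool} {T : Sort*} (F : D.Pt → T)
    (h : ∀ a b, D.Adj ε a b → F a = F b) {a b : D.Pt} (e : D.circ ε a = D.circ ε b) :
    F a = F b := congrArg (Quot.lift F h) e

/-- The circles of `ε'` are those of `ε`, except that the different circles through `p` and `q`
are joined. -/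
structure Joins (ε ε' : Fin D.n → Bool) (p q : D.Pt) : Prop where
  ne : D.circ ε p ≠ D.circ ε q
  iff : ∀ a b, D.circ ε' a = D.circ ε' b ↔ D.circ ε a = D.circ ε b ∨
    (D.circ ε a = D.circ ε p ∧ D.circ ε b = D.circ ε q) ∨
    (D.circ ε a = D.circ ε q ∧ D.circ ε b = D.circ ε p)

/-- Changing a resolution always merges two circles or splits one circle. -/
def Good : Prop :=
  ∀ (ε : Fin D.n → Bool) (c : Fin D.n), ε c = false →
    (D.circ ε (D.nw c) = D.circ ε (D.ne c) ↔
      D.circ (Function.update ε c true) (D.nw c) ≠ D.circ (Function.update ε c true) (D.sw c))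

variable {D}

section Joins

variable {ε ε' : Fin D.n → Bool} {p q : D.Pt}

theorem Joins.of_adj (hne : D.circ ε p ≠ D.circ ε q)
    (h1 : ∀ a b, D.Adj ε a b → D.circ ε' a = D.circ ε' b) (h2 : D.circ ε' p = D.circ ε' q)
    (h3 : ∀ a b, D.Adj ε' a b → D.circ ε a = D.circ ε b ∨
      (D.circ ε a = D.circ ε p ∧ D.circ ε b = D.circ ε q) ∨
      (D.circ ε a = D.circ ε q ∧ D.circ ε b = D.circ ε p)) : D.Joins ε ε' p q := by
  classical
  refine ⟨hne, fun a b => ⟨fun h => ?_, ?_⟩⟩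
  -- This test function renames the circle of `q` to that of `p`. By `h3` it is constant along
  -- adjacencies of `ε'`, hence on circles of `ε'`.
  · have := circ_factor (fun a => if D.circ ε a = D.circ ε q then D.circ ε p else D.circ ε a)
      (fun a b hab => by
        rcases h3 a b hab with h | ⟨h, h'⟩ | ⟨h, h'⟩
        · simp only [h]
        · simp only [h, h', if_true]; simp
        · simp only [h, h', if_true]; simp) h
    by_cases ha : D.circ ε a = D.circ ε q <;> by_cases hb : D.circ ε b = D.circ ε q <;>
      simp only [ha, hb, if_true, if_false] at this ⊢ <;> tauto
  · have h1' : ∀ a b, D.circ ε a = D.circ ε b → D.circ ε' a = D.circ ε' b :=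
      fun a b => circ_factor _ h1
    rintro (h | ⟨h, h'⟩ | ⟨h, h'⟩)
    · exact h1' _ _ h
    · rw [h1' _ _ h, h1' _ _ h', h2]
    · rw [h1' _ _ h, h1' _ _ h', h2]

theorem Joins.symm (h : D.Joins ε ε' p q) : D.Joins ε ε' q p :=
  ⟨h.ne.symm, fun a b => by rw [h.iff]; tauto⟩

theorem Joins.eq (h : D.Joins ε ε' p q) : D.circ ε' p = D.circ ε' q := (h.iff p q).2 (by simp)

theorem Joins.mono (h : D.Joins ε ε' p q) {a b : D.Pt} (hab : D.circ ε a = D.circ ε b) :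
    D.circ ε' a = D.circ ε' b := (h.iff a b).2 (Or.inl hab)

/-- The projection of the circles before joining to those after. -/
def Joins.down (h : D.Joins ε ε' p q) : D.Circle ε → D.Circle ε' :=
  Quot.lift (D.circ ε') fun _ _ hab => h.mono (circ_eq_of_adj hab)

theorem Joins.down_circ (h : D.Joins ε ε' p q) (a : D.Pt) :
    h.down (D.circ ε a) = D.circ ε' a := rfl

open Classical in
/-- The section of `Joins.down` whose image omits the circle of `q`. -/
noncomputable def Joins.up (h : D.Joins ε ε' p q) : D.Circle ε' → D.Circle ε :=
  Quot.lift (fun a => if D.circ ε a = D.circ ε q then D.circ ε p else D.circ ε a)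
    fun a b hab => by
      have := (h.iff a b).1 (circ_eq_of_adj hab)
      rcases this with h | ⟨h, h'⟩ | ⟨h, h'⟩
      · simp only [h]
      · simp only [h, h', if_true]; simp
      · simp only [h, h', if_true]; simp

open Classical in
theorem Joins.up_circ (h : D.Joins ε ε' p q) (a : D.Pt) :
    h.up (D.circ ε' a) = if D.circ ε a = D.circ ε q then D.circ ε p else D.circ ε a := rfl

theorem Joins.up_of_ne (h : D.Joins ε ε' p q) {a : D.Pt} (ha : D.circ ε a ≠ D.circ ε q) :
    h.up (D.circ ε' a) = D.circ ε a := by rw [h.up_circ, if_neg ha]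

theorem Joins.up_left (h : D.Joins ε ε' p q) : h.up (D.circ ε' p) = D.circ ε p :=
  h.up_of_ne h.ne

theorem Joins.up_ne (h : D.Joins ε ε' p q) (γ : D.Circle ε') : h.up γ ≠ D.circ ε q := by
  obtain ⟨a, rfl⟩ := circ_surjective γ
  rw [h.up_circ]
  split_ifs with ha
  · exact h.ne
  · exact ha

theorem Joins.down_up (h : D.Joins ε ε' p q) (γ : D.Circle ε') : h.down (h.up γ) = γ := by
  obtain ⟨a, rfl⟩ := circ_surjective γ
  rw [h.up_circ]
  split_ifs with ha
  · rw [h.down_circ, h.eq, h.mono ha]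
  · rw [h.down_circ]

theorem Joins.up_down (h : D.Joins ε ε' p q) {γ : D.Circle ε} (hγ : γ ≠ D.circ ε q) :
    h.up (h.down γ) = γ := by
  obtain ⟨a, rfl⟩ := circ_surjective γ
  rw [h.down_circ, h.up_of_ne hγ]

open Classical in
/-- The circles before joining are the circle of `q` and the circles after joining. -/
noncomputable def Joins.equiv (h : D.Joins ε ε' p q) : Option (D.Circle ε') ≃ D.Circle ε where
  toFun o := o.elim (D.circ ε q) h.up
  invFun γ := if γ = D.circ ε q then none else some (h.down γ)
  left_inv o := by
    cases o with
    | none => simp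
    | some γ => simp [h.up_ne, h.down_up]
  right_inv γ := by
    by_cases hγ : γ = D.circ ε q
    · simp [hγ]
    · simp [hγ, h.up_down hγ]

theorem Joins.sum (h : D.Joins ε ε' p q) (f : D.Circle ε → ℤ) :
    ∑ γ, f γ = f (D.circ ε q) + ∑ γ, f (h.up γ) := by
  rw [← Equiv.sum_comp h.equiv, Fintype.sum_option]
  rfl

theorem Joins.card (h : D.Joins ε ε' p q) :
    Fintype.card (D.Circle ε) = Fintype.card (D.Circle ε') + 1 := by
  rw [← Fintype.card_congr h.equiv, Fintype.card_option]

end Joins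

section Good

variable {ε : Fin D.n → Bool} {c : Fin D.n}

/-- Since the two strands at `c` lie on different circles, `Good` forbids the new strands to be
separated. All four corners therefore lie on one circle afterwards, and the adjacencies at other
crossings are the same before and after. -/
theorem Good.merge (hD : D.Good) (hc : ε c = false) (h : D.circ ε (D.nw c) ≠ D.circ ε (D.ne c)) :
    D.Joins ε (Function.update ε c true) (D.nw c) (D.ne c) := by
  have hs : D.circ (Function.update ε c true) (D.nw c) =
      D.circ (Function.update ε c true) (D.sw c) := by
    by_contra h'
    exact h ((hD ε c hc).2 h')
  have ht := circ_eq_of_adj (Adj.one_top (D := D) (ε := Function.update ε c true) c (by simp))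
  have hb := circ_eq_of_adj (Adj.one_bot (D := D) (ε := Function.update ε c true) c (by simp))
  have hl := circ_eq_of_adj (Adj.zero_left (D := D) (ε := ε) c hc)
  have hr := circ_eq_of_adj (Adj.zero_right (D := D) (ε := ε) c hc)
  refine Joins.of_adj h ?_ ht ?_
  · rintro a b (hab | ⟨k, hk⟩ | ⟨k, hk⟩ | ⟨k, hk⟩ | ⟨k, hk⟩)
    · exact circ_eq_of_adj (Adj.arc hab)
    · by_cases hkc : k = c
      · subst hkc; exact hs
      · exact circ_eq_of_adj (Adj.zero_left k (by simpa [hkc] using hk))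
    · by_cases hkc : k = c
      · subst hkc; rw [← ht, hs, hb]
      · exact circ_eq_of_adj (Adj.zero_right k (by simpa [hkc] using hk))
    · by_cases hkc : k = c
      · subst hkc; exact ht
      · exact circ_eq_of_adj (Adj.one_top k (by simpa [hkc] using hk))
    · by_cases hkc : k = c
      · subst hkc; exact hb
      · exact circ_eq_of_adj (Adj.one_bot k (by simpa [hkc] using hk))
  · rintro a b (hab | ⟨k, hk⟩ | ⟨k, hk⟩ | ⟨k, hk⟩ | ⟨k, hk⟩)
    · exact Or.inl (circ_eq_of_adj (Adj.arc hab))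
    · by_cases hkc : k = c
      · subst hkc; simp at hk
      · exact Or.inl (circ_eq_of_adj (Adj.zero_left k (by simpa [hkc] using hk)))
    · by_cases hkc : k = c
      · subst hkc; simp at hk
      · exact Or.inl (circ_eq_of_adj (Adj.zero_right k (by simpa [hkc] using hk)))
    · by_cases hkc : k = c
      · subst hkc; simp
      · exact Or.inl (circ_eq_of_adj (Adj.one_top k (by simpa [hkc] using hk)))
    · by_cases hkc : k = c
      · subst hkc; rw [← hl, ← hr]; simp
      · exact Or.inl (circ_eq_of_adj (Adj.one_bot k (by simpa [hkc] using hk)))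

/-- A split is a merge read backwards: the circles at the 0-resolution arise from those at the
1-resolution by joining the top strand to the bottom strand. -/
theorem Good.split (hD : D.Good) (hc : ε c = false) (h : D.circ ε (D.nw c) = D.circ ε (D.ne c)) :
    D.Joins (Function.update ε c true) ε (D.nw c) (D.sw c) := by
  have hs := (hD ε c hc).1 h
  have ht := circ_eq_of_adj (Adj.one_top (D := D) (ε := Function.update ε c true) c (by simp))
  have hb := circ_eq_of_adj (Adj.one_bot (D := D) (ε := Function.update ε c true) c (by simp))
  have hl := circ_eq_of_adj (Adj.zero_left (D := D) (ε := ε) c hc)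
  have hr := circ_eq_of_adj (Adj.zero_right (D := D) (ε := ε) c hc)
  refine Joins.of_adj hs ?_ hl ?_
  · rintro a b (hab | ⟨k, hk⟩ | ⟨k, hk⟩ | ⟨k, hk⟩ | ⟨k, hk⟩)
    · exact circ_eq_of_adj (Adj.arc hab)
    · by_cases hkc : k = c
      · subst hkc; exact hl
      · exact circ_eq_of_adj (Adj.zero_left k (by simpa [hkc] using hk))
    · by_cases hkc : k = c
      · subst hkc; exact hr
      · exact circ_eq_of_adj (Adj.zero_right k (by simpa [hkc] using hk))
    · by_cases hkc : k = c
      · subst hkc; exact h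
      · exact circ_eq_of_adj (Adj.one_top k (by simpa [hkc] using hk))
    · by_cases hkc : k = c
      · subst hkc; rw [← hl, h, hr]
      · exact circ_eq_of_adj (Adj.one_bot k (by simpa [hkc] using hk))
  · rintro a b (hab | ⟨k, hk⟩ | ⟨k, hk⟩ | ⟨k, hk⟩ | ⟨k, hk⟩)
    · exact Or.inl (circ_eq_of_adj (Adj.arc hab))
    · by_cases hkc : k = c
      · subst hkc; simp
      · exact Or.inl (circ_eq_of_adj (Adj.zero_left k (by simpa [hkc] using hk)))
    · by_cases hkc : k = c
      · subst hkc; rw [← ht, ← hb]; simp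
      · exact Or.inl (circ_eq_of_adj (Adj.zero_right k (by simpa [hkc] using hk)))
    · by_cases hkc : k = c
      · subst hkc; exact Or.inl ht
      · exact Or.inl (circ_eq_of_adj (Adj.one_top k (by simpa [hkc] using hk)))
    · by_cases hkc : k = c
      · subst hkc; exact Or.inl hb
      · exact Or.inl (circ_eq_of_adj (Adj.one_bot k (by simpa [hkc] using hk)))

end Good

section EdgeCoeff

variable {ε ε' : Fin D.n → Bool} {c : Fin D.n}

theorem edgeCoeff_ne_zero {x y : D.Basis} (h : D.edgeCoeff c x y ≠ 0) :
    x.1 c = false ∧ y.1 = Function.update x.1 c true := by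
  rw [edgeCoeff] at h
  split_ifs at h with h1 <;> first | exact ⟨h1.1, h1.2.1⟩ | simp at h

theorem edgeCoeff_agree {x y : D.Basis} (h : D.edgeCoeff c x y ≠ 0) {a : D.Pt}
    (h1 : D.circ x.1 a ≠ D.circ x.1 (D.nw c)) (h2 : D.circ x.1 a ≠ D.circ x.1 (D.ne c)) :
    y.2 (D.circ y.1 a) = x.2 (D.circ x.1 a) := by
  rw [edgeCoeff] at h
  split_ifs at h with h3 <;> first | exact h3.2.2 a h1 h2 | simp at h

open Classical in
theorem edgeCoeff_merge (hc : ε c = false) (hε : ε' = Function.update ε c true)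
    (h : D.circ ε (D.nw c) ≠ D.circ ε (D.ne c)) (x : D.Circle ε → Gen) (y : D.Circle ε' → Gen) :
    D.edgeCoeff c ⟨ε, x⟩ ⟨ε', y⟩ =
      if ∀ a : D.Pt, D.circ ε a ≠ D.circ ε (D.nw c) → D.circ ε a ≠ D.circ ε (D.ne c) →
        y (D.circ ε' a) = x (D.circ ε a) then
      mulCoeff (x (D.circ ε (D.nw c))) (x (D.circ ε (D.ne c))) (y (D.circ ε' (D.nw c)))
      else 0 := by
  subst hε
  simp [edgeCoeff, hc, h]

open Classical in
theorem edgeCoeff_split (hc : ε c = false) (hε : ε' = Function.update ε c true)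
    (h : D.circ ε (D.nw c) = D.circ ε (D.ne c)) (h' : D.circ ε' (D.nw c) ≠ D.circ ε' (D.sw c))
    (x : D.Circle ε → Gen) (y : D.Circle ε' → Gen) :
    D.edgeCoeff c ⟨ε, x⟩ ⟨ε', y⟩ =
      if ∀ a : D.Pt, D.circ ε a ≠ D.circ ε (D.nw c) → y (D.circ ε' a) = x (D.circ ε a) then
      comulCoeff (x (D.circ ε (D.nw c))) (y (D.circ ε' (D.nw c))) (y (D.circ ε' (D.sw c)))
      else 0 := by
  subst hε
  simp [edgeCoeff, hc, ← h, h']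

theorem deg_of_mulCoeff {a b c : Gen} (h : mulCoeff a b c ≠ 0) : a.deg + b.deg = c.deg + 1 := by
  cases a <;> cases b <;> cases c <;> simp_all [mulCoeff, Gen.deg]

theorem deg_of_comulCoeff {a b c : Gen} (h : comulCoeff a b c ≠ 0) :
    a.deg = b.deg + c.deg + 1 := by
  cases a <;> cases b <;> cases c <;> simp_all [comulCoeff, Gen.deg]

theorem height_update (hc : ε c = false) :
    D.height (Function.update ε c true) = D.height ε + 1 := by
  unfold height
  have : (Finset.univ.filter fun k => Function.update ε c true k = true) =
      insert c (Finset.univ.filter fun k => ε k = true) := by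
    ext k
    by_cases hk : k = c <;> simp [Function.update_apply, hk]
  rw [this, Finset.card_insert_of_notMem (by simp [hc])]

/-- The sum over circles changes by the contributions of the circles involved in a join. -/
theorem Joins.sum_deg {ε ε' : Fin D.n → Bool} {p q : D.Pt} (h : D.Joins ε ε' p q)
    {x : D.Circle ε → Gen} {y : D.Circle ε' → Gen}
    (hxy : ∀ a, D.circ ε a ≠ D.circ ε p → D.circ ε a ≠ D.circ ε q →
      y (D.circ ε' a) = x (D.circ ε a)) :
    ∑ γ, (x γ).deg + (y (D.circ ε' p)).deg =
      ∑ γ, (y γ).deg + (x (D.circ ε p)).deg + (x (D.circ ε q)).deg := by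
  classical
  -- Only the joined circle contributes, because all other labels agree.
  have h1 : ∑ γ, ((x (h.up γ)).deg - (y γ).deg) =
      (x (D.circ ε p)).deg - (y (D.circ ε' p)).deg := by
    rw [Finset.sum_eq_single (D.circ ε' p), h.up_left]
    · intro γ _ hγ
      obtain ⟨a, rfl⟩ := circ_surjective γ
      have hp : D.circ ε a ≠ D.circ ε p := fun h' => hγ (h.mono h')
      have hq : D.circ ε a ≠ D.circ ε q := fun h' => hγ (by rw [h.mono h', h.eq])
      rw [h.up_of_ne hq, hxy a hp hq, sub_self]
    · simp
  rw [h.sum]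
  rw [Finset.sum_sub_distrib] at h1
  linarith

/-- Both `m` and `Δ` lower the degree of labels by one, which the shift by the height compensates.
-/
theorem Good.edge_degrees (hD : D.Good) {x y : D.Basis} (h : D.edgeCoeff c x y ≠ 0) :
    (D.height y.1 : ℤ) = D.height x.1 + 1 ∧ D.qdeg y = D.qdeg x := by
  obtain ⟨h1, h2⟩ := edgeCoeff_ne_zero h
  have hh : (D.height y.1 : ℤ) = D.height x.1 + 1 := by
    rw [h2, height_update h1]; push_cast; rfl
  refine ⟨hh, ?_⟩
  obtain ⟨ε, x⟩ := x
  obtain ⟨ε', y⟩ := y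
  simp only at h1 h2 hh ⊢
  simp only [qdeg]
  by_cases hm : D.circ ε (D.nw c) = D.circ ε (D.ne c)
  · have hj := hD.split h1 hm
    rw [← h2] at hj
    rw [edgeCoeff_split h1 h2 hm hj.ne] at h
    split_ifs at h with hxy
    · have := hj.sum_deg (x := y) (y := x) fun a ha ha' => (hxy a fun h' => by
        rcases (hj.iff _ _).1 h' with h' | ⟨h', -⟩ | ⟨h', -⟩
        · exact ha h'
        · exact ha h'
        · exact ha' h').symm
      have := deg_of_comulCoeff h
      linarith
    · exact absurd rfl h
  · have hj := hD.merge h1 hm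
    rw [← h2] at hj
    rw [edgeCoeff_merge h1 h2 hm] at h
    split_ifs at h with hxy
    · have := hj.sum_deg hxy
      have := deg_of_mulCoeff h
      linarith
    · exact absurd rfl h

end EdgeCoeff

end Diagram

end Khovanov

/-! ### Edge maps as linear maps over the action of X on the circles -/

namespace Khovanov

namespace Diagram

variable {D : Diagram}

noncomputable instance (ε : Fin D.n → Bool) : Fintype (D.Circle ε → Gen) := Fintype.ofFinite _

/-- Chains on the labellings of the circles of one resolution. -/
abbrev Local (D : Diagram) (ε : Fin D.n → Bool) : Type := (D.Circle ε → Gen) → ℤ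

open Classical in
/-- Multiplication by the generator `X` of the tensor factor of the circle through `a`. -/
noncomputable def mulX (ε : Fin D.n → Bool) (a : D.Pt) : D.Local ε →ₗ[ℤ] D.Local ε where
  toFun f x := if x (D.circ ε a) = Gen.X then f (Function.update x (D.circ ε a) Gen.one) else 0
  map_add' f g := by ext x; by_cases h : x (D.circ ε a) = Gen.X <;> simp [h]
  map_smul' r f := by ext x; by_cases h : x (D.circ ε a) = Gen.X <;> simp [h]

/-- The unsigned per-edge map at the crossing `c`. -/
noncomputable def edge (c : Fin D.n) (ε ε' : Fin D.n → Bool) : D.Local ε →ₗ[ℤ] D.Local ε' :=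
  Matrix.mulVecLin (Matrix.of fun y x => D.edgeCoeff c ⟨ε, x⟩ ⟨ε', y⟩)

open Classical in
/-- The unit of the Frobenius algebra of a resolution. -/
noncomputable def unit (ε : Fin D.n → Bool) : D.Local ε := Pi.single (fun _ => Gen.one) 1

section Operators

variable {ε ε' : Fin D.n → Bool} {c : Fin D.n}

open Classical in
theorem mulX_apply (a : D.Pt) (f : D.Local ε) (x : D.Circle ε → Gen) :
    mulX ε a f x = if x (D.circ ε a) = Gen.X then
      f (Function.update x (D.circ ε a) Gen.one) else 0 := rfl

theorem edge_apply (f : D.Local ε) (y : D.Circle ε' → Gen) :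
    edge c ε ε' f y = ∑ x, D.edgeCoeff c ⟨ε, x⟩ ⟨ε', y⟩ * f x := rfl

theorem mulX_congr {a b : D.Pt} (h : D.circ ε a = D.circ ε b) : mulX ε a = mulX ε b := by
  classical
  ext f x
  simp only [LinearMap.comp_apply, mulX_apply, h]

theorem mulX_comm (a b : D.Pt) (f : D.Local ε) :
    mulX ε a (mulX ε b f) = mulX ε b (mulX ε a f) := by
  classical
  by_cases h : D.circ ε a = D.circ ε b
  · rw [mulX_congr h]
  · ext x
    simp only [mulX_apply, Function.update_of_ne h, Function.update_of_ne (Ne.symm h)]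
    rw [Function.update_comm h]
    split_ifs <;> rfl

/-- The labellings are generated from the unit by the operators `mulX`. -/
theorem eq_top_of_mulX (W : Submodule ℤ (D.Local ε)) (h1 : unit ε ∈ W)
    (hX : ∀ a, ∀ f ∈ W, mulX ε a f ∈ W) : W = ⊤ := by
  classical
  have key : ∀ (n : ℕ) (x : D.Circle ε → Gen),
      (Finset.univ.filter fun γ => x γ = Gen.X).card = n → Pi.single x (1 : ℤ) ∈ W := by
    intro n
    induction n with
    | zero =>
      intro x hx
      have : x = fun _ => Gen.one := by
        funext γ
        rw [Finset.card_eq_zero, Finset.filter_eq_empty_iff] at hx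
        have := hx (Finset.mem_univ γ)
        cases h : x γ <;> simp_all
      rw [this]
      exact h1
    | succ n ih =>
      intro x hx
      obtain ⟨γ, hγ⟩ := Finset.card_pos.1 (by rw [hx]; exact Nat.succ_pos n)
      have hγX : x γ = Gen.X := (Finset.mem_filter.1 hγ).2
      obtain ⟨a, rfl⟩ := circ_surjective γ
      have h2 := ih (Function.update x (D.circ ε a) Gen.one) (by
        have : (Finset.univ.filter fun γ => Function.update x (D.circ ε a) Gen.one γ = Gen.X) =
            (Finset.univ.filter fun γ => x γ = Gen.X).erase (D.circ ε a) := by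
          ext γ
          by_cases hk : γ = D.circ ε a <;> simp [hk]
        rw [this, Finset.card_erase_of_mem hγ, hx]; rfl)
      have h3 := hX a _ h2
      convert h3 using 1
      ext z
      rw [mulX_apply]
      by_cases hz : z = x
      · subst hz; simp [hγX]
      · rw [Pi.single_eq_of_ne hz]
        split_ifs with hzX
        · rw [Pi.single_eq_of_ne]
          intro h'
          apply hz
          funext δ
          by_cases hδ : δ = D.circ ε a
          · rw [hδ, hzX, hγX]
          · have := congrFun h' δ
            rwa [Function.update_of_ne hδ, Function.update_of_ne hδ] at this
        · rfl
  rw [eq_top_iff]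
  intro f _
  rw [← Finset.univ_sum_single f]
  refine Submodule.sum_mem _ fun x _ => ?_
  have : (Pi.single x (f x) : D.Local ε) = f x • Pi.single x (1 : ℤ) := by
    rw [← Pi.single_smul]; simp
  rw [this]
  exact Submodule.smul_mem _ _ (key _ x rfl)

/-- As a module over the operators `mulX`, the space of labellings is cyclic with generator the
unit. An identity between compositions of edge maps thus needs to be checked on one vector only. -/
theorem ext_of_mulX {T T' : D.Local ε →ₗ[ℤ] D.Local ε'}
    (hT : ∀ a f, T (mulX ε a f) = mulX ε' a (T f))
    (hT' : ∀ a f, T' (mulX ε a f) = mulX ε' a (T' f)) (h : T (unit ε) = T' (unit ε)) : T = T' := by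
  rw [← LinearMap.eqLocus_eq_top]
  refine eq_top_of_mulX _ h fun a f hf => ?_
  rw [LinearMap.mem_eqLocus] at hf ⊢
  rw [hT, hT', hf]

-- Linearity over X is reduced to matrix entries. The operator moves label `1` to `X` on the circle
-- of `a`, so the two sums match under exchanging these labels there.
open Classical in
theorem edge_mulX_of_coeff (a : D.Pt)
    (h : ∀ (x : D.Circle ε → Gen) (y : D.Circle ε' → Gen),
      (if y (D.circ ε' a) = Gen.X then
        D.edgeCoeff c ⟨ε, x⟩ ⟨ε', Function.update y (D.circ ε' a) Gen.one⟩ else 0) =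
      if x (D.circ ε a) = Gen.one then
        D.edgeCoeff c ⟨ε, Function.update x (D.circ ε a) Gen.X⟩ ⟨ε', y⟩ else 0)
    (f : D.Local ε) : edge c ε ε' (mulX ε a f) = mulX ε' a (edge c ε ε' f) := by
  ext y
  rw [mulX_apply, edge_apply, edge_apply]
  have h1 : (if y (D.circ ε' a) = Gen.X then
      ∑ x, D.edgeCoeff c ⟨ε, x⟩ ⟨ε', Function.update y (D.circ ε' a) Gen.one⟩ * f x else 0) =
      ∑ x, (if x (D.circ ε a) = Gen.one then
        D.edgeCoeff c ⟨ε, Function.update x (D.circ ε a) Gen.X⟩ ⟨ε', y⟩ * f x else 0) := by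
    trans ∑ x, (if y (D.circ ε' a) = Gen.X then
      D.edgeCoeff c ⟨ε, x⟩ ⟨ε', Function.update y (D.circ ε' a) Gen.one⟩ * f x else 0)
    · split_ifs <;> simp
    refine Finset.sum_congr rfl fun x _ => ?_
    have := congrArg (· * f x) (h x y)
    simpa only [ite_mul, zero_mul] using this
  rw [h1]
  simp only [mulX_apply, mul_ite, mul_zero]
  rw [← Finset.sum_filter, ← Finset.sum_filter]
  refine Finset.sum_nbij' (fun x => Function.update x (D.circ ε a) Gen.one)
    (fun x => Function.update x (D.circ ε a) Gen.X) ?_ ?_ ?_ ?_ ?_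
  · intro x hx; simp
  · intro x hx; simp
  · intro x hx
    simp only [Finset.mem_filter, Finset.mem_univ, true_and] at hx
    simp [← hx]
  · intro x hx
    simp only [Finset.mem_filter, Finset.mem_univ, true_and] at hx
    simp [← hx]
  · intro x hx
    simp only [Finset.mem_filter, Finset.mem_univ, true_and] at hx
    simp [← hx]

/-- Multiplication in `V` is commutative and associative, so acting by X on either factor before the
merge is acting by X on the product. On an uninvolved circle the two operations touch different
tensor factors. -/
theorem edge_mulX_merge (hc : ε c = false) (hε : ε' = Function.update ε c true)
    (hj : D.Joins ε ε' (D.nw c) (D.ne c)) (a : D.Pt) (f : D.Local ε) :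
    edge c ε ε' (mulX ε a f) = mulX ε' a (edge c ε ε' f) := by
  classical
  refine edge_mulX_of_coeff a (fun x y => ?_) f
  rw [edgeCoeff_merge hc hε hj.ne, edgeCoeff_merge hc hε hj.ne]
  have hs : ∀ b, D.circ ε b ≠ D.circ ε (D.nw c) → D.circ ε b ≠ D.circ ε (D.ne c) →
      D.circ ε' b ≠ D.circ ε' (D.nw c) := by
    intro b h1 h2 h3
    rcases (hj.iff _ _).1 h3 with h | ⟨h, -⟩ | ⟨h, -⟩
    · exact h1 h
    · exact h1 h
    · exact h2 h
  by_cases hp : D.circ ε a = D.circ ε (D.nw c)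
  · rw [hj.mono hp, hp]
    have e1 : (∀ b, D.circ ε b ≠ D.circ ε (D.nw c) → D.circ ε b ≠ D.circ ε (D.ne c) →
        Function.update y (D.circ ε' (D.nw c)) Gen.one (D.circ ε' b) = x (D.circ ε b)) ↔
        ∀ b, D.circ ε b ≠ D.circ ε (D.nw c) → D.circ ε b ≠ D.circ ε (D.ne c) →
        y (D.circ ε' b) = x (D.circ ε b) := by
      refine forall_congr' fun b => forall_congr' fun h1 => forall_congr' fun h2 => ?_
      rw [Function.update_of_ne (hs b h1 h2)]
    have e2 : (∀ b, D.circ ε b ≠ D.circ ε (D.nw c) → D.circ ε b ≠ D.circ ε (D.ne c) →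
        y (D.circ ε' b) = Function.update x (D.circ ε (D.nw c)) Gen.X (D.circ ε b)) ↔
        ∀ b, D.circ ε b ≠ D.circ ε (D.nw c) → D.circ ε b ≠ D.circ ε (D.ne c) →
        y (D.circ ε' b) = x (D.circ ε b) := by
      refine forall_congr' fun b => forall_congr' fun h1 => forall_congr' fun h2 => ?_
      rw [Function.update_of_ne h1]
    simp only [e1, e2, Function.update_self, Function.update_of_ne hj.ne.symm]
    cases x (D.circ ε (D.nw c)) <;> cases x (D.circ ε (D.ne c)) <;>
      cases y (D.circ ε' (D.nw c)) <;> simp [mulCoeff]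
  by_cases hq : D.circ ε a = D.circ ε (D.ne c)
  · rw [hj.mono hq, ← hj.eq, hq]
    have e1 : (∀ b, D.circ ε b ≠ D.circ ε (D.nw c) → D.circ ε b ≠ D.circ ε (D.ne c) →
        Function.update y (D.circ ε' (D.nw c)) Gen.one (D.circ ε' b) = x (D.circ ε b)) ↔
        ∀ b, D.circ ε b ≠ D.circ ε (D.nw c) → D.circ ε b ≠ D.circ ε (D.ne c) →
        y (D.circ ε' b) = x (D.circ ε b) := by
      refine forall_congr' fun b => forall_congr' fun h1 => forall_congr' fun h2 => ?_
      rw [Function.update_of_ne (hs b h1 h2)]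
    have e2 : (∀ b, D.circ ε b ≠ D.circ ε (D.nw c) → D.circ ε b ≠ D.circ ε (D.ne c) →
        y (D.circ ε' b) = Function.update x (D.circ ε (D.ne c)) Gen.X (D.circ ε b)) ↔
        ∀ b, D.circ ε b ≠ D.circ ε (D.nw c) → D.circ ε b ≠ D.circ ε (D.ne c) →
        y (D.circ ε' b) = x (D.circ ε b) := by
      refine forall_congr' fun b => forall_congr' fun h1 => forall_congr' fun h2 => ?_
      rw [Function.update_of_ne h2]
    simp only [e1, e2, Function.update_self, Function.update_of_ne hj.ne]
    cases x (D.circ ε (D.nw c)) <;> cases x (D.circ ε (D.ne c)) <;>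
      cases y (D.circ ε' (D.nw c)) <;> simp [mulCoeff]
  · have ha := hs a hp hq
    have hab : ∀ b, D.circ ε b ≠ D.circ ε a → D.circ ε' b ≠ D.circ ε' a := by
      intro b h1 h2
      rcases (hj.iff _ _).1 h2 with h | ⟨-, h⟩ | ⟨-, h⟩
      · exact h1 h
      · exact hq h
      · exact hp h
    have e1 : (∀ b, D.circ ε b ≠ D.circ ε (D.nw c) → D.circ ε b ≠ D.circ ε (D.ne c) →
        Function.update y (D.circ ε' a) Gen.one (D.circ ε' b) = x (D.circ ε b)) ↔
        x (D.circ ε a) = Gen.one ∧ ∀ b, D.circ ε b ≠ D.circ ε a → D.circ ε b ≠ D.circ ε (D.nw c) →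
          D.circ ε b ≠ D.circ ε (D.ne c) → y (D.circ ε' b) = x (D.circ ε b) := by
      constructor
      · intro h
        refine ⟨by rw [← h a hp hq, Function.update_self], fun b h1 h2 h3 => ?_⟩
        rw [← h b h2 h3, Function.update_of_ne (hab b h1)]
      · rintro ⟨h1, h2⟩ b h3 h4
        by_cases hb : D.circ ε b = D.circ ε a
        · rw [hj.mono hb, hb, Function.update_self, h1]
        · rw [Function.update_of_ne (hab b hb), h2 b hb h3 h4]
    have e2 : (∀ b, D.circ ε b ≠ D.circ ε (D.nw c) → D.circ ε b ≠ D.circ ε (D.ne c) →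
        y (D.circ ε' b) = Function.update x (D.circ ε a) Gen.X (D.circ ε b)) ↔
        y (D.circ ε' a) = Gen.X ∧ ∀ b, D.circ ε b ≠ D.circ ε a → D.circ ε b ≠ D.circ ε (D.nw c) →
          D.circ ε b ≠ D.circ ε (D.ne c) → y (D.circ ε' b) = x (D.circ ε b) := by
      constructor
      · intro h
        refine ⟨by rw [h a hp hq, Function.update_self], fun b h1 h2 h3 => ?_⟩
        rw [h b h2 h3, Function.update_of_ne h1]
      · rintro ⟨h1, h2⟩ b h3 h4
        by_cases hb : D.circ ε b = D.circ ε a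
        · rw [hj.mono hb, hb, Function.update_self, h1]
        · rw [Function.update_of_ne hb, h2 b hb h3 h4]
    simp only [e1, e2, Function.update_of_ne (Ne.symm ha), Function.update_of_ne (Ne.symm hp),
      Function.update_of_ne (Ne.symm hq)]
    split_ifs <;> tauto

/-- The comultiplication is a map of bimodules: X may act on the circle before the split or on
either of the two pieces afterwards. -/
theorem edge_mulX_split (hc : ε c = false) (hε : ε' = Function.update ε c true)
    (h0 : D.circ ε (D.nw c) = D.circ ε (D.ne c)) (hj : D.Joins ε' ε (D.nw c) (D.sw c)) (a : D.Pt)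
    (f : D.Local ε) : edge c ε ε' (mulX ε a f) = mulX ε' a (edge c ε ε' f) := by
  classical
  refine edge_mulX_of_coeff a (fun x y => ?_) f
  rw [edgeCoeff_split hc hε h0 hj.ne, edgeCoeff_split hc hε h0 hj.ne]
  by_cases hs : D.circ ε a = D.circ ε (D.nw c)
  · rw [hs]
    have e1 : (∀ b, D.circ ε b ≠ D.circ ε (D.nw c) →
        Function.update y (D.circ ε' a) Gen.one (D.circ ε' b) = x (D.circ ε b)) ↔
        ∀ b, D.circ ε b ≠ D.circ ε (D.nw c) → y (D.circ ε' b) = x (D.circ ε b) := by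
      refine forall_congr' fun b => forall_congr' fun h1 => ?_
      rw [Function.update_of_ne fun h => h1 (by rw [hj.mono h, hs])]
    have e2 : (∀ b, D.circ ε b ≠ D.circ ε (D.nw c) →
        y (D.circ ε' b) = Function.update x (D.circ ε (D.nw c)) Gen.X (D.circ ε b)) ↔
        ∀ b, D.circ ε b ≠ D.circ ε (D.nw c) → y (D.circ ε' b) = x (D.circ ε b) := by
      refine forall_congr' fun b => forall_congr' fun h1 => ?_
      rw [Function.update_of_ne h1]
    simp only [e1, e2, Function.update_self]
    have hpq : D.circ ε' a = D.circ ε' (D.nw c) ∨ D.circ ε' a = D.circ ε' (D.sw c) := by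
      rcases (hj.iff _ _).1 hs with h | ⟨h, -⟩ | ⟨h, -⟩
      · exact Or.inl h
      · exact Or.inl h
      · exact Or.inr h
    rcases hpq with hp | hp
    · rw [hp, Function.update_self, Function.update_of_ne hj.ne.symm]
      cases x (D.circ ε (D.nw c)) <;> cases y (D.circ ε' (D.nw c)) <;>
        cases y (D.circ ε' (D.sw c)) <;> simp [comulCoeff]
    · rw [hp, Function.update_self, Function.update_of_ne hj.ne]
      cases x (D.circ ε (D.nw c)) <;> cases y (D.circ ε' (D.nw c)) <;>
        cases y (D.circ ε' (D.sw c)) <;> simp [comulCoeff]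
  · have hp : D.circ ε' a ≠ D.circ ε' (D.nw c) := fun h => hs (hj.mono h)
    have hq : D.circ ε' a ≠ D.circ ε' (D.sw c) := fun h => hs (by rw [hj.mono h, hj.eq])
    have hab : ∀ b, D.circ ε b ≠ D.circ ε a → D.circ ε' b ≠ D.circ ε' a :=
      fun b h1 h2 => h1 (hj.mono h2)
    have hab' : ∀ b, D.circ ε b = D.circ ε a → D.circ ε' b = D.circ ε' a := by
      intro b h1
      rcases (hj.iff _ _).1 h1 with h | ⟨-, h⟩ | ⟨-, h⟩
      · exact h
      · exact absurd h hq
      · exact absurd h hp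
    have e1 : (∀ b, D.circ ε b ≠ D.circ ε (D.nw c) →
        Function.update y (D.circ ε' a) Gen.one (D.circ ε' b) = x (D.circ ε b)) ↔
        x (D.circ ε a) = Gen.one ∧ ∀ b, D.circ ε b ≠ D.circ ε a →
          D.circ ε b ≠ D.circ ε (D.nw c) → y (D.circ ε' b) = x (D.circ ε b) := by
      constructor
      · intro h
        refine ⟨by rw [← h a hs, Function.update_self], fun b h1 h2 => ?_⟩
        rw [← h b h2, Function.update_of_ne (hab b h1)]
      · rintro ⟨h1, h2⟩ b h3
        by_cases hb : D.circ ε b = D.circ ε a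
        · rw [hab' b hb, hb, Function.update_self, h1]
        · rw [Function.update_of_ne (hab b hb), h2 b hb h3]
    have e2 : (∀ b, D.circ ε b ≠ D.circ ε (D.nw c) →
        y (D.circ ε' b) = Function.update x (D.circ ε a) Gen.X (D.circ ε b)) ↔
        y (D.circ ε' a) = Gen.X ∧ ∀ b, D.circ ε b ≠ D.circ ε a →
          D.circ ε b ≠ D.circ ε (D.nw c) → y (D.circ ε' b) = x (D.circ ε b) := by
      constructor
      · intro h
        refine ⟨by rw [h a hs, Function.update_self], fun b h1 h2 => ?_⟩
        rw [h b h2, Function.update_of_ne h1]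
      · rintro ⟨h1, h2⟩ b h3
        by_cases hb : D.circ ε b = D.circ ε a
        · rw [hab' b hb, hb, Function.update_self, h1]
        · rw [Function.update_of_ne hb, h2 b hb h3]
    simp only [e1, e2, Function.update_of_ne (Ne.symm hp), Function.update_of_ne (Ne.symm hs),
      Function.update_of_ne (Ne.symm hq)]
    split_ifs <;> tauto

theorem edge_unit (y : D.Circle ε' → Gen) :
    edge c ε ε' (unit ε) y = D.edgeCoeff c ⟨ε, fun _ => Gen.one⟩ ⟨ε', y⟩ := by
  classical
  rw [edge_apply, Finset.sum_eq_single (fun _ => Gen.one)]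
  · simp [unit]
  · intro x _ hx
    simp [unit, Pi.single_eq_of_ne hx]
  · simp

theorem edge_unit_merge (hc : ε c = false) (hε : ε' = Function.update ε c true)
    (hj : D.Joins ε ε' (D.nw c) (D.ne c)) : edge c ε ε' (unit ε) = unit ε' := by
  classical
  ext y
  rw [edge_unit, edgeCoeff_merge hc hε hj.ne]
  by_cases hy : y = fun _ => Gen.one
  · subst hy; simp [mulCoeff, unit]
  · rw [unit, Pi.single_eq_of_ne hy]
    split_ifs with h
    · cases h1 : y (D.circ ε' (D.nw c))
      · exfalso
        apply hy
        funext γ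
        obtain ⟨a, rfl⟩ := circ_surjective γ
        by_cases h2 : D.circ ε a = D.circ ε (D.nw c)
        · rw [hj.mono h2, h1]
        by_cases h3 : D.circ ε a = D.circ ε (D.ne c)
        · rw [hj.mono h3, ← hj.eq, h1]
        · exact h a h2 h3
      · rfl
    · rfl

theorem edge_unit_split (hc : ε c = false) (hε : ε' = Function.update ε c true)
    (h0 : D.circ ε (D.nw c) = D.circ ε (D.ne c)) (hj : D.Joins ε' ε (D.nw c) (D.sw c)) :
    edge c ε ε' (unit ε) = mulX ε' (D.nw c) (unit ε') + mulX ε' (D.sw c) (unit ε') := by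
  classical
  ext y
  rw [edge_unit, edgeCoeff_split hc hε h0 hj.ne, Pi.add_apply, mulX_apply, mulX_apply]
  -- This is the coefficient of `y` in X on the circle of `u` times the unit, apart from the
  -- condition that `y` has label `X` at `u`. Here `u` and `v` represent the two pieces.
  have key : ∀ u v, D.circ ε' u ≠ D.circ ε' v →
      (∀ a, D.circ ε a = D.circ ε (D.nw c) →
        D.circ ε' a = D.circ ε' u ∨ D.circ ε' a = D.circ ε' v) →
      (∀ a, D.circ ε a ≠ D.circ ε (D.nw c) → D.circ ε' a ≠ D.circ ε' u) →
      (∀ a, D.circ ε a ≠ D.circ ε (D.nw c) → D.circ ε' a ≠ D.circ ε' v) →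
      (unit ε' (Function.update y (D.circ ε' u) Gen.one) =
        if (∀ a : D.Pt, D.circ ε a ≠ D.circ ε (D.nw c) → y (D.circ ε' a) = Gen.one) ∧
          y (D.circ ε' v) = Gen.one then 1 else 0) := by
    intro u v huv h1 h2 h3
    rw [unit]
    split_ifs with h
    · have : Function.update y (D.circ ε' u) Gen.one = fun _ => Gen.one := by
        funext γ
        obtain ⟨a, rfl⟩ := circ_surjective γ
        by_cases hu : D.circ ε' a = D.circ ε' u
        · rw [hu, Function.update_self]
        rw [Function.update_of_ne hu]
        by_cases hv : D.circ ε' a = D.circ ε' v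
        · rw [hv, h.2]
        · exact h.1 a fun h' => (h1 a h').elim hu hv
      rw [this, Pi.single_eq_same]
    · rw [Pi.single_eq_of_ne]
      intro h'
      apply h
      refine ⟨fun a ha => ?_, ?_⟩
      · have := congrFun h' (D.circ ε' a)
        rwa [Function.update_of_ne (h2 a ha)] at this
      · have := congrFun h' (D.circ ε' v)
        rwa [Function.update_of_ne huv.symm] at this
  have hs : ∀ a, D.circ ε a = D.circ ε (D.nw c) →
      D.circ ε' a = D.circ ε' (D.nw c) ∨ D.circ ε' a = D.circ ε' (D.sw c) := by
    intro a ha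
    rcases (hj.iff _ _).1 ha with h | ⟨h, -⟩ | ⟨h, -⟩
    · exact Or.inl h
    · exact Or.inl h
    · exact Or.inr h
  have h2 : ∀ a, D.circ ε a ≠ D.circ ε (D.nw c) → D.circ ε' a ≠ D.circ ε' (D.nw c) :=
    fun a ha h => ha (hj.mono h)
  have h3 : ∀ a, D.circ ε a ≠ D.circ ε (D.nw c) → D.circ ε' a ≠ D.circ ε' (D.sw c) :=
    fun a ha h => ha (by rw [hj.mono h, hj.eq])
  rw [key _ _ hj.ne hs h2 h3, key _ _ hj.ne.symm (fun a ha => (hs a ha).symm) h3 h2]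
  cases y (D.circ ε' (D.nw c)) <;> cases y (D.circ ε' (D.sw c)) <;> simp [comulCoeff]

end Operators

end Diagram

end Khovanov

/-! ### Commuting squares and the differential -/

namespace Khovanov

namespace Diagram

variable {D : Diagram}

section Square

variable {ε ε' : Fin D.n → Bool} {c : Fin D.n}

/-- An edge of the cube is a merge or a split. -/
theorem Good.cases (hD : D.Good) (hc : ε c = false) (hε : ε' = Function.update ε c true) :
    D.Joins ε ε' (D.nw c) (D.ne c) ∨
      (D.circ ε (D.nw c) = D.circ ε (D.ne c) ∧ D.Joins ε' ε (D.nw c) (D.sw c)) := by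
  subst hε
  by_cases h : D.circ ε (D.nw c) = D.circ ε (D.ne c)
  · exact Or.inr ⟨h, hD.split hc h⟩
  · exact Or.inl (hD.merge hc h)

theorem Good.edge_mulX (hD : D.Good) (hc : ε c = false) (hε : ε' = Function.update ε c true)
    (a : D.Pt) (f : D.Local ε) : edge c ε ε' (mulX ε a f) = mulX ε' a (edge c ε ε' f) := by
  rcases hD.cases hc hε with h | ⟨h0, h⟩
  · exact edge_mulX_merge hc hε h a f
  · exact edge_mulX_split hc hε h0 h a f

/-- Both compositions commute with all `mulX`, so they are compared on the unit. A merge sends the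
unit to the unit, and a split sends it to the sum of X over the two pieces. -/
theorem Good.square (hD : D.Good) {c c' : Fin D.n} (hcc : c ≠ c') {ε ε₁ ε₂ ε₃ : Fin D.n → Bool}
    (hc : ε c = false) (hc' : ε c' = false) (h1 : ε₁ = Function.update ε c true)
    (h2 : ε₂ = Function.update ε c' true) (h13 : ε₃ = Function.update ε₁ c' true)
    (h23 : ε₃ = Function.update ε₂ c true) :
    edge c' ε₁ ε₃ ∘ₗ edge c ε ε₁ = edge c ε₂ ε₃ ∘ₗ edge c' ε ε₂ := by
  have h1c : ε₁ c' = false := by rw [h1, Function.update_of_ne hcc.symm, hc']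
  have h2c : ε₂ c = false := by rw [h2, Function.update_of_ne hcc, hc]
  refine ext_of_mulX (fun a f => ?_) (fun a f => ?_) ?_
  · simp only [LinearMap.comp_apply]
    rw [hD.edge_mulX hc h1, hD.edge_mulX h1c h13]
  · simp only [LinearMap.comp_apply]
    rw [hD.edge_mulX hc' h2, hD.edge_mulX h2c h23]
  simp only [LinearMap.comp_apply]
  have m1 := hD.edge_mulX hc h1
  have m2 := hD.edge_mulX hc' h2
  have m13 := hD.edge_mulX h1c h13
  have m23 := hD.edge_mulX h2c h23
  have l0 := circ_eq_of_adj (Adj.zero_left (D := D) (ε := ε) c hc)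
  have l1 := circ_eq_of_adj (Adj.zero_left (D := D) (ε := ε₁) c' h1c)
  -- Of the sixteen patterns of merges and splits, counting circles along the two paths leaves six.
  rcases hD.cases hc h1 with j1 | ⟨i1, j1⟩ <;> rcases hD.cases h1c h13 with j13 | ⟨i13, j13⟩ <;>
    rcases hD.cases hc' h2 with j2 | ⟨i2, j2⟩ <;> rcases hD.cases h2c h23 with j23 | ⟨i23, j23⟩ <;>
    first
    | (exfalso
       have := j1.card
       have := j13.card
       have := j2.card
       have := j23.card
       omega)
    | skip
  · rw [edge_unit_merge hc h1 j1, edge_unit_merge h1c h13 j13, edge_unit_merge hc' h2 j2,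
      edge_unit_merge h2c h23 j23]
  · rw [edge_unit_merge hc h1 j1, edge_unit_split h1c h13 i13 j13, edge_unit_merge hc' h2 j2,
      edge_unit_split h2c h23 i23 j23]
    -- Both paths merge and then split, and the two pieces separated at `c'` are those separated at
    -- `c`.
    rcases (j13.iff _ _).1 (j1.mono l0) with h | ⟨h, h'⟩ | ⟨h, h'⟩
    · exact absurd h j23.ne
    · rw [mulX_congr h, mulX_congr h']
    · rw [mulX_congr h, mulX_congr h', add_comm]
  · rw [edge_unit_merge hc h1 j1, edge_unit_split h1c h13 i13 j13, edge_unit_split hc' h2 i2 j2,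
      map_add, m23, m23, edge_unit_merge h2c h23 j23]
  · rw [edge_unit_split hc h1 i1 j1, map_add, m13, m13, edge_unit_merge h1c h13 j13,
      edge_unit_merge hc' h2 j2, edge_unit_split h2c h23 i23 j23]
  · rw [edge_unit_split hc h1 i1 j1, map_add, m13, m13, edge_unit_merge h1c h13 j13,
      edge_unit_split hc' h2 i2 j2, map_add, m23, m23, edge_unit_merge h2c h23 j23]
    -- When both paths split and merge again, all corners used end up on one circle, and both sides
    -- are twice X on it.
    have e1 : D.circ ε₃ (D.sw c') = D.circ ε₃ (D.nw c') := (j13.mono l1).symm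
    rcases (j1.iff _ _).1 i2 with h | ⟨h, h'⟩ | ⟨h, h'⟩
    · exact absurd h j13.ne
    · rw [mulX_congr e1, mulX_congr (j13.mono h.symm), mulX_congr (j13.mono h'.symm),
        mulX_congr j13.eq]
    · rw [mulX_congr e1, mulX_congr (j13.mono h.symm), mulX_congr (j13.mono h'.symm),
        mulX_congr j13.eq]
  · rw [edge_unit_split hc h1 i1 j1, map_add, m13, m13, edge_unit_split h1c h13 i13 j13,
      edge_unit_split hc' h2 i2 j2, map_add (edge c ε₂ ε₃), m23, m23,
      edge_unit_split h2c h23 i23 j23]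
    simp only [map_add]
    rw [mulX_comm (D.nw c') (D.nw c), mulX_comm (D.nw c') (D.sw c), mulX_comm (D.sw c') (D.nw c),
      mulX_comm (D.sw c') (D.sw c)]
    abel

end Square

/-- For two different crossings exactly one comes first, so exactly one of the two paths around a
square acquires the extra sign. This makes squares anticommute. -/
theorem edgeSign_update {ε : Fin D.n → Bool} {c c' : Fin D.n} (hc : ε c = false) :
    D.edgeSign (Function.update ε c true) c' = (if c < c' then -1 else 1) * D.edgeSign ε c' := by
  unfold edgeSign
  split_ifs with h
  · have : (Finset.univ.filter fun k => k < c' ∧ Function.update ε c true k = true) =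
        insert c (Finset.univ.filter fun k => k < c' ∧ ε k = true) := by
      ext k
      by_cases hk : k = c <;> simp [Function.update_apply, hk, h]
    rw [this, Finset.card_insert_of_notMem (by simp [hc]), pow_succ]
    ring
  · rw [one_mul]
    congr 2
    ext k
    by_cases hk : k = c <;> simp [Function.update_apply, hk, h]

/-- The Khovanov complex of a diagram as a based complex. -/
noncomputable def based (D : Diagram) : Based where
  B := D.Basis
  finite_B := inferInstance
  ht x := D.height x.1
  qd := D.qdeg
  coeff x y := ∑ c : Fin D.n, D.edgeSign x.1 c * D.edgeCoeff c x y

theorem edgeSign_sq (ε : Fin D.n → Bool) (c : Fin D.n) :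
    D.edgeSign ε c * D.edgeSign ε c = 1 := by
  unfold edgeSign
  rw [← mul_pow]; simp

/-- At most one crossing contributes to a coefficient of the differential. -/
theorem based_coeff_of_update {x y : D.Basis} {c : Fin D.n}
    (hy : y.1 = Function.update x.1 c true) :
    D.based.coeff x y = D.edgeSign x.1 c * D.edgeCoeff c x y := by
  show ∑ c : Fin D.n, D.edgeSign x.1 c * D.edgeCoeff c x y = _
  rw [Finset.sum_eq_single c]
  · intro c' _ hcc
    by_contra h
    obtain ⟨h1, h2⟩ := edgeCoeff_ne_zero (right_ne_zero_of_mul h)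
    have := congrFun (hy.symm.trans h2) c'
    rw [Function.update_self, Function.update_of_ne hcc, h1] at this
    exact absurd this (by simp)
  · simp

theorem based_coeff_ne_zero {x y : D.Basis} (h : D.based.coeff x y ≠ 0) :
    ∃ c, x.1 c = false ∧ y.1 = Function.update x.1 c true ∧ D.edgeCoeff c x y ≠ 0 := by
  have h' : ∑ c : Fin D.n, D.edgeSign x.1 c * D.edgeCoeff c x y ≠ 0 := h
  obtain ⟨c, -, hc⟩ := Finset.exists_ne_zero_of_sum_ne_zero h'
  have := right_ne_zero_of_mul hc
  exact ⟨c, (edgeCoeff_ne_zero this).1, (edgeCoeff_ne_zero this).2, this⟩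

theorem Good.homogeneous (hD : D.Good) (S : Set D.based.B) : D.based.Homogeneous S := by
  intro x _ y _ h
  obtain ⟨c, -, -, h⟩ := based_coeff_ne_zero h
  exact hD.edge_degrees h

/-- `Good.square` in coordinates: the sum over all basis vectors is supported on the single
intermediate resolution of each path, and both sides vanish unless `z` lies over the opposite vertex
of the square. -/
theorem Good.sum_edge_edge (hD : D.Good) {c c' : Fin D.n} (hcc : c ≠ c') {x z : D.Basis} :
    ∑ y : D.based.B, D.edgeCoeff c x y * D.edgeCoeff c' y z =
      ∑ y : D.based.B, D.edgeCoeff c' x y * D.edgeCoeff c y z := by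
  classical
  by_cases h : x.1 c = false ∧ x.1 c' = false ∧
      z.1 = Function.update (Function.update x.1 c true) c' true
  · obtain ⟨hc, hc', hz⟩ := h
    obtain ⟨ε, x⟩ := x
    obtain ⟨ε₃, z⟩ := z
    have key : ∀ (c c' : Fin D.n) (ε₁ : Fin D.n → Bool), ε₁ = Function.update ε c true →
        ∑ y : D.based.B, D.edgeCoeff c ⟨ε, x⟩ y * D.edgeCoeff c' y ⟨ε₃, z⟩ =
        edge c' ε₁ ε₃ (edge c ε ε₁ (Pi.single x 1)) z := by
      intro c c' ε₁ h1
      have : ∀ y, edge c ε ε₁ (Pi.single x 1) y = D.edgeCoeff c ⟨ε, x⟩ ⟨ε₁, y⟩ := by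
        intro y
        rw [edge_apply, Finset.sum_eq_single x]
        · simp
        · intro w _ hw; rw [Pi.single_eq_of_ne hw]; simp
        · simp
      rw [edge_apply]
      simp only [this]
      refine (Fintype.sum_of_injective (κ := D.based.B)
        (fun y : D.Circle ε₁ → Gen => (⟨ε₁, y⟩ : D.based.B)) ?_ _ _
        ?_ ?_).symm
      · intro y y' hyy
        exact eq_of_heq (Sigma.mk.inj hyy).2
      · rintro ⟨ε', y⟩ hy
        by_contra hne
        apply hy
        have := (edgeCoeff_ne_zero (left_ne_zero_of_mul hne)).2
        simp only at this
        rw [← h1] at this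
        subst this
        exact ⟨y, rfl⟩
      · intro y
        rw [mul_comm]
    have hsq := hD.square (c := c) (c' := c') hcc hc hc' rfl rfl hz
      (by rw [hz, Function.update_comm hcc])
    rw [key c c' _ rfl, key c' c _ rfl]
    exact congrFun (LinearMap.congr_fun hsq (Pi.single x 1)) z
  · rw [Finset.sum_eq_zero, Finset.sum_eq_zero]
    · intro y _
      by_contra hne
      obtain ⟨h1, h2⟩ := edgeCoeff_ne_zero (left_ne_zero_of_mul hne)
      obtain ⟨h3, h4⟩ := edgeCoeff_ne_zero (right_ne_zero_of_mul hne)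
      rw [h2] at h3 h4
      rw [Function.update_of_ne hcc] at h3
      exact h ⟨h3, h1, by rw [h4, Function.update_comm hcc]⟩
    · intro y _
      by_contra hne
      obtain ⟨h1, h2⟩ := edgeCoeff_ne_zero (left_ne_zero_of_mul hne)
      obtain ⟨h3, h4⟩ := edgeCoeff_ne_zero (right_ne_zero_of_mul hne)
      rw [h2] at h3 h4
      rw [Function.update_of_ne hcc.symm] at h3
      exact h ⟨h1, h3, h4⟩

theorem Good.sum_coeff_coeff (hD : D.Good) (x z : D.Basis) :
    ∑ y : D.based.B, D.based.coeff x y * D.based.coeff y z = 0 := by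
  let N : Fin D.n → Fin D.n → ℤ := fun c c' => ∑ y : D.based.B,
    (D.edgeSign x.1 c * D.edgeCoeff c x y) * (D.edgeSign y.1 c' * D.edgeCoeff c' y z)
  have h1 : ∑ y : D.based.B, D.based.coeff x y * D.based.coeff y z = ∑ c, ∑ c', N c c' := by
    show ∑ y : D.based.B, (∑ c : Fin D.n, D.edgeSign x.1 c * D.edgeCoeff c x y) *
      (∑ c : Fin D.n, D.edgeSign y.1 c * D.edgeCoeff c y z) = _
    simp only [Finset.sum_mul_sum]
    rw [Finset.sum_comm]
    refine Finset.sum_congr rfl fun c _ => ?_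
    rw [Finset.sum_comm]
  have h2 : ∀ c c', N c c' = D.edgeSign x.1 c * D.edgeSign (Function.update x.1 c true) c' *
      ∑ y : D.based.B, D.edgeCoeff c x y * D.edgeCoeff c' y z := by
    intro c c'
    rw [Finset.mul_sum]
    refine Finset.sum_congr rfl fun y _ => ?_
    by_cases h : D.edgeCoeff c x y = 0
    · simp [h]
    · rw [(edgeCoeff_ne_zero h).2]; ring
  -- The diagonal terms vanish because a crossing can be changed only once.
  have h3 : ∀ c c', N c c' = -N c' c := by
    intro c c'
    by_cases hcc : c = c'
    · subst hcc
      have : N c c = 0 := by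
        rw [h2, Finset.sum_eq_zero, mul_zero]
        intro y _
        by_contra hne
        have h4 := (edgeCoeff_ne_zero (left_ne_zero_of_mul hne)).2
        have h5 := (edgeCoeff_ne_zero (right_ne_zero_of_mul hne)).1
        rw [h4, Function.update_self] at h5
        exact absurd h5 (by simp)
      rw [this]; rfl
    · rw [h2, h2, hD.sum_edge_edge hcc]
      by_cases h : x.1 c = false ∧ x.1 c' = false
      · rw [edgeSign_update h.1, edgeSign_update h.2]
        rcases lt_or_gt_of_ne hcc with h | h
        · rw [if_pos h, if_neg h.le.not_gt]; ring
        · rw [if_pos h, if_neg h.le.not_gt]; ring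
      · rw [Finset.sum_eq_zero]
        · simp
        · intro y _
          by_contra hne
          obtain ⟨h4, h5⟩ := edgeCoeff_ne_zero (left_ne_zero_of_mul hne)
          have h6 := (edgeCoeff_ne_zero (right_ne_zero_of_mul hne)).1
          rw [h5, Function.update_of_ne hcc] at h6
          exact h ⟨h6, h4⟩
  have h4 : ∑ c, ∑ c', N c c' = -∑ c, ∑ c', N c c' := by
    nth_rewrite 1 [Finset.sum_comm]
    simp only [← Finset.sum_neg_distrib]
    exact Finset.sum_congr rfl fun c _ => Finset.sum_congr rfl fun c' _ => h3 c' c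
  rw [h1]
  omega

/-- The differential squares to zero on every subset that contains all intermediate vertices. -/
theorem Good.sqZero (hD : D.Good) {S : Set D.based.B}
    (hS : ∀ x ∈ S, ∀ z ∈ S, ∀ y, D.based.coeff x y ≠ 0 → D.based.coeff y z ≠ 0 → y ∈ S) :
    D.based.SqZero S := by
  classical
  intro f
  ext z
  by_cases hz : z ∈ S
  · rw [Based.diff_mem hz]
    have : ∀ y : D.based.B, (if y ∈ S then D.based.coeff y z * D.based.diff S f y else 0) =
        ∑ x : D.based.B, if x ∈ S then D.based.coeff x y * D.based.coeff y z * f x else 0 := by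
      intro y
      by_cases hy : y ∈ S
      · rw [if_pos hy, Based.diff_mem hy, Finset.mul_sum]
        refine Finset.sum_congr rfl fun x _ => ?_
        by_cases hx : x ∈ S
        · rw [if_pos hx, if_pos hx]; ring
        · rw [if_neg hx, if_neg hx, mul_zero]
      · rw [if_neg hy, Finset.sum_eq_zero]
        intro x _
        split_ifs with hx
        · by_cases h1 : D.based.coeff x y = 0
          · simp [h1]
          by_cases h2 : D.based.coeff y z = 0
          · simp [h2]
          exact absurd (hS x hx z hz y h1 h2) hy
        · rfl
    simp only [this]
    rw [Finset.sum_comm, Finset.sum_eq_zero]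
    · rfl
    · intro x _
      by_cases hx : x ∈ S
      · simp only [hx, if_true]
        rw [← Finset.sum_mul]
        exact mul_eq_zero_of_left (hD.sum_coeff_coeff x z) _
      · simp [hx]
  · rw [Based.diff_not_mem hz]; rfl

/-- The Khovanov homology of a diagram is the homology of its based complex. -/
theorem Good.nonempty_H_equiv (hD : D.Good) (i j : ℤ) :
    Nonempty (D.H i j ≃ₗ[ℤ] D.based.Hom Set.univ i j) := by
  classical
  let T : ∀ i, D.Chain i j →ₗ[ℤ] (D.based.B → ℤ) := fun i =>
    { toFun := fun f x => if h : (D.height x.1 : ℤ) = i ∧ D.qdeg x = j then f ⟨x, h⟩ else 0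
      map_add' := fun f g => by
        ext x
        by_cases h : (D.height x.1 : ℤ) = i ∧ D.qdeg x = j <;> simp [h] <;> rfl
      map_smul' := fun r f => by
        ext x
        by_cases h : (D.height x.1 : ℤ) = i ∧ D.qdeg x = j <;> simp [h] <;> rfl }
  have hT : ∀ i (f : D.Chain i j) (x : D.BasisAt i j), T i f x.1 = f x := fun i f x => dif_pos x.2
  have hnT : ∀ i (f : D.Chain i j) (x : D.Basis), ¬ ((D.height x.1 : ℤ) = i ∧ D.qdeg x = j) →
      T i f x = 0 := fun i f x hx => dif_neg hx
  have hgrp : ∀ i f, T i f ∈ D.based.grp Set.univ i j := by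
    intro i f x hx
    refine ⟨trivial, ?_⟩
    by_contra h
    exact hx (hnT i f x h)
  have hsurj : ∀ i, ∀ g ∈ D.based.grp Set.univ i j, ∃ f, T i f = g := by
    intro i g hg
    refine ⟨fun x => g x.1, ?_⟩
    ext x
    by_cases h : (D.height x.1 : ℤ) = i ∧ D.qdeg x = j
    · exact hT i _ ⟨x, h⟩
    · rw [hnT i _ x h]
      by_contra h'
      exact h (hg x (Ne.symm h')).2
  have hinj : ∀ i f, T i f = 0 → f = 0 := by
    intro i f h
    ext x
    rw [← hT i f x, h]; rfl
  have hd : ∀ i i' f, i' = i + 1 → T i' (D.d i i' j f) = D.based.diff Set.univ (T i f) := by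
    intro i i' f hi
    have hg : D.based.diff Set.univ (T i f) ∈ D.based.grp Set.univ i' j := by
      rw [hi]
      exact Based.diff_grp (hD.homogeneous _) (hgrp i f)
    ext y
    by_cases h : (D.height y.1 : ℤ) = i' ∧ D.qdeg y = j
    · have := hT i' (D.d i i' j f) ⟨y, h⟩
      rw [this, Based.diff_mem (Set.mem_univ _)]
      refine Fintype.sum_of_injective (κ := D.based.B)
        (fun x : D.BasisAt i j => (x.1 : D.based.B)) Subtype.val_injective _ _ ?_ ?_
      · intro x hx
        rw [hnT i f x, mul_zero, ite_self]
        intro h'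
        exact hx ⟨⟨x, h'⟩, rfl⟩
      · intro x
        rw [hT]
        exact (if_pos (Set.mem_univ (x.1 : D.based.B))).symm
    · rw [hnT _ _ _ h]
      by_contra h'
      exact h (hg y (Ne.symm h')).2
  refine nonempty_subquotient_equiv (T i) ?_ ?_ ?_
  · intro z hz
    refine ⟨hgrp i z, ?_⟩
    show D.based.diff Set.univ _ = 0
    rw [← hd i (i + 1) z rfl, show D.d i (i + 1) j z = 0 from hz, map_zero]
  · intro z _
    constructor
    · rintro ⟨y, hy, hyz⟩
      obtain ⟨w, rfl⟩ := hsurj _ y hy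
      refine ⟨w, ?_⟩
      rw [← hd (i - 1) i w (by ring)] at hyz
      rw [← sub_eq_zero] at hyz ⊢
      rw [← map_sub] at hyz
      exact hinj _ _ hyz
    · rintro ⟨y, rfl⟩
      exact ⟨T (i - 1) y, hgrp _ _, (hd (i - 1) i y (by ring)).symm⟩
  · rintro z ⟨hz, hdz⟩
    obtain ⟨w, rfl⟩ := hsurj _ z hz
    refine ⟨w, ?_, by rw [sub_self]; exact Submodule.zero_mem _⟩
    rw [LinearMap.mem_ker]
    refine hinj (i + 1) _ ?_
    rw [hd i (i + 1) w rfl]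
    exact hdz

end Diagram

end Khovanov

/-! ### Orienting the resolutions of braid closures -/

namespace Khovanov

section SwapMul

variable {α : Type*} [Finite α]

/-- Once the orbit of `u` has returned to `u`, it only repeats what it has already met; exponents
are reduced modulo `m`. -/
theorem not_sameCycle_of_return {π : Equiv.Perm α} {u v : α} (huv : u ≠ v) {m : ℕ}
    (hm : 0 < m) (hret : (π ^ m) u = u) (h : ∀ t, 0 < t → t < m → (π ^ t) u ≠ v) :
    ¬ π.SameCycle u v := by
  intro hs
  obtain ⟨k, -, hk⟩ := hs.exists_pow_eq'
  have h1 : (π ^ (k % m)) u = v := by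
    have h2 : ∀ q, ((π ^ m) ^ q) u = u := by
      intro q
      induction q with
      | zero => rfl
      | succ q ih => rw [pow_succ, Equiv.Perm.mul_apply, hret, ih]
    rw [← hk]
    conv_rhs => rw [← Nat.mod_add_div k m, pow_add, pow_mul, Equiv.Perm.mul_apply, h2]
  rcases Nat.eq_zero_or_pos (k % m) with h0 | h0
  · rw [h0] at h1
    exact huv h1
  · exact h _ h0 (Nat.mod_lt _ hm) h1

/-- Multiplication by a transposition joins or separates the orbits of the two points. -/
theorem sameCycle_swap_mul_iff [DecidableEq α] (π : Equiv.Perm α) {u v : α} (huv : u ≠ v) :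
    (Equiv.swap u v * π).SameCycle u v ↔ ¬ π.SameCycle u v := by
  classical
  -- The number `m` is the first positive time at which the orbit of `u` meets `u` or `v`. Until
  -- then the transposition is not felt, and at time `m` it exchanges the two outcomes.
  have hex : ∃ m, 0 < m ∧ ((π ^ m) u = u ∨ (π ^ m) u = v) := by
    obtain ⟨m, hm, h⟩ := (isOfFinOrder_of_finite π).exists_pow_eq_one
    exact ⟨m, hm, Or.inl (by rw [h]; rfl)⟩
  obtain ⟨hm, hret⟩ := Nat.find_spec hex
  set m := Nat.find hex
  have hmin : ∀ t, 0 < t → t < m → (π ^ t) u ≠ u ∧ (π ^ t) u ≠ v := by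
    intro t h0 h1
    have := Nat.find_min hex h1
    tauto
  have hpow : ∀ t, t < m → ((Equiv.swap u v * π) ^ t) u = (π ^ t) u := by
    intro t
    induction t with
    | zero => intro _; rfl
    | succ t ih =>
      intro ht
      rw [pow_succ', Equiv.Perm.mul_apply, ih (by omega), Equiv.Perm.mul_apply,
        ← Equiv.Perm.mul_apply π, ← pow_succ']
      have := hmin (t + 1) (by omega) ht
      exact Equiv.swap_apply_of_ne_of_ne this.1 this.2
  have hpm : ((Equiv.swap u v * π) ^ m) u = Equiv.swap u v ((π ^ m) u) := by
    obtain ⟨t, ht⟩ : ∃ t, m = t + 1 := ⟨m - 1, by omega⟩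
    rw [ht, pow_succ', Equiv.Perm.mul_apply, hpow t (by omega), Equiv.Perm.mul_apply,
        ← Equiv.Perm.mul_apply π, ← pow_succ']
  rcases hret with h | h
  · have h1 := not_sameCycle_of_return huv hm h fun t h0 h1 => (hmin t h0 h1).2
    refine ⟨fun _ => h1, fun _ => ⟨m, ?_⟩⟩
    rw [zpow_natCast, hpm, h, Equiv.swap_apply_left]
  · have h1 : π.SameCycle u v := ⟨m, by rw [zpow_natCast, h]⟩
    have h2 := not_sameCycle_of_return (π := Equiv.swap u v * π) huv hm
      (by rw [hpm, h, Equiv.swap_apply_right])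
      (fun t h0 h1 => by rw [hpow t h1]; exact (hmin t h0 h1).2)
    tauto

end SwapMul

section Step

/-- The next point along the circles of a flat closure with `n` levels, letters `κ` and resolution
`e`; columns of the parity of `s` are oriented downwards, the others upwards. -/
def stepNat (n : ℕ) (κ : ℕ → ℕ) (e : ℕ → Bool) (s : ℕ) (a : ℕ × ℕ) : ℕ × ℕ :=
  if (a.2 + s) % 2 = 0 then
    if a.1 < n then
      if e a.1 = true ∧ a.2 = κ a.1 then (a.1, a.2 + 1)
      else if e a.1 = true ∧ a.2 = κ a.1 + 1 then (a.1, κ a.1) else (a.1 + 1, a.2)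
    else (0, a.2)
  else
    if a.1 = 0 then (n, a.2)
    else if e (a.1 - 1) = true ∧ a.2 = κ (a.1 - 1) then (a.1, a.2 + 1)
    else if e (a.1 - 1) = true ∧ a.2 = κ (a.1 - 1) + 1 then (a.1, κ (a.1 - 1))
    else (a.1 - 1, a.2)

variable {n : ℕ} {κ : ℕ → ℕ} {e : ℕ → Bool} {s : ℕ}

/-- A turnback joins neighbouring columns, which are oriented oppositely, so every arc has a
consistent direction. Changing the parity of `s` reverses all arrows, hence inverts the step. -/
theorem stepNat_stepNat {s t : ℕ} (hst : (s + t) % 2 = 1) {a : ℕ × ℕ} (ha : a.1 ≤ n) :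
    stepNat n κ e t (stepNat n κ e s a) = a := by
  obtain ⟨l, i⟩ := a
  simp only at ha
  by_cases hpar : (i + s) % 2 = 0
  · have hp1 : ¬ (i + t) % 2 = 0 := by omega
    by_cases hl : l < n
    · by_cases h1 : e l = true ∧ i = κ l
      · have hp2 : (i + 1 + t) % 2 = 0 := by omega
        simp [stepNat, hpar, hl, h1.1, ← h1.2, hp2]
      · by_cases h2 : e l = true ∧ i = κ l + 1
        · have hp2 : (κ l + t) % 2 = 0 := by omega
          have hp3 : (κ l + 1 + s) % 2 = 0 := by omega
          simp [stepNat, hl, h2.1, h2.2, hp2, hp3]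
        · have : stepNat n κ e s (l, i) = (l + 1, i) := by
            simp only [stepNat, hpar, hl, if_true, h1, h2, if_false]
          rw [this]
          simp only [stepNat, hp1, if_false, Nat.add_sub_cancel, h1, h2]
          simp
    · have : l = n := by omega
      subst this
      simp [stepNat, hpar, hp1]
  · have hp1 : (i + t) % 2 = 0 := by omega
    by_cases hl : l = 0
    · subst hl; simp [stepNat, hpar, hp1]
    · obtain ⟨l, rfl⟩ : ∃ l', l = l' + 1 := ⟨l - 1, by omega⟩
      by_cases h1 : e l = true ∧ i = κ l
      · have hp2 : ¬ (i + 1 + t) % 2 = 0 := by omega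
        simp [stepNat, hpar, h1.1, ← h1.2, hp2]
      · by_cases h2 : e l = true ∧ i = κ l + 1
        · have hp2 : ¬ (κ l + t) % 2 = 0 := by omega
          have hp3 : ¬ (κ l + 1 + s) % 2 = 0 := by omega
          simp [stepNat, h2.1, h2.2, hp2, hp3]
        · have : stepNat n κ e s (l + 1, i) = (l, i) := by
            simp only [stepNat, hpar, if_false, Nat.add_sub_cancel, h1, h2]
            simp
          rw [this]
          have hl' : l < n := by omega
          simp only [stepNat, hp1, if_true, hl', h1, h2, if_false]

theorem stepNat_fst_le {a : ℕ × ℕ} (ha : a.1 ≤ n) : (stepNat n κ e s a).1 ≤ n := by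
  unfold stepNat
  split_ifs <;> simp <;> omega

theorem stepNat_snd_lt {p : ℕ} (hκ : ∀ l < n, κ l + 1 < p) {a : ℕ × ℕ} (ha : a.1 ≤ n)
    (ha' : a.2 < p) : (stepNat n κ e s a).2 < p := by
  have k1 : a.1 < n → κ a.1 + 1 < p := fun h => hκ _ h
  have k2 : a.1 ≠ 0 → κ (a.1 - 1) + 1 < p := fun h => hκ _ (by omega)
  unfold stepNat
  split_ifs with h1 h2 h3 h4 h5 h6 h7 <;> simp only <;> first | exact ha' | skip
  · have := k1 h2; omega
  · have := k1 h2; omega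
  · have := k2 h5; omega
  · have := k2 h5; omega

end Step

section Word

variable {p : ℕ} {b : List (Fin (p - 1))}

/-- The letter at a level as a natural number. -/
def letterAt (b : List (Fin (p - 1))) (l : ℕ) : ℕ := if h : l < b.length then (b[l] : ℕ) else 0

/-- A resolution as a function on all levels. -/
def extend {n : ℕ} (ε : Fin n → Bool) (l : ℕ) : Bool := if h : l < n then ε ⟨l, h⟩ else false

theorem letterAt_add_one_lt {l : ℕ} (h : l < b.length) : letterAt b l + 1 < p := by
  have := (b[l]).isLt
  rw [letterAt, dif_pos h]
  omega

theorem extend_of_lt {n : ℕ} {ε : Fin n → Bool} {l : ℕ} (h : l < n) : extend ε l = ε ⟨l, h⟩ :=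
  dif_pos h

/-- The marked point of a braid closure in a given level and column. -/
def pt (b : List (Fin (p - 1))) (l i : ℕ) (hl : l ≤ b.length) (hi : i < p) :
    (braidClosure p b).Pt := (⟨l, Nat.lt_succ_of_le hl⟩, ⟨i, hi⟩)

theorem crossing_lt (c : Fin (braidClosure p b).n) : (c : ℕ) < b.length := c.2

theorem corner_nw (c : Fin (braidClosure p b).n) : (braidClosure p b).nw c =
    pt b c (letterAt b c) (crossing_lt c).le
      (Nat.lt_of_succ_lt (letterAt_add_one_lt (crossing_lt c))) := by
  simp only [letterAt, dif_pos (crossing_lt c)]; rfl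

theorem corner_ne (c : Fin (braidClosure p b).n) : (braidClosure p b).ne c =
    pt b c (letterAt b c + 1) (crossing_lt c).le (letterAt_add_one_lt (crossing_lt c)) := by
  simp only [letterAt, dif_pos (crossing_lt c)]; rfl

theorem corner_sw (c : Fin (braidClosure p b).n) : (braidClosure p b).sw c =
    pt b (c + 1) (letterAt b c) (crossing_lt c)
      (Nat.lt_of_succ_lt (letterAt_add_one_lt (crossing_lt c))) := by
  simp only [letterAt, dif_pos (crossing_lt c)]; rfl

theorem corner_se (c : Fin (braidClosure p b).n) : (braidClosure p b).se c =
    pt b (c + 1) (letterAt b c + 1) (crossing_lt c) (letterAt_add_one_lt (crossing_lt c)) := by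
  simp only [letterAt, dif_pos (crossing_lt c)]; rfl

variable {ε : Fin (braidClosure p b).n → Bool}

/-- Away from turnbacks, circles run vertically. -/
theorem circ_vert {l i : ℕ} (hl : l < b.length) (hi : i < p)
    (h : extend ε l = false ∨ (i ≠ letterAt b l ∧ i ≠ letterAt b l + 1)) :
    (braidClosure p b).circ ε (pt b l i hl.le hi) =
      (braidClosure p b).circ ε (pt b (l + 1) i hl hi) := by
  by_cases h1 : i ≠ letterAt b l ∧ i ≠ letterAt b l + 1
  · refine Diagram.circ_eq_of_adj (Diagram.Adj.arc (Or.inl ⟨⟨l, hl⟩, rfl, rfl, rfl, ?_⟩))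
    simpa [letterAt, hl, pt] using h1
  · have h2 : extend ε l = false := by tauto
    rw [extend_of_lt (n := (braidClosure p b).n) hl] at h2
    by_cases h3 : i = letterAt b l
    · subst h3
      have := Diagram.circ_eq_of_adj (Diagram.Adj.zero_left (D := braidClosure p b) _ h2)
      rwa [corner_nw, corner_sw] at this
    · have h3 : i = letterAt b l + 1 := by tauto
      subst h3
      have := Diagram.circ_eq_of_adj (Diagram.Adj.zero_right (D := braidClosure p b) _ h2)
      rwa [corner_ne, corner_se] at this

theorem circ_top {l : ℕ} (hl : l < b.length) (h : extend ε l = true) :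
    (braidClosure p b).circ ε (pt b l (letterAt b l) hl.le
      (Nat.lt_of_succ_lt (letterAt_add_one_lt hl))) =
      (braidClosure p b).circ ε (pt b l (letterAt b l + 1) hl.le (letterAt_add_one_lt hl)) := by
  rw [extend_of_lt (n := (braidClosure p b).n) hl] at h
  have := Diagram.circ_eq_of_adj (Diagram.Adj.one_top (D := braidClosure p b) _ h)
  rwa [corner_nw, corner_ne] at this

theorem circ_bot {l : ℕ} (hl : l < b.length) (h : extend ε l = true) :
    (braidClosure p b).circ ε (pt b (l + 1) (letterAt b l) hl
      (Nat.lt_of_succ_lt (letterAt_add_one_lt hl))) =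
      (braidClosure p b).circ ε (pt b (l + 1) (letterAt b l + 1) hl (letterAt_add_one_lt hl)) := by
  rw [extend_of_lt (n := (braidClosure p b).n) hl] at h
  have := Diagram.circ_eq_of_adj (Diagram.Adj.one_bot (D := braidClosure p b) _ h)
  rwa [corner_sw, corner_se] at this

theorem circ_close {i : ℕ} (hi : i < p) :
    (braidClosure p b).circ ε (pt b b.length i le_rfl hi) =
      (braidClosure p b).circ ε (pt b 0 i (Nat.zero_le _) hi) :=
  Diagram.circ_eq_of_adj (Diagram.Adj.arc (Or.inr ⟨rfl, rfl, rfl⟩))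

/-- Induction principle for adjacency in a braid closure. -/
theorem adj_rec {R : (braidClosure p b).Pt → (braidClosure p b).Pt → Prop}
    (hvert : ∀ l i (hl : l < b.length) (hi : i < p),
      extend ε l = false ∨ (i ≠ letterAt b l ∧ i ≠ letterAt b l + 1) →
      R (pt b l i hl.le hi) (pt b (l + 1) i hl hi))
    (htop : ∀ l (hl : l < b.length), extend ε l = true →
      R (pt b l (letterAt b l) hl.le (Nat.lt_of_succ_lt (letterAt_add_one_lt hl)))
        (pt b l (letterAt b l + 1) hl.le (letterAt_add_one_lt hl)))
    (hbot : ∀ l (hl : l < b.length), extend ε l = true →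
      R (pt b (l + 1) (letterAt b l) hl (Nat.lt_of_succ_lt (letterAt_add_one_lt hl)))
        (pt b (l + 1) (letterAt b l + 1) hl (letterAt_add_one_lt hl)))
    (hclose : ∀ i (hi : i < p), R (pt b b.length i le_rfl hi) (pt b 0 i (Nat.zero_le _) hi))
    {x y : (braidClosure p b).Pt} (h : (braidClosure p b).Adj ε x y) : R x y := by
  obtain ⟨h⟩ | ⟨c, hc⟩ | ⟨c, hc⟩ | ⟨c, hc⟩ | ⟨c, hc⟩ := h
  · obtain ⟨⟨l, i⟩, ⟨l', i'⟩⟩ := x, y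
    rcases h with ⟨k, h1, h2, h3, h4, h5⟩ | ⟨h1, h2, h3⟩
    · simp only at h1 h2 h3 h4 h5
      subst h1 h2 h3
      refine hvert k i k.2 i.2 (Or.inr ?_)
      simp only [letterAt, dif_pos k.2]
      exact ⟨h4, h5⟩
    · simp only at h1 h2 h3
      subst h1 h2 h3
      exact hclose _ i.2
  · rw [corner_nw, corner_sw]
    exact hvert c _ c.2 _ (Or.inl (by rw [extend_of_lt c.2]; exact hc))
  · rw [corner_ne, corner_se]
    exact hvert c _ c.2 _ (Or.inl (by rw [extend_of_lt c.2]; exact hc))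
  · rw [corner_nw, corner_ne]
    exact htop c c.2 (by rw [extend_of_lt c.2]; exact hc)
  · rw [corner_sw, corner_se]
    exact hbot c c.2 (by rw [extend_of_lt c.2]; exact hc)

/-- The permutation of the marked points along the oriented circles of a resolution. -/
def stepPerm (b : List (Fin (p - 1))) (ε : Fin (braidClosure p b).n → Bool) :
    Equiv.Perm (braidClosure p b).Pt := show Equiv.Perm (Fin (b.length + 1) × Fin p) from {
  toFun a := (⟨(stepNat b.length (letterAt b) (extend ε) 0 (a.1, a.2)).1,
      Nat.lt_succ_of_le (stepNat_fst_le (Nat.le_of_lt_succ a.1.2))⟩,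
    ⟨(stepNat b.length (letterAt b) (extend ε) 0 (a.1, a.2)).2,
      stepNat_snd_lt (fun _ h => letterAt_add_one_lt h) (Nat.le_of_lt_succ a.1.2) a.2.2⟩)
  invFun a := (⟨(stepNat b.length (letterAt b) (extend ε) 1 (a.1, a.2)).1,
      Nat.lt_succ_of_le (stepNat_fst_le (Nat.le_of_lt_succ a.1.2))⟩,
    ⟨(stepNat b.length (letterAt b) (extend ε) 1 (a.1, a.2)).2,
      stepNat_snd_lt (fun _ h => letterAt_add_one_lt h) (Nat.le_of_lt_succ a.1.2) a.2.2⟩)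
  left_inv a := by
    have := stepNat_stepNat (n := b.length) (κ := letterAt b) (e := extend ε) (s := 0) (t := 1)
      rfl (a := (a.1, a.2)) (Nat.le_of_lt_succ a.1.2)
    apply Prod.ext <;> apply Fin.ext <;> simp [this]
  right_inv a := by
    have := stepNat_stepNat (n := b.length) (κ := letterAt b) (e := extend ε) (s := 1) (t := 0)
      rfl (a := (a.1, a.2)) (Nat.le_of_lt_succ a.1.2)
    apply Prod.ext <;> apply Fin.ext <;> simp [this] }

theorem stepPerm_pt {l i l' i' : ℕ} {hl : l ≤ b.length} {hi : i < p} (hl' : l' ≤ b.length)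
    (hi' : i' < p) (h : stepNat b.length (letterAt b) (extend ε) 0 (l, i) = (l', i')) :
    stepPerm b ε (pt b l i hl hi) = pt b l' i' hl' hi' :=
  Prod.ext (Fin.ext (congrArg Prod.fst h)) (Fin.ext (congrArg Prod.snd h))

end Word

end Khovanov

namespace Khovanov

section StepValues

variable {n : ℕ} {κ : ℕ → ℕ} {e : ℕ → Bool} {l i : ℕ}

theorem stepNat_down (hi : i % 2 = 0) (hl : l < n)
    (h : e l = false ∨ (i ≠ κ l ∧ i ≠ κ l + 1)) : stepNat n κ e 0 (l, i) = (l + 1, i) := by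
  have h1 : ¬ (e l = true ∧ i = κ l) := by rcases h with h | h <;> simp [h]
  have h2 : ¬ (e l = true ∧ i = κ l + 1) := by rcases h with h | h <;> simp [h]
  simp only [stepNat, add_zero, hi, if_true, hl, h1, h2, if_false]

theorem stepNat_top_right (hi : κ l % 2 = 0) (hl : l < n) (h : e l = true) :
    stepNat n κ e 0 (l, κ l) = (l, κ l + 1) := by
  simp [stepNat, hi, hl, h]

theorem stepNat_top_left (hi : κ l % 2 = 1) (hl : l < n) (h : e l = true) :
    stepNat n κ e 0 (l, κ l + 1) = (l, κ l) := by
  have : (κ l + 1) % 2 = 0 := by omega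
  simp [stepNat, this, hl, h]

theorem stepNat_last (hi : i % 2 = 0) : stepNat n κ e 0 (n, i) = (0, i) := by
  simp [stepNat, hi]

theorem stepNat_up (hi : i % 2 = 1) (h : e l = false ∨ (i ≠ κ l ∧ i ≠ κ l + 1)) :
    stepNat n κ e 0 (l + 1, i) = (l, i) := by
  have h1 : ¬ (e l = true ∧ i = κ l) := by rcases h with h | h <;> simp [h]
  have h2 : ¬ (e l = true ∧ i = κ l + 1) := by rcases h with h | h <;> simp [h]
  have h3 : ¬ i % 2 = 0 := by omega
  simp only [stepNat, add_zero, h3, if_false, Nat.add_sub_cancel, h1, h2]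
  simp

theorem stepNat_bot_right (hi : κ l % 2 = 1) (h : e l = true) :
    stepNat n κ e 0 (l + 1, κ l) = (l + 1, κ l + 1) := by
  simp [stepNat, hi, h]

theorem stepNat_bot_left (hi : κ l % 2 = 0) (h : e l = true) :
    stepNat n κ e 0 (l + 1, κ l + 1) = (l + 1, κ l) := by
  have : ¬ (κ l + 1) % 2 = 0 := by omega
  simp only [stepNat, add_zero, this, if_false, Nat.add_sub_cancel, h]
  simp

theorem stepNat_first (hi : i % 2 = 1) : stepNat n κ e 0 (0, i) = (n, i) := by
  simp [stepNat, hi]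

end StepValues

section Good

variable {p : ℕ} {b : List (Fin (p - 1))} {ε : Fin (braidClosure p b).n → Bool}

theorem circ_stepPerm (x : (braidClosure p b).Pt) :
    (braidClosure p b).circ ε (stepPerm b ε x) = (braidClosure p b).circ ε x := by
  obtain ⟨⟨l, hl⟩, ⟨i, hi⟩⟩ := x
  have hl' : l ≤ b.length := Nat.le_of_lt_succ hl
  show (braidClosure p b).circ ε (stepPerm b ε (pt b l i hl' hi)) =
    (braidClosure p b).circ ε (pt b l i hl' hi)
  rcases Nat.mod_two_eq_zero_or_one i with h2 | h2
  · rcases hl'.lt_or_eq with h | rfl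
    · by_cases hv : extend ε l = false ∨ (i ≠ letterAt b l ∧ i ≠ letterAt b l + 1)
      · rw [stepPerm_pt h hi (stepNat_down h2 h hv)]
        exact (circ_vert h hi hv).symm
      · have he : extend ε l = true := by
          cases h' : extend ε l <;> simp_all
        by_cases hk : i = letterAt b l
        · subst hk
          rw [stepPerm_pt h.le (letterAt_add_one_lt h) (stepNat_top_right h2 h he)]
          exact (circ_top h he).symm
        · have hk : i = letterAt b l + 1 := by tauto
          subst hk
          rw [stepPerm_pt h.le (by omega) (stepNat_top_left (by omega) h he)]
          exact circ_top h he
    · rw [stepPerm_pt (Nat.zero_le _) hi (stepNat_last h2)]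
      exact (circ_close hi).symm
  · rcases Nat.eq_zero_or_pos l with rfl | h
    · rw [stepPerm_pt le_rfl hi (stepNat_first h2)]
      exact circ_close hi
    · obtain ⟨l, rfl⟩ : ∃ l', l = l' + 1 := ⟨l - 1, by omega⟩
      have hl'' : l < b.length := hl'
      by_cases hv : extend ε l = false ∨ (i ≠ letterAt b l ∧ i ≠ letterAt b l + 1)
      · rw [stepPerm_pt hl''.le hi (stepNat_up h2 hv)]
        exact circ_vert hl'' hi hv
      · have he : extend ε l = true := by
          cases h' : extend ε l <;> simp_all
        by_cases hk : i = letterAt b l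
        · subst hk
          rw [stepPerm_pt hl' (letterAt_add_one_lt hl'') (stepNat_bot_right h2 he)]
          exact (circ_bot hl'' he).symm
        · have hk : i = letterAt b l + 1 := by tauto
          subst hk
          rw [stepPerm_pt hl' (by omega) (stepNat_bot_left (by omega) he)]
          exact circ_bot hl'' he

theorem sameCycle_of_stepPerm_eq {x y : (braidClosure p b).Pt} (h : stepPerm b ε x = y) :
    (stepPerm b ε).SameCycle x y := ⟨1, by simpa using h⟩

/-- Circles are the orbits of `stepPerm`. -/
theorem sameCycle_iff_circ {x y : (braidClosure p b).Pt} :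
    (stepPerm b ε).SameCycle x y ↔
      (braidClosure p b).circ ε x = (braidClosure p b).circ ε y := by
  constructor
  · intro h
    obtain ⟨k, rfl⟩ := Equiv.Perm.SameCycle.exists_nat_pow_eq h
    clear h
    induction k with
    | zero => rfl
    | succ k ih => rw [ih, pow_succ', Equiv.Perm.mul_apply]; exact (circ_stepPerm _).symm
  · intro h
    refine Quotient.exact (s := Equiv.Perm.SameCycle.setoid (stepPerm b ε))
      (Diagram.circ_factor (fun x : (braidClosure p b).Pt =>
        (Quotient.mk (Equiv.Perm.SameCycle.setoid (stepPerm b ε)) x)) (fun x y hxy => ?_) h)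
    refine Quotient.sound (s := Equiv.Perm.SameCycle.setoid (stepPerm b ε)) ?_
    refine adj_rec (R := fun x y => (stepPerm b ε).SameCycle x y) ?_ ?_ ?_ ?_ hxy
    · intro l i hl hi h
      rcases Nat.mod_two_eq_zero_or_one i with h2 | h2
      · exact sameCycle_of_stepPerm_eq (stepPerm_pt hl hi (stepNat_down h2 hl h))
      · exact (sameCycle_of_stepPerm_eq (stepPerm_pt hl.le hi (stepNat_up h2 h))).symm
    · intro l hl h
      rcases Nat.mod_two_eq_zero_or_one (letterAt b l) with h2 | h2
      · exact sameCycle_of_stepPerm_eq (stepPerm_pt _ _ (stepNat_top_right h2 hl h))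
      · exact (sameCycle_of_stepPerm_eq (stepPerm_pt _ _ (stepNat_top_left h2 hl h))).symm
    · intro l hl h
      rcases Nat.mod_two_eq_zero_or_one (letterAt b l) with h2 | h2
      · exact (sameCycle_of_stepPerm_eq (stepPerm_pt _ _ (stepNat_bot_left h2 h))).symm
      · exact sameCycle_of_stepPerm_eq (stepPerm_pt _ _ (stepNat_bot_right h2 h))
    · intro i hi
      rcases Nat.mod_two_eq_zero_or_one i with h2 | h2
      · exact sameCycle_of_stepPerm_eq (stepPerm_pt _ _ (stepNat_last h2))
      · exact (sameCycle_of_stepPerm_eq (stepPerm_pt _ _ (stepNat_first h2))).symm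

/-- A step consults one letter at most: the one below the point in a downward column and the one
above it in an upward column, and only if that letter involves the column. -/
theorem stepNat_congr {n : ℕ} {κ : ℕ → ℕ} {e e' : ℕ → Bool} {l i : ℕ} (s : ℕ)
    (h1 : (i + s) % 2 = 0 → l < n → (i = κ l ∨ i = κ l + 1) → e l = e' l)
    (h2 : (i + s) % 2 = 1 → l ≠ 0 → (i = κ (l - 1) ∨ i = κ (l - 1) + 1) →
      e (l - 1) = e' (l - 1)) : stepNat n κ e s (l, i) = stepNat n κ e' s (l, i) := by
  unfold stepNat
  rcases Nat.mod_two_eq_zero_or_one (i + s) with h | h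
  · simp only [h, if_true]
    by_cases hl : l < n
    · simp only [hl, if_true]
      by_cases ha : i = κ l
      · rw [h1 h hl (Or.inl ha)]
      · by_cases hb : i = κ l + 1
        · rw [h1 h hl (Or.inr hb)]
        · simp [ha, hb]
    · simp only [hl, if_false]
  · have h' : ¬ (i + s) % 2 = 0 := by omega
    simp only [h', if_false]
    by_cases hl : l = 0
    · simp only [hl, if_true]
    · simp only [hl, if_false]
      by_cases ha : i = κ (l - 1)
      · rw [h2 h hl (Or.inl ha)]
      · by_cases hb : i = κ (l - 1) + 1
        · rw [h2 h hl (Or.inr hb)]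
        · simp [ha, hb]

theorem extend_update_self {n : ℕ} {ε : Fin n → Bool} {c : Fin n} {v : Bool} :
    extend (Function.update ε c v) c = v := by
  rw [extend_of_lt c.2]; simp

theorem extend_update_of_ne {n : ℕ} {ε : Fin n → Bool} {c : Fin n} {v : Bool} {l : ℕ}
    (h : l ≠ c) : extend (Function.update ε c v) l = extend ε l := by
  unfold extend
  split_ifs with hl
  · exact Function.update_of_ne (fun h' => h (by rw [← h'])) _ _
  · rfl

theorem extend_fin {n : ℕ} {ε : Fin n → Bool} (c : Fin n) : extend ε c = ε c :=
  extend_of_lt c.2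

-- Changing the resolution of `c` redirects two arrows only, by exchanging their targets, so
-- `sameCycle_swap_mul_iff` becomes applicable.
open Classical in
theorem stepPerm_update {c : Fin (braidClosure p b).n} {u v x y : (braidClosure p b).Pt}
    (hu : stepPerm b ε x = u) (hv : stepPerm b ε y = v)
    (hu' : stepPerm b (Function.update ε c true) x = v)
    (hv' : stepPerm b (Function.update ε c true) y = u)
    (h : ∀ z, z ≠ x → z ≠ y → stepPerm b (Function.update ε c true) z = stepPerm b ε z) :
    stepPerm b (Function.update ε c true) = Equiv.swap u v * stepPerm b ε := by
  ext1 z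
  rw [Equiv.Perm.mul_apply]
  by_cases hzx : z = x
  · rw [hzx, hu', hu, Equiv.swap_apply_left]
  by_cases hzy : z = y
  · rw [hzy, hv', hv, Equiv.swap_apply_right]
  rw [h z hzx hzy, Equiv.swap_apply_of_ne_of_ne]
  · rw [← hu]; exact fun h => hzx ((stepPerm b ε).injective h)
  · rw [← hv]; exact fun h => hzy ((stepPerm b ε).injective h)

theorem pt_eq_iff {l i l' i' : ℕ} {hl : l ≤ b.length} {hi : i < p} {hl' : l' ≤ b.length}
    {hi' : i' < p} : pt b l i hl hi = pt b l' i' hl' hi' ↔ l = l' ∧ i = i' := by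
  constructor
  · intro h
    exact ⟨congrArg (fun z : Fin (b.length + 1) × Fin p => (z.1 : ℕ)) h,
      congrArg (fun z : Fin (b.length + 1) × Fin p => (z.2 : ℕ)) h⟩
  · rintro ⟨rfl, rfl⟩; rfl

/-- In the closure of a positive braid, every edge of the cube merges or splits circles. -/
theorem good_braidClosure (p : ℕ) (b : List (Fin (p - 1))) : (braidClosure p b).Good := by
  classical
  intro ε c hc
  have hcl : (c : ℕ) < b.length := c.2
  have he : extend ε c = false := by rw [extend_fin, hc]
  have he' : extend (Function.update ε c true) c = true := extend_update_self
  have hk := letterAt_add_one_lt hcl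
  have hk' : letterAt b c < p := by omega
  -- The arrows that pass through `c` start at `nw` and `se` if the left column runs downwards, and
  -- at `ne` and `sw` if it runs upwards.
  have hrest : ∀ z : (braidClosure p b).Pt, ((letterAt b c % 2 = 0 ∧ z ≠ (braidClosure p b).nw c ∧
      z ≠ (braidClosure p b).se c) ∨ (letterAt b c % 2 = 1 ∧ z ≠ (braidClosure p b).ne c ∧
      z ≠ (braidClosure p b).sw c)) →
      stepPerm b (Function.update ε c true) z = stepPerm b ε z := by
    rintro ⟨⟨l, hl⟩, ⟨i, hi⟩⟩ h
    have hz : ((⟨l, hl⟩, ⟨i, hi⟩) : (braidClosure p b).Pt) = pt b l i (Nat.le_of_lt_succ hl) hi :=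
      rfl
    rw [hz, corner_nw, corner_se, corner_ne, corner_sw] at h
    simp only [ne_eq, pt_eq_iff] at h
    have : stepNat b.length (letterAt b) (extend (Function.update ε c true)) 0 (l, i) =
        stepNat b.length (letterAt b) (extend ε) 0 (l, i) := by
      apply stepNat_congr
      · intro h1 h2 h3
        refine extend_update_of_ne fun h4 => ?_
        subst h4
        omega
      · intro h1 h2 h3
        refine extend_update_of_ne fun h4 => ?_
        rw [h4] at h3
        omega
    exact Prod.ext (Fin.ext (congrArg Prod.fst this)) (Fin.ext (congrArg Prod.snd this))
  rcases Nat.mod_two_eq_zero_or_one (letterAt b c) with h2 | h2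
  -- The 0-resolution has the arrows `nw → sw` and `se → ne`; the 1-resolution has `nw → ne` and `se
  -- → sw`. The other parity is analogous.
  · have hsw := stepPerm_update (c := c) (x := (braidClosure p b).nw c)
      (y := (braidClosure p b).se c) (u := (braidClosure p b).sw c) (v := (braidClosure p b).ne c)
      (by rw [corner_nw, corner_sw]; exact stepPerm_pt _ _ (stepNat_down h2 hcl (Or.inl he)))
      (by rw [corner_se, corner_ne]; exact stepPerm_pt _ _ (stepNat_up (by omega) (Or.inl he)))
      (by rw [corner_nw, corner_ne]; exact stepPerm_pt _ _ (stepNat_top_right h2 hcl he'))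
      (by rw [corner_se, corner_sw]; exact stepPerm_pt _ _ (stepNat_bot_left h2 he'))
      (fun z h1 h3 => hrest z (Or.inl ⟨h2, h1, h3⟩))
    have hne : (braidClosure p b).sw c ≠ (braidClosure p b).ne c := by
      rw [corner_sw, corner_ne, ne_eq, pt_eq_iff]; omega
    have key := sameCycle_swap_mul_iff (stepPerm b ε) hne
    rw [← hsw, sameCycle_iff_circ, sameCycle_iff_circ] at key
    have l0 := Diagram.circ_eq_of_adj (Diagram.Adj.zero_left (D := braidClosure p b) (ε := ε) c hc)
    have l1 := Diagram.circ_eq_of_adj (Diagram.Adj.one_top (D := braidClosure p b)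
      (ε := Function.update ε c true) c (by simp))
    rw [l0, l1]
    constructor
    · intro h h'; exact (key.1 h'.symm) h
    · intro h; by_contra h'; exact h (key.2 h').symm
  · have hsw := stepPerm_update (c := c) (x := (braidClosure p b).ne c)
      (y := (braidClosure p b).sw c) (u := (braidClosure p b).se c) (v := (braidClosure p b).nw c)
      (by
        rw [corner_ne, corner_se]
        exact stepPerm_pt _ _ (stepNat_down (by omega) hcl (Or.inl he)))
      (by rw [corner_sw, corner_nw]; exact stepPerm_pt _ _ (stepNat_up h2 (Or.inl he)))
      (by rw [corner_nw, corner_ne]; exact stepPerm_pt _ _ (stepNat_top_left h2 hcl he'))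
      (by rw [corner_se, corner_sw]; exact stepPerm_pt _ _ (stepNat_bot_right h2 he'))
      (fun z h1 h3 => hrest z (Or.inr ⟨h2, h1, h3⟩))
    have hne : (braidClosure p b).se c ≠ (braidClosure p b).nw c := by
      rw [corner_se, corner_nw, ne_eq, pt_eq_iff]; omega
    have key := sameCycle_swap_mul_iff (stepPerm b ε) hne
    rw [← hsw, sameCycle_iff_circ, sameCycle_iff_circ] at key
    have l0 := Diagram.circ_eq_of_adj (Diagram.Adj.zero_right (D := braidClosure p b) (ε := ε) c hc)
    have l1 := Diagram.circ_eq_of_adj (Diagram.Adj.one_bot (D := braidClosure p b)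
      (ε := Function.update ε c true) c (by simp))
    rw [l0, l1]
    constructor
    · intro h h'; exact (key.1 h'.symm) h.symm
    · intro h; by_contra h'; exact h (key.2 fun h3 => h' h3.symm).symm

end Good

end Khovanov

/-! ### Transferring labels and signs between cubes -/

namespace Khovanov

namespace Diagram

section Embeds

variable {D D' : Diagram}

/-- The circles of `ε` are identified by `f` with those circles of `ε'` that avoid `O`, and `O` is
at most one circle. -/
structure Embeds (ε : Fin D.n → Bool) (ε' : Fin D'.n → Bool) (f : D.Pt → D'.Pt) (O : Set D'.Pt) :
    Prop where
  iff : ∀ a b, D.circ ε a = D.circ ε b ↔ D'.circ ε' (f a) = D'.circ ε' (f b)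
  cover : ∀ b, b ∈ O ∨ ∃ a, D'.circ ε' b = D'.circ ε' (f a)
  sep : ∀ b ∈ O, ∀ a, D'.circ ε' b ≠ D'.circ ε' (f a)
  single : ∀ b ∈ O, ∀ b' ∈ O, D'.circ ε' b = D'.circ ε' b'

open Classical in
/-- Extension of a labelling along `Embeds` by a fixed label on the extra circle. -/
noncomputable def extLabel (ε : Fin D.n → Bool) (ε' : Fin D'.n → Bool) (f : D.Pt → D'.Pt) (g : Gen)
    (x : D.Circle ε → Gen) : D'.Circle ε' → Gen :=
  fun γ => if h : ∃ a, D'.circ ε' (f a) = γ then x (D.circ ε h.choose) else g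

/-- Restriction of a labelling along `Embeds`. -/
noncomputable def resLabel (ε : Fin D.n → Bool) (ε' : Fin D'.n → Bool) (f : D.Pt → D'.Pt)
    (y : D'.Circle ε' → Gen) : D.Circle ε → Gen :=
  fun γ => y (D'.circ ε' (f (Quot.out γ)))

variable {ε : Fin D.n → Bool} {ε' : Fin D'.n → Bool} {f : D.Pt → D'.Pt} {O : Set D'.Pt} {g : Gen}

theorem Embeds.ext_apply (h : Embeds ε ε' f O) (x : D.Circle ε → Gen) (a : D.Pt) :
    extLabel ε ε' f g x (D'.circ ε' (f a)) = x (D.circ ε a) := by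
  have h1 : ∃ a', D'.circ ε' (f a') = D'.circ ε' (f a) := ⟨a, rfl⟩
  rw [extLabel, dif_pos h1]
  congr 1
  exact (h.iff _ _).2 h1.choose_spec

theorem Embeds.ext_extra (h : Embeds ε ε' f O) (x : D.Circle ε → Gen) {b : D'.Pt} (hb : b ∈ O) :
    extLabel ε ε' f g x (D'.circ ε' b) = g := by
  rw [extLabel, dif_neg]
  rintro ⟨a, ha⟩
  exact h.sep b hb a ha.symm

theorem Embeds.res_apply (h : Embeds ε ε' f O) (y : D'.Circle ε' → Gen) (a : D.Pt) :
    resLabel ε ε' f y (D.circ ε a) = y (D'.circ ε' (f a)) := by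
  rw [resLabel]
  congr 1
  exact (h.iff _ _).1 (Quot.out_eq (D.circ ε a))

/-- The circles of `ε'` are those of `ε`, plus the single circle `O` when `O` is nonempty; that
circle alone accounts for the difference. -/
theorem Embeds.sum_deg (h : Embeds ε ε' f O) (x : D.Circle ε → Gen) {s : ℤ}
    (hs : (O = ∅ ∧ s = 0) ∨ (O.Nonempty ∧ s = g.deg)) :
    ∑ γ, (extLabel ε ε' f g x γ).deg = ∑ γ, (x γ).deg + s := by
  let ι : D.Circle ε → D'.Circle ε' := Quot.lift (fun a => D'.circ ε' (f a))
    fun a b hab => (h.iff a b).1 (circ_eq_of_adj hab)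
  have hι : ∀ a, ι (D.circ ε a) = D'.circ ε' (f a) := fun a => rfl
  have hinj : Function.Injective ι := by
    intro γ δ
    obtain ⟨a, rfl⟩ := circ_surjective γ
    obtain ⟨b, rfl⟩ := circ_surjective δ
    exact (h.iff a b).2
  have hx : ∀ γ, extLabel ε ε' f g x (ι γ) = x γ := by
    intro γ
    obtain ⟨a, rfl⟩ := circ_surjective γ
    exact h.ext_apply x a
  rcases hs with ⟨hO, rfl⟩ | ⟨⟨o, ho⟩, rfl⟩
  · rw [add_zero]
    refine (Fintype.sum_bijective ι ⟨hinj, fun γ => ?_⟩ _ _ fun γ => by rw [hx]).symm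
    obtain ⟨b, rfl⟩ := circ_surjective γ
    rcases h.cover b with hb | ⟨a, ha⟩
    · rw [hO] at hb; exact absurd hb id
    · exact ⟨D.circ ε a, ha.symm⟩
  · let e : Option (D.Circle ε) → D'.Circle ε' := fun u => u.elim (D'.circ ε' o) ι
    have he : Function.Bijective e := by
      constructor
      · rintro (_ | γ) (_ | δ) hγ
        · rfl
        · obtain ⟨a, rfl⟩ := circ_surjective δ
          exact absurd hγ (h.sep o ho a)
        · obtain ⟨a, rfl⟩ := circ_surjective γ
          exact absurd hγ.symm (h.sep o ho a)
        · rw [hinj hγ]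
      · intro γ
        obtain ⟨b, rfl⟩ := circ_surjective γ
        rcases h.cover b with hb | ⟨a, ha⟩
        · exact ⟨none, h.single o ho b hb⟩
        · exact ⟨some (D.circ ε a), ha.symm⟩
    rw [← Fintype.sum_bijective e he (fun u => (extLabel ε ε' f g x (e u)).deg) _ fun u => rfl,
      Fintype.sum_option, add_comm]
    congr 1
    · exact Finset.sum_congr rfl fun γ _ => by rw [← hx γ]; rfl
    · show (extLabel ε ε' f g x (D'.circ ε' o)).deg = _
      rw [h.ext_extra x ho]

/-- Corresponding edges have the same coefficients. -/
theorem Embeds.edgeCoeff_eq {ε₁ : Fin D.n → Bool} {ε₁' : Fin D'.n → Bool} {c : Fin D.n}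
    {c' : Fin D'.n} (h : Embeds ε ε' f O) (h₁ : Embeds ε₁ ε₁' f O)
    (hcover : ∀ b, b ∈ O ∨ ∃ a, D'.circ ε' b = D'.circ ε' (f a) ∧ D'.circ ε₁' b = D'.circ ε₁' (f a))
    (hc : ε c = false) (hc' : ε' c' = false) (hε : ε₁ = Function.update ε c true)
    (hε' : ε₁' = Function.update ε' c' true)
    (hnw : D'.circ ε' (f (D.nw c)) = D'.circ ε' (D'.nw c'))
    (hne : D'.circ ε' (f (D.ne c)) = D'.circ ε' (D'.ne c'))
    (hnw₁ : D'.circ ε₁' (f (D.nw c)) = D'.circ ε₁' (D'.nw c'))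
    (hsw₁ : D'.circ ε₁' (f (D.sw c)) = D'.circ ε₁' (D'.sw c'))
    (x : D.Circle ε → Gen) (y : D.Circle ε₁ → Gen) :
    D'.edgeCoeff c' ⟨ε', extLabel ε ε' f g x⟩ ⟨ε₁', extLabel ε₁ ε₁' f g y⟩ =
      D.edgeCoeff c ⟨ε, x⟩ ⟨ε₁, y⟩ := by
  classical
  -- The condition on uninvolved circles transfers because the extra circle carries the same label
  -- `g` at both ends of the edge.
  have hcond : (∀ a : D'.Pt, D'.circ ε' a ≠ D'.circ ε' (D'.nw c') →
      D'.circ ε' a ≠ D'.circ ε' (D'.ne c') →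
        extLabel ε₁ ε₁' f g y (D'.circ ε₁' a) = extLabel ε ε' f g x (D'.circ ε' a)) ↔
      ∀ a : D.Pt, D.circ ε a ≠ D.circ ε (D.nw c) → D.circ ε a ≠ D.circ ε (D.ne c) →
        y (D.circ ε₁ a) = x (D.circ ε a) := by
    constructor
    · intro H a h1 h2
      have := H (f a) (by rw [← hnw]; exact fun h' => h1 ((h.iff _ _).2 h'))
        (by rw [← hne]; exact fun h' => h2 ((h.iff _ _).2 h'))
      rwa [h₁.ext_apply, h.ext_apply] at this
    · intro H b h1 h2
      rcases hcover b with hb | ⟨a, ha, ha₁⟩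
      · rw [h₁.ext_extra _ hb, h.ext_extra _ hb]
      · rw [ha, ha₁, h₁.ext_apply, h.ext_apply]
        refine H a (fun h' => h1 ?_) (fun h' => h2 ?_)
        · rw [ha, ← hnw]; exact (h.iff _ _).1 h'
        · rw [ha, ← hne]; exact (h.iff _ _).1 h'
  unfold edgeCoeff
  simp only [hcond, hc, hc', hε', hε, true_and]
  subst hε hε'
  rw [← hnw, ← hne, ← hnw₁, ← hsw₁]
  simp only [h.ext_apply, h₁.ext_apply, ne_eq, ← h.iff, ← h₁.iff]

end Embeds

section Gauge

/-- A sign depending on pairs is the coboundary of a gauge. -/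
theorem exists_gauge {n : ℕ} (T : Fin n → ℤ) (J : Fin n → Fin n → ℤ) (hT : ∀ c, T c * T c = 1)
    (hJ : ∀ k c, J k c * J k c = 1) (hJs : ∀ k c, k ≠ c → J k c = J c k) :
    ∃ γ : (Fin n → Bool) → ℤ, (∀ ε, γ ε * γ ε = 1) ∧ ∀ ε c, ε c = false →
      γ (Function.update ε c true) = γ ε * (T c * ∏ k, if ε k = true then J k c else 1) := by
  classical
  -- The gauge multiplies `T` over the 1-resolved crossings and `J` over the unordered pairs of
  -- them. Turning on `c` adds the pairs containing `c`, and symmetry of `J` makes their order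
  -- irrelevant.
  refine ⟨fun ε => (∏ c, if ε c = true then T c else 1) *
    ∏ a, ∏ b, if b < a ∧ ε a = true ∧ ε b = true then J b a else 1, ?_, ?_⟩
  · intro ε
    rw [mul_mul_mul_comm, ← Finset.prod_mul_distrib, ← Finset.prod_mul_distrib]
    rw [Finset.prod_eq_one, Finset.prod_eq_one, mul_one]
    · intro a _
      rw [← Finset.prod_mul_distrib, Finset.prod_eq_one]
      intro b _
      split_ifs
      · exact hJ _ _
      · rfl
    · intro c _
      split_ifs
      · exact hT c
      · rfl
  · intro ε c hc
    have h1 : (∏ a, if Function.update ε c true a = true then T a else 1) =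
        (∏ a, if ε a = true then T a else 1) * T c := by
      have : ∀ a, (if Function.update ε c true a = true then T a else 1) =
          (if ε a = true then T a else 1) * (if a = c then T c else 1) := by
        intro a
        by_cases ha : a = c
        · subst ha; simp [hc]
        · simp [ha]
      simp only [this, Finset.prod_mul_distrib]
      simp
    have h2 : (∏ a, ∏ b, if b < a ∧ Function.update ε c true a = true ∧
          Function.update ε c true b = true then J b a else 1) =
        (∏ a, ∏ b, if b < a ∧ ε a = true ∧ ε b = true then J b a else 1) *
          ∏ k, if ε k = true then J k c else 1 := by
      have : ∀ a b, (if b < a ∧ Function.update ε c true a = true ∧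
          Function.update ε c true b = true then J b a else 1) =
          (if b < a ∧ ε a = true ∧ ε b = true then J b a else 1) *
          ((if a = c then (if b < c ∧ ε b = true then J b c else 1) else 1) *
          (if b = c then (if c < a ∧ ε a = true then J c a else 1) else 1)) := by
        intro a b
        by_cases ha : a = c
        · subst ha
          by_cases hb : b = a
          · subst hb; simp
          · simp [hb, hc]
        · by_cases hb : b = c
          · subst hb; simp [ha, hc]
          · simp [ha, hb]
      simp only [this, Finset.prod_mul_distrib]
      congr 1
      have e1 : (∏ a, ∏ b, if a = c then (if b < c ∧ ε b = true then J b c else 1) else 1) =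
          ∏ b, if b < c ∧ ε b = true then J b c else 1 := by
        rw [Finset.prod_comm]; simp
      have e2 : (∏ a, ∏ b, if b = c then (if c < a ∧ ε a = true then J c a else 1) else 1) =
          ∏ a, if c < a ∧ ε a = true then J c a else 1 := by simp
      rw [e1, e2, ← Finset.prod_mul_distrib]
      refine Finset.prod_congr rfl fun k _ => ?_
      rcases lt_trichotomy k c with h | h | h
      · simp [h, h.le.not_gt]
      · subst h; simp [hc]
      · simp [h, h.le.not_gt, hJs k c h.ne']
    simp only [h1, h2]
    ring

end Gauge

end Diagram

end Khovanov

/-! ### Faces of the cube of resolutions and their comparison -/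

namespace Khovanov

/-- `ε` extends the partial resolution `τ`. -/
def Fits {n : ℕ} (τ : Fin n → Option Bool) (ε : Fin n → Bool) : Prop :=
  ∀ c v, τ c = some v → ε c = v

/-- The number of crossings that are fixed to be `1`-resolved. -/
def ones {n : ℕ} (τ : Fin n → Option Bool) : ℕ := (Finset.univ.filter fun c => τ c = some true).card

/-- The relation `R` is a bijection between the free crossings of two partial resolutions. -/
structure CrossingMatch {n n' : ℕ} (τ : Fin n → Option Bool) (τ' : Fin n' → Option Bool)
    (R : Fin n → Fin n' → Prop) : Prop where
  free : ∀ c d, R c d → τ c = none ∧ τ' d = none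
  total : ∀ c, τ c = none → ∃ d, R c d
  total' : ∀ d, τ' d = none → ∃ c, R c d
  right_unique : ∀ c d d', R c d → R c d' → d = d'
  left_unique : ∀ c c' d, R c d → R c' d → c = c'

/-- `ε` and `ε'` extend `τ` and `τ'` by corresponding resolutions of the free crossings. -/
structure FaceRel {n n' : ℕ} (τ : Fin n → Option Bool) (τ' : Fin n' → Option Bool)
    (R : Fin n → Fin n' → Prop) (ε : Fin n → Bool) (ε' : Fin n' → Bool) : Prop where
  fits : Fits τ ε
  fits' : Fits τ' ε'
  eq : ∀ c d, R c d → ε' d = ε c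

open Classical in
/-- The resolution extending `τ'` that corresponds to `ε`. -/
noncomputable def transport {n n' : ℕ} (τ' : Fin n' → Option Bool) (R : Fin n → Fin n' → Prop)
    (ε : Fin n → Bool) : Fin n' → Bool :=
  fun d => (τ' d).getD (decide (∃ c, R c d ∧ ε c = true))

section Match

variable {n n' : ℕ} {τ : Fin n → Option Bool} {τ' : Fin n' → Option Bool}
  {R : Fin n → Fin n' → Prop}

theorem fits_transport (ε : Fin n → Bool) : Fits τ' (transport τ' R ε) := by
  intro c v hc
  simp [transport, hc]

theorem CrossingMatch.symm (h : CrossingMatch τ τ' R) : CrossingMatch τ' τ (flip R) :=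
  ⟨fun c d hcd => (h.free d c hcd).symm, h.total', h.total, fun c d d' => h.left_unique d d' c,
    fun c c' d => h.right_unique d c c'⟩

theorem CrossingMatch.transport_eq (h : CrossingMatch τ τ' R) (ε : Fin n → Bool) {c : Fin n}
    {d : Fin n'} (hcd : R c d) : transport τ' R ε d = ε c := by
  have h1 : (∃ c, R c d ∧ ε c = true) ↔ ε c = true :=
    ⟨fun ⟨c', h2, h3⟩ => by rwa [h.left_unique c c' d hcd h2], fun h2 => ⟨c, hcd, h2⟩⟩
  simp only [transport, (h.free c d hcd).2, Option.getD_none, h1, Bool.decide_eq_true]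

theorem CrossingMatch.rel (h : CrossingMatch τ τ' R) {ε : Fin n → Bool} (hε : Fits τ ε) :
    FaceRel τ τ' R ε (transport τ' R ε) :=
  ⟨hε, fits_transport ε, fun _ _ hcd => h.transport_eq ε hcd⟩

theorem CrossingMatch.rel' (h : CrossingMatch τ τ' R) {ε : Fin n' → Bool} (hε : Fits τ' ε) :
    FaceRel τ τ' R (transport τ (flip R) ε) ε :=
  ⟨fits_transport ε, hε, fun c d hcd => (h.symm.transport_eq (c := d) (d := c) ε hcd).symm⟩

theorem CrossingMatch.transport_transport (h : CrossingMatch τ τ' R) {ε : Fin n → Bool}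
    (hε : Fits τ ε) : transport τ (flip R) (transport τ' R ε) = ε := by
  funext c
  cases hc : τ c with
  | none =>
    obtain ⟨d, hd⟩ := h.total c hc
    rw [h.symm.transport_eq (c := d) (d := c) _ hd, h.transport_eq _ hd]
  | some v => rw [fits_transport _ c v hc, hε c v hc]

theorem CrossingMatch.transport_update (h : CrossingMatch τ τ' R) (ε : Fin n → Bool)
    {c : Fin n} {d : Fin n'} (hcd : R c d) :
    transport τ' R (Function.update ε c true) =
      Function.update (transport τ' R ε) d true := by
  funext k
  by_cases hk : k = d
  · subst hk
    rw [h.transport_eq _ hcd]; simp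
  · rw [Function.update_of_ne hk]
    cases hk' : τ' k with
    | none =>
      obtain ⟨k', hkk⟩ := h.total' k hk'
      rw [h.transport_eq _ hkk, h.transport_eq _ hkk, Function.update_of_ne]
      rintro rfl
      exact hk (h.right_unique _ _ _ hkk hcd)
    | some v => rw [fits_transport _ k v hk', fits_transport _ k v hk']

theorem Fits.update {ε : Fin n → Bool} (h : Fits τ ε) {c : Fin n} (hc : τ c = none) (v : Bool) :
    Fits τ (Function.update ε c v) := by
  intro k w hk
  rw [Function.update_of_ne, h k w hk]
  rintro rfl
  simp [hc] at hk

theorem CrossingMatch.prod_free (h : CrossingMatch τ τ' R) {F : Fin n → ℤ} {F' : Fin n' → ℤ}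
    (hF : ∀ c d, R c d → F c = F' d) :
    (∏ k, if τ' k = none then F' k else 1) = ∏ k, if τ k = none then F k else 1 := by
  rw [← Finset.prod_filter, ← Finset.prod_filter]
  symm
  refine Finset.prod_bij (fun c hc => (h.total c (by simpa using hc)).choose) ?_ ?_ ?_ ?_
  · intro c hc
    simpa using (h.free _ _ (h.total c (by simpa using hc)).choose_spec).2
  · intro c hc c' hc' he
    have h1 := (h.total c (by simpa using hc)).choose_spec
    have h2 := (h.total c' (by simpa using hc')).choose_spec
    rw [he] at h1
    exact h.left_unique _ _ _ h1 h2
  · intro d hd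
    obtain ⟨c, hc⟩ := h.total' d (by simpa using hd)
    have h1 := (h.free _ _ hc).1
    exact ⟨c, by simpa using h1, h.right_unique _ _ _ (h.total c h1).choose_spec hc⟩
  · intro c hc
    exact hF _ _ (h.total c (by simpa using hc)).choose_spec

theorem CrossingMatch.sum_free (h : CrossingMatch τ τ' R) {F : Fin n → ℕ} {F' : Fin n' → ℕ}
    (hF : ∀ c d, R c d → F c = F' d) :
    (∑ k, if τ' k = none then F' k else 0) = ∑ k, if τ k = none then F k else 0 := by
  rw [← Finset.sum_filter, ← Finset.sum_filter]
  symm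
  refine Finset.sum_bij (fun c hc => (h.total c (by simpa using hc)).choose) ?_ ?_ ?_ ?_
  · intro c hc
    simpa using (h.free _ _ (h.total c (by simpa using hc)).choose_spec).2
  · intro c hc c' hc' he
    have h1 := (h.total c (by simpa using hc)).choose_spec
    have h2 := (h.total c' (by simpa using hc')).choose_spec
    rw [he] at h1
    exact h.left_unique _ _ _ h1 h2
  · intro d hd
    obtain ⟨c, hc⟩ := h.total' d (by simpa using hd)
    have h1 := (h.free _ _ hc).1
    exact ⟨c, by simpa using h1, h.right_unique _ _ _ (h.total c h1).choose_spec hc⟩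
  · intro c hc
    exact hF _ _ (h.total c (by simpa using hc)).choose_spec

end Match

namespace Diagram

variable {D D' : Diagram}

theorem basis_ext {x y : D.Basis} (h : x.1 = y.1)
    (h' : ∀ a, x.2 (D.circ x.1 a) = y.2 (D.circ y.1 a)) : x = y := by
  obtain ⟨ε, x⟩ := x
  obtain ⟨ε', y⟩ := y
  simp only at h
  subst h
  congr 1
  funext γ
  obtain ⟨a, rfl⟩ := circ_surjective γ
  exact h' a

/-- The basis vectors over the face of the cube of resolutions determined by `τ`. -/
def face (D : Diagram) (τ : Fin D.n → Option Bool) : Set D.based.B := {x | Fits τ x.1}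

theorem mem_face {τ : Fin D.n → Option Bool} {x : D.Basis} : x ∈ D.face τ ↔ Fits τ x.1 := Iff.rfl

theorem height_eq_ones_add {τ : Fin D.n → Option Bool} {ε : Fin D.n → Bool} (h : Fits τ ε) :
    D.height ε = ones τ + ∑ k, if τ k = none then (if ε k = true then 1 else 0) else 0 := by
  unfold height ones
  rw [Finset.card_filter, Finset.card_filter, ← Finset.sum_add_distrib]
  refine Finset.sum_congr rfl fun k _ => ?_
  cases hk : τ k with
  | none => simp
  | some v => rw [h k v hk]; simp

/-- The fixed crossings contribute a factor that depends on `c` alone. The free ones contribute one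
factor for each 1-resolved crossing, which is the form that `exists_gauge` requires. -/
theorem edgeSign_eq_prod {τ : Fin D.n → Option Bool} {ε : Fin D.n → Bool} (h : Fits τ ε)
    (c : Fin D.n) : D.edgeSign ε c = (∏ k, if τ k = some true ∧ k < c then -1 else 1) *
      ∏ k, if τ k = none then (if ε k = true then (if k < c then -1 else 1) else 1) else 1 := by
  unfold edgeSign
  rw [← Finset.prod_const, Finset.prod_filter, ← Finset.prod_mul_distrib]
  refine Finset.prod_congr rfl fun k _ => ?_
  cases hk : τ k with
  | none => by_cases h1 : k < c <;> by_cases h2 : ε k = true <;> simp [h1, h2]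
  | some v => rw [h k v hk]; cases v <;> by_cases h1 : k < c <;> simp [h1]

/-- Corresponding edges may have different signs, since the matching need not preserve the order of
the crossings and the fixed crossings may differ. The quotient of the two sign assignments is a
coboundary, so it does not affect homology. -/
theorem exists_face_gauge {τ : Fin D.n → Option Bool} {τ' : Fin D'.n → Option Bool}
    {R : Fin D.n → Fin D'.n → Prop} (h : CrossingMatch τ τ' R) :
    ∃ γ : (Fin D.n → Bool) → ℤ, (∀ ε, γ ε * γ ε = 1) ∧ ∀ ε ε' c d, FaceRel τ τ' R ε ε' →
      R c d → ε c = false →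
      γ (Function.update ε c true) = γ ε * (D.edgeSign ε c * D'.edgeSign ε' d) := by
  classical
  -- `s` records the order of two crossings in `D`, and `s'` that of their partners in `D'`. Each is
  -- antisymmetric on distinct free crossings, so their product is symmetric.
  let s : Fin D.n → Fin D.n → ℤ := fun k c => if k < c then -1 else 1
  let s' : Fin D.n → Fin D.n → ℤ := fun k c => if ∃ d e, R k d ∧ R c e ∧ d < e then -1 else 1
  have hs : ∀ k c, s k c * s k c = 1 := by
    intro k c
    simp only [s]
    split_ifs <;> simp
  have hs' : ∀ k c, s' k c * s' k c = 1 := by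
    intro k c
    simp only [s']
    split_ifs <;> simp
  have hss : ∀ k c, k ≠ c → s k c = - s c k := by
    intro k c hkc
    simp only [s]
    rcases lt_or_gt_of_ne hkc with h | h
    · simp [h, h.le.not_gt]
    · simp [h, h.le.not_gt]
  have hsR : ∀ k c d e, R k d → R c e → s' k c = if d < e then -1 else 1 := by
    intro k c d e h1 h2
    have : (∃ d e, R k d ∧ R c e ∧ d < e) ↔ d < e :=
      ⟨fun ⟨d', e', h3, h4, h5⟩ => by
        rwa [h.right_unique _ _ _ h1 h3, h.right_unique _ _ _ h2 h4], fun h3 => ⟨d, e, h1, h2, h3⟩⟩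
    simp only [s', this]
  obtain ⟨γ, hγ, hγ'⟩ := exists_gauge
    (fun c => (∏ k, if τ k = some true ∧ k < c then -1 else 1) *
      ∏ k, if τ' k = some true ∧ ∃ d, R c d ∧ k < d then -1 else 1)
    (fun k c => if τ k = none ∧ τ c = none then s k c * s' k c else 1) (by
      intro c
      rw [mul_mul_mul_comm, ← Finset.prod_mul_distrib, ← Finset.prod_mul_distrib,
        Finset.prod_eq_one, Finset.prod_eq_one, mul_one]
      · intro k _
        split_ifs <;> simp
      · intro k _
        split_ifs <;> simp) (by
      intro k c
      split_ifs
      · rw [mul_mul_mul_comm, hs, hs', mul_one]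
      · simp) (by
      intro k c hkc
      by_cases h1 : τ k = none ∧ τ c = none
      · rw [if_pos h1, if_pos h1.symm, hss k c hkc]
        obtain ⟨d, hd⟩ := h.total k h1.1
        obtain ⟨e, he⟩ := h.total c h1.2
        have hde : d ≠ e := by
          rintro rfl
          exact hkc (h.left_unique _ _ _ hd he)
        rw [hsR k c d e hd he, hsR c k e d he hd]
        rcases lt_or_gt_of_ne hde with h2 | h2
        · simp [h2, h2.le.not_gt]
        · simp [h2, h2.le.not_gt]
      · rw [if_neg h1, if_neg (fun h2 => h1 h2.symm)])
  refine ⟨γ, hγ, fun ε ε' c d hr hc hεc => ?_⟩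
  have hd : ∀ k, (∃ e, R c e ∧ k < e) ↔ k < d := fun k =>
    ⟨fun ⟨e, h1, h2⟩ => by rwa [h.right_unique _ _ _ hc h1], fun h1 => ⟨d, hc, h1⟩⟩
  rw [hγ' ε c hεc, edgeSign_eq_prod hr.fits, edgeSign_eq_prod hr.fits',
    h.prod_free (F := fun k => if ε k = true then s' k c else 1) (fun k e hke => by
      rw [hsR k c e d hke hc, hr.eq k e hke]),
    mul_mul_mul_comm, ← Finset.prod_mul_distrib]
  simp only [hd]
  congr 2
  refine Finset.prod_congr rfl fun k _ => ?_
  by_cases hk : τ k = none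
  · by_cases h1 : ε k = true
    · simp [hk, h1, (h.free c d hc).1, s]
    · simp [hk, h1]
  · simp [hk]

/-- Faces of two diagrams with corresponding circles and free crossings, up to an extra circle that
has a fixed label, have the same homology up to a shift. -/
theorem compareFaces {τ : Fin D.n → Option Bool} {τ' : Fin D'.n → Option Bool}
    {R : Fin D.n → Fin D'.n → Prop} (hκ : CrossingMatch τ τ' R)
    {f : D.Pt → D'.Pt} {O : Set D'.Pt} {g : Gen}
    (hemb : ∀ ε ε', FaceRel τ τ' R ε ε' → Embeds ε ε' f O)
    (hcover : ∀ b, b ∈ O ∨ ∃ a, ∀ ε ε', FaceRel τ τ' R ε ε' → D'.circ ε' b = D'.circ ε' (f a))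
    (hnw : ∀ c d, R c d → ∀ ε ε', FaceRel τ τ' R ε ε' →
      D'.circ ε' (f (D.nw c)) = D'.circ ε' (D'.nw d))
    (hne : ∀ c d, R c d → ∀ ε ε', FaceRel τ τ' R ε ε' →
      D'.circ ε' (f (D.ne c)) = D'.circ ε' (D'.ne d))
    (hsw : ∀ c d, R c d → ∀ ε ε', FaceRel τ τ' R ε ε' →
      D'.circ ε' (f (D.sw c)) = D'.circ ε' (D'.sw d))
    {s : ℤ} (hs : (O = ∅ ∧ s = 0) ∨ (O.Nonempty ∧ s = g.deg)) {i j i' j' : ℤ}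
    (hi : i' = i + (ones τ' - ones τ)) (hj : j' = j + (ones τ' - ones τ + s)) :
    Nonempty (D.based.Hom (D.face τ) i j ≃ₗ[ℤ]
      D'.based.Hom {y | y ∈ D'.face τ' ∧ ∀ b ∈ O, y.2 (D'.circ y.1 b) = g} i' j') := by
  classical
  obtain ⟨γ, hγ, hγ'⟩ := exists_face_gauge hκ
  let e : D.Basis → D'.Basis := fun x =>
    ⟨transport τ' R x.1, extLabel x.1 (transport τ' R x.1) f g x.2⟩
  let e' : D'.Basis → D.Basis := fun y =>
    ⟨transport τ (flip R) y.1, resLabel (transport τ (flip R) y.1) y.1 f y.2⟩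
  have hht : ∀ x ∈ D.face τ, (D'.height (e x).1 : ℤ) = D.height x.1 + (ones τ' - ones τ) := by
    intro x hx
    rw [height_eq_ones_add (fits_transport (τ' := τ') (R := R) x.1),
      height_eq_ones_add (mem_face.1 hx),
      hκ.sum_free (F := fun k => if x.1 k = true then 1 else 0) (fun c d hcd => by
        rw [(hκ.rel (mem_face.1 hx)).eq c d hcd])]
    push_cast
    ring
  refine Based.compare (C := D.based) (C' := D'.based) e e' ?_ ?_ ?_ ?_ (fun x => γ x.1)
    (fun x => hγ _) ?_ hht (a := ones τ' - ones τ) (b := ones τ' - ones τ + s) ?_ hi hj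
  · intro x hx
    exact ⟨fits_transport _, fun b hb => (hemb _ _ (hκ.rel hx)).ext_extra x.2 hb⟩
  · intro y hy
    exact fits_transport _
  · intro x hx
    have h1 := hκ.transport_transport (mem_face.1 hx)
    have h2 := hκ.rel' (fits_transport (τ' := τ') (R := R) x.1)
    refine basis_ext h1 fun a => ?_
    exact ((hemb _ _ h2).res_apply _ _).trans ((hemb _ _ (hκ.rel hx)).ext_apply _ _)
  · intro y hy
    have h1 := hκ.symm.transport_transport (mem_face.1 hy.1)
    have h2 := hκ.rel (fits_transport (τ' := τ) (R := flip R) y.1)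
    refine basis_ext h1 fun b => ?_
    rcases hcover b with hb | ⟨a, ha⟩
    · exact ((hemb _ _ h2).ext_extra _ hb).trans (hy.2 b hb).symm
    · rw [ha _ _ (hκ.rel' hy.1)]
      refine (congrArg (e (e' y)).2 (ha _ _ h2)).trans ?_
      exact ((hemb _ _ h2).ext_apply _ _).trans ((hemb _ _ (hκ.rel' hy.1)).res_apply _ _)
  · intro x hx y hy
    have key : ∀ c d, R c d → x.1 c = false → y.1 = Function.update x.1 c true →
        D'.based.coeff (e x) (e y) = γ x.1 * γ y.1 * D.based.coeff x y := by
      intro c d hcd hxc hyc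
      have hr := hκ.rel (mem_face.1 hx)
      have h1 : (e y).1 = Function.update (e x).1 d true := by
        show transport τ' R y.1 = _
        rw [hyc, hκ.transport_update x.1 hcd]
      rw [based_coeff_of_update h1, based_coeff_of_update hyc]
      have h2 := hγ' x.1 _ c d hr hcd hxc
      rw [← hyc] at h2
      have hry := hκ.rel (mem_face.1 hy)
      have h3 := (hemb _ _ hr).edgeCoeff_eq (g := g) (hemb _ _ hry) (c := c) (c' := d)
        (fun b => by
          rcases hcover b with hb | ⟨a, ha⟩
          · exact Or.inl hb
          · exact Or.inr ⟨a, ha _ _ hr, ha _ _ hry⟩)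
        hxc ((hr.eq c d hcd).trans hxc) hyc h1 (hnw c d hcd _ _ hr) (hne c d hcd _ _ hr)
        (hnw c d hcd _ _ hry) (hsw c d hcd _ _ hry) x.2 y.2
      have h4 : D'.edgeCoeff d (e x) (e y) = D.edgeCoeff c x y := h3
      rw [h4, h2]
      have h5 := hγ x.1
      have h6 := edgeSign_sq x.1 c
      have h7 : (e x).1 = transport τ' R x.1 := rfl
      rw [h7]
      linear_combination (-(D'.edgeSign (transport τ' R x.1) d * D.edgeCoeff c x y)) *
        (D.edgeSign x.1 c * D.edgeSign x.1 c) * h5 -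
        (D'.edgeSign (transport τ' R x.1) d * D.edgeCoeff c x y) * h6
    by_cases h0 : D.based.coeff x y = 0
    · by_cases h0' : D'.based.coeff (e x) (e y) = 0
      · rw [h0, h0', mul_zero]
      -- A nonzero coefficient in `D'` also comes from a free crossing, because both of its ends fit
      -- `τ'`; it is pulled back to a crossing of `D`.
      · obtain ⟨c, h1, h2, -⟩ := based_coeff_ne_zero h0'
        have hc : τ' c = none := by
          cases hc : τ' c with
          | none => rfl
          | some v =>
            have h3 : (e x).1 c = v := fits_transport _ c v hc
            have h4 : (e y).1 c = v := fits_transport _ c v hc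
            rw [h2, ← h3, h1] at h4
            simp at h4
        obtain ⟨k, hk⟩ := hκ.total' c hc
        refine key k c hk ?_ ?_
        · rw [← h1]
          exact (hκ.transport_eq x.1 hk).symm
        · have h3 := hκ.symm.transport_update (e x).1 (c := c) (d := k) hk
          rw [← h2] at h3
          have h4 : transport τ (flip R) (e x).1 = x.1 := hκ.transport_transport (mem_face.1 hx)
          have h5 : transport τ (flip R) (e y).1 = y.1 := hκ.transport_transport (mem_face.1 hy)
          rwa [h4, h5] at h3
    · obtain ⟨c, h1, h2, -⟩ := based_coeff_ne_zero h0
      suffices hc : τ c = none by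
        obtain ⟨d, hd⟩ := hκ.total c hc
        exact key c d hd h1 h2
      cases hc : τ c with
      | none => rfl
      | some v =>
        have h3 := mem_face.1 hx c v hc
        have h4 := mem_face.1 hy c v hc
        rw [h2, ← h3, h1] at h4
        simp at h4
  · intro x hx
    have h1 := hht x hx
    have h2 := (hemb _ _ (hκ.rel (mem_face.1 hx))).sum_deg (g := g) x.2 hs
    have h3 : D'.qdeg (e x) = D'.height (e x).1 + ∑ γ, ((e x).2 γ).deg := rfl
    have h4 : D.qdeg x = D.height x.1 + ∑ γ, (x.2 γ).deg := rfl
    have h5 : ∑ γ, ((e x).2 γ).deg = ∑ γ, (x.2 γ).deg + s := h2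
    show D'.qdeg (e x) = D.qdeg x + _
    rw [h3, h4, h1, h5]
    ring

end Diagram

end Khovanov

/-! ### Eliminating small circles -/

namespace Khovanov

section

variable {n : ℕ} {τ : Fin n → Option Bool}

theorem fits_update_iff {ε : Fin n → Bool} {c : Fin n} (hc : τ c = none) (v : Bool) :
    Fits (Function.update τ c (some v)) ε ↔ ε c = v ∧ Fits τ ε := by
  constructor
  · intro h
    refine ⟨h c v (by simp), fun k w hk => ?_⟩
    have hkc : k ≠ c := by rintro rfl; simp [hc] at hk
    exact h k w (by rwa [Function.update_of_ne hkc])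
  · rintro ⟨h1, h2⟩ k w hk
    by_cases hkc : k = c
    · subst hkc; simp at hk; rw [h1, hk]
    · exact h2 k w (by rwa [Function.update_of_ne hkc] at hk)

theorem ones_update {c : Fin n} (hc : τ c = none) (v : Bool) :
    ones (Function.update τ c (some v)) = ones τ + if v = true then 1 else 0 := by
  classical
  unfold ones
  cases v with
  | false =>
    simp only [Bool.false_eq_true, if_false, add_zero]
    congr 1
    ext k
    by_cases hk : k = c <;> simp [Function.update_apply, hk, hc]
  | true =>
    have : (Finset.univ.filter fun k => Function.update τ c (some true) k = some true) =
        insert c (Finset.univ.filter fun k => τ k = some true) := by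
      ext k
      by_cases hk : k = c <;> simp [Function.update_apply, hk]
    rw [this, Finset.card_insert_of_notMem (by simp [hc])]
    simp

end

namespace Diagram

variable {D : Diagram} {O : Set D.Pt}

/-- `O` is a circle of the total resolution `ε`. -/
def IsCircle (D : Diagram) (ε : Fin D.n → Bool) (O : Set D.Pt) : Prop :=
  O.Nonempty ∧ ∀ o ∈ O, ∀ b, b ∈ O ↔ D.circ ε b = D.circ ε o

theorem IsCircle.ne {ε : Fin D.n → Bool} (h : D.IsCircle ε O) {a o : D.Pt} (ho : o ∈ O)
    (ha : a ∉ O) : D.circ ε o ≠ D.circ ε a := fun h' => ha ((h.2 o ho a).2 h'.symm)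

open Classical in
/-- The point `u` in place of the points of `O`. -/
noncomputable def avoid (O : Set D.Pt) (u : D.Pt) (a : D.Pt) : D.Pt := if a ∈ O then u else a

theorem avoid_of_notMem {u a : D.Pt} (h : a ∉ O) : avoid O u a = a := if_neg h

theorem avoid_of_mem {u a : D.Pt} (h : a ∈ O) : avoid O u a = u := if_pos h

/-- Before `O` is joined to the circle of `u`, the circles other than `O` are exactly those that
exist afterwards. Points of `O` are represented by `u`, onto whose circle they are joined. -/
theorem Joins.embeds {ε ε' : Fin D.n → Bool} {u o : D.Pt} (h : D.Joins ε ε' u o)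
    (hO : D.IsCircle ε O) (ho : o ∈ O) : Embeds ε' ε (avoid O u) O := by
  have hu : u ∉ O := fun hu => h.ne ((hO.2 o ho u).1 hu)
  have hav : ∀ a, avoid O u a ∉ O := by
    intro a
    by_cases ha : a ∈ O
    · rwa [avoid_of_mem ha]
    · rwa [avoid_of_notMem ha]
  refine ⟨fun a b => ?_, fun b => ?_, fun b hb a => hO.ne hb (hav a),
    fun b hb b' hb' => ((hO.2 b' hb' b).1 hb)⟩
  · rw [h.iff]
    by_cases ha : a ∈ O
    · rw [avoid_of_mem ha]
      by_cases hb : b ∈ O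
      · rw [avoid_of_mem hb]
        simp [(hO.2 o ho a).1 ha, (hO.2 o ho b).1 hb]
      · rw [avoid_of_notMem hb, (hO.2 o ho a).1 ha]
        have h1 := hO.ne ho hb
        have h2 := h.ne
        simp only [h1, h1.symm, h2.symm, false_or, true_and, and_false]
        tauto
    · rw [avoid_of_notMem ha]
      have h1 := hO.ne ho ha
      have h2 := h.ne
      by_cases hb : b ∈ O
      · rw [avoid_of_mem hb, (hO.2 o ho b).1 hb]
        simp only [h1.symm, h2.symm, and_true, and_false, false_or, or_false]
      · rw [avoid_of_notMem hb]
        have h3 := hO.ne ho hb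
        simp only [h1.symm, h3.symm, and_false, false_and, or_false]
  · by_cases hb : b ∈ O
    · exact Or.inl hb
    · exact Or.inr ⟨b, by rw [avoid_of_notMem hb]⟩

/-- The basis vector with the resolution of `c` changed to `v` that is obtained by labelling an
additional circle by `g`. -/
noncomputable def addCircle (f : D.Pt → D.Pt) (c : Fin D.n) (v : Bool) (g : Gen) (x : D.Basis) :
    D.Basis := ⟨Function.update x.1 c v, extLabel x.1 (Function.update x.1 c v) f g x.2⟩

/-- The basis vector with the resolution of `c` changed to `v` that is obtained by forgetting a
circle. -/
noncomputable def dropCircle (f : D.Pt → D.Pt) (c : Fin D.n) (v : Bool) (y : D.Basis) :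
    D.Basis := ⟨Function.update y.1 c v, resLabel (Function.update y.1 c v) y.1 f y.2⟩

theorem update_update_self {ε : Fin D.n → Bool} {c : Fin D.n} {v w : Bool} (h : ε c = w) :
    Function.update (Function.update ε c v) c w = ε := by
  rw [Function.update_idem, ← h, Function.update_eq_self]

theorem dropCircle_addCircle {f : D.Pt → D.Pt} {c : Fin D.n} {v w : Bool} {g : Gen} {x : D.Basis}
    (hx : x.1 c = w) (h : Embeds x.1 (Function.update x.1 c v) f O) :
    dropCircle f c w (addCircle f c v g x) = x := by
  have h1 : (dropCircle f c w (addCircle f c v g x)).1 = x.1 := update_update_self hx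
  refine basis_ext h1 fun a => ?_
  have h' : Embeds (dropCircle f c w (addCircle f c v g x)).1 (addCircle f c v g x).1 f O := by
    rw [h1]; exact h
  exact (h'.res_apply _ a).trans (h.ext_apply _ a)

theorem addCircle_dropCircle {f : D.Pt → D.Pt} {c : Fin D.n} {v w : Bool} {g : Gen} {y : D.Basis}
    (hy : y.1 c = v) (h : Embeds (Function.update y.1 c w) y.1 f O)
    (hg : ∀ b ∈ O, y.2 (D.circ y.1 b) = g) :
    addCircle f c v g (dropCircle f c w y) = y := by
  have h1 : (addCircle f c v g (dropCircle f c w y)).1 = y.1 := update_update_self hy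
  refine basis_ext h1 fun b => ?_
  have h' : Embeds (dropCircle f c w y).1 (addCircle f c v g (dropCircle f c w y)).1 f O := by
    rw [h1]; exact h
  rcases h.cover b with hb | ⟨a, ha⟩
  · exact (h'.ext_extra _ hb).trans (hg b hb).symm
  · rw [ha]
    have h2 : D.circ (addCircle f c v g (dropCircle f c w y)).1 b =
        D.circ (addCircle f c v g (dropCircle f c w y)).1 (f a) := by rw [h1, ha]
    rw [h2]
    exact (h'.ext_apply _ a).trans (h.res_apply _ a)

/-- Passing to the `1`-resolution of `c` splits off the circle `O`; `u` lies on the other circle. -/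
structure SplitsOff (ε : Fin D.n → Bool) (c : Fin D.n) (O : Set D.Pt) (u : D.Pt) : Prop where
  zero : ε c = false
  circle : D.IsCircle (Function.update ε c true) O
  notMem : u ∉ O
  corners : (D.nw c ∈ O ∧ u = D.sw c) ∨ (D.sw c ∈ O ∧ u = D.nw c)

/-- Passing to the `1`-resolution of `c` merges the circle `O` into the circle of `u`. -/
structure MergesIn (ε : Fin D.n → Bool) (c : Fin D.n) (O : Set D.Pt) (u : D.Pt) : Prop where
  zero : ε c = false
  circle : D.IsCircle ε O
  notMem : u ∉ O
  corners : (D.nw c ∈ O ∧ u = D.ne c) ∨ (D.ne c ∈ O ∧ u = D.nw c)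

section

variable {ε ε' : Fin D.n → Bool} {c : Fin D.n} {u : D.Pt}

theorem SplitsOff.ne (h : SplitsOff ε c O u) : D.circ (Function.update ε c true) (D.nw c) ≠
    D.circ (Function.update ε c true) (D.sw c) := by
  rcases h.corners with ⟨h1, h2⟩ | ⟨h1, h2⟩
  · exact h.circle.ne h1 (h2 ▸ h.notMem)
  · exact (h.circle.ne h1 (h2 ▸ h.notMem)).symm

theorem SplitsOff.eq (h : SplitsOff ε c O u) (hD : D.Good) :
    D.circ ε (D.nw c) = D.circ ε (D.ne c) := (hD ε c h.zero).2 h.ne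

theorem SplitsOff.embeds (h : SplitsOff ε c O u) (hD : D.Good) :
    Embeds ε (Function.update ε c true) (avoid O u) O := by
  have hj := hD.split h.zero (h.eq hD)
  rcases h.corners with ⟨h1, h2⟩ | ⟨h1, h2⟩
  · rw [h2]; exact hj.symm.embeds h.circle h1
  · rw [h2]; exact hj.embeds h.circle h1

theorem MergesIn.ne (h : MergesIn ε c O u) : D.circ ε (D.nw c) ≠ D.circ ε (D.ne c) := by
  rcases h.corners with ⟨h1, h2⟩ | ⟨h1, h2⟩
  · exact h.circle.ne h1 (h2 ▸ h.notMem)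
  · exact (h.circle.ne h1 (h2 ▸ h.notMem)).symm

theorem MergesIn.embeds (h : MergesIn ε c O u) (hD : D.Good) :
    Embeds (Function.update ε c true) ε (avoid O u) O := by
  have hj := hD.merge h.zero h.ne
  rcases h.corners with ⟨h1, h2⟩ | ⟨h1, h2⟩
  · rw [h2]; exact hj.symm.embeds h.circle h1
  · rw [h2]; exact hj.embeds h.circle h1

end

open Classical in
theorem comulCoeff_X_left (a b : Gen) : comulCoeff a .X b = if a = b then 1 else 0 := by
  cases a <;> cases b <;> simp [comulCoeff]

open Classical in
theorem comulCoeff_X_right (a b : Gen) : comulCoeff a b .X = if a = b then 1 else 0 := by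
  cases a <;> cases b <;> simp [comulCoeff]

open Classical in
theorem mulCoeff_one_left (a b : Gen) : mulCoeff .one a b = if a = b then 1 else 0 := by
  cases a <;> cases b <;> simp [mulCoeff]

open Classical in
theorem mulCoeff_one_right (a b : Gen) : mulCoeff a .one b = if a = b then 1 else 0 := by
  cases a <;> cases b <;> simp [mulCoeff]

theorem Embeds.ext_of_notMem {ε ε' : Fin D.n → Bool} {u : D.Pt} {g : Gen}
    (h : Embeds ε ε' (avoid O u) O) (x : D.Circle ε → Gen) {a : D.Pt} (ha : a ∉ O) :
    extLabel ε ε' (avoid O u) g x (D.circ ε' a) = x (D.circ ε a) := by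
  have := h.ext_apply (g := g) x a
  rwa [avoid_of_notMem ha] at this

theorem Embeds.eq_ext {ε ε' : Fin D.n → Bool} {u : D.Pt} {g : Gen}
    (h : Embeds ε ε' (avoid O u) O) {x : D.Circle ε → Gen} {y : D.Circle ε' → Gen}
    (h1 : ∀ a ∈ O, y (D.circ ε' a) = g) (h2 : ∀ a ∉ O, y (D.circ ε' a) = x (D.circ ε a)) :
    y = extLabel ε ε' (avoid O u) g x := by
  funext γ
  obtain ⟨a, rfl⟩ := circ_surjective γ
  by_cases ha : a ∈ O
  · rw [h1 a ha, h.ext_extra x ha]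
  · rw [h2 a ha, h.ext_of_notMem x ha]

open Classical in
/-- The part of the edge map of a circle splitting off that labels it by `X` is an isomorphism. -/
theorem SplitsOff.edgeCoeff_label {ε : Fin D.n → Bool} {c : Fin D.n} {u : D.Pt}
    (h : SplitsOff ε c O u) (hD : D.Good) {x : D.Circle ε → Gen}
    {y : D.Circle (Function.update ε c true) → Gen}
    (hX : ∀ o ∈ O, y (D.circ (Function.update ε c true) o) = .X) :
    D.edgeCoeff c ⟨ε, x⟩ ⟨Function.update ε c true, y⟩ =
      if y = extLabel ε (Function.update ε c true) (avoid O u) .X x then 1 else 0 := by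
  classical
  have hm := h.eq hD
  have hE := h.embeds hD
  rw [edgeCoeff_split h.zero rfl hm h.ne]
  have key : ∀ (g : Gen), (comulCoeff g (y (D.circ (Function.update ε c true) (D.nw c)))
      (y (D.circ (Function.update ε c true) (D.sw c)))) =
      if g = y (D.circ (Function.update ε c true) u) then 1 else 0 := by
    intro g
    rcases h.corners with ⟨h1, h2⟩ | ⟨h1, h2⟩
    · rw [hX _ h1, h2, comulCoeff_X_left]
    · rw [hX _ h1, h2, comulCoeff_X_right]
  have hl := circ_eq_of_adj (Adj.zero_left (D := D) (ε := ε) c h.zero)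
  have hut : D.circ ε (D.nw c) = D.circ ε u := by
    rcases h.corners with ⟨h1, h2⟩ | ⟨h1, h2⟩
    · rw [h2]; exact hl
    · rw [h2]
  rw [key]
  by_cases he : y = extLabel ε (Function.update ε c true) (avoid O u) .X x
  · rw [if_pos he]
    have hn : ∀ a ∉ O, y (D.circ (Function.update ε c true) a) = x (D.circ ε a) := by
      intro a ha
      rw [he, hE.ext_of_notMem x ha]
    rw [if_pos, if_pos]
    · rw [hn u h.notMem, hut]
    · intro a ha
      refine hn a fun haO => ha ?_
      rw [hut, hE.iff, avoid_of_mem haO, avoid_of_notMem h.notMem]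
  · rw [if_neg he]
    split_ifs with h3 h4
    · refine absurd ?_ he
      refine hE.eq_ext hX fun a ha => ?_
      by_cases h5 : D.circ ε a = D.circ ε (D.nw c)
      · rw [h5, h4]
        congr 1
        rw [hut, hE.iff, avoid_of_notMem ha, avoid_of_notMem h.notMem] at h5
        exact h5
      · exact h3 a h5
    · rfl
    · rfl

open Classical in
/-- The edge map of merging in a circle is an isomorphism on the part where it is labelled by
`1`. -/
theorem MergesIn.edgeCoeff_label {ε : Fin D.n → Bool} {c : Fin D.n} {u : D.Pt}
    (h : MergesIn ε c O u) (hD : D.Good) {x : D.Circle ε → Gen}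
    {y : D.Circle (Function.update ε c true) → Gen} (hX : ∀ o ∈ O, x (D.circ ε o) = .one) :
    D.edgeCoeff c ⟨ε, x⟩ ⟨Function.update ε c true, y⟩ =
      if y = resLabel (Function.update ε c true) ε (avoid O u) x then 1 else 0 := by
  classical
  have hE := h.embeds hD
  rw [edgeCoeff_merge h.zero rfl h.ne]
  have ht := circ_eq_of_adj (Adj.one_top (D := D) (ε := Function.update ε c true) c (by simp))
  have key : ∀ (g : Gen), (mulCoeff (x (D.circ ε (D.nw c))) (x (D.circ ε (D.ne c))) g) =
      if x (D.circ ε u) = g then 1 else 0 := by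
    intro g
    rcases h.corners with ⟨h1, h2⟩ | ⟨h1, h2⟩
    · rw [hX _ h1, h2, mulCoeff_one_left]
    · rw [hX _ h1, h2, mulCoeff_one_right]
  have hut : D.circ (Function.update ε c true) (D.nw c) = D.circ (Function.update ε c true) u := by
    rcases h.corners with ⟨h1, h2⟩ | ⟨h1, h2⟩
    · rw [h2]; exact ht
    · rw [h2]
  have hcor : ∀ a ∉ O, D.circ ε a = D.circ ε (D.nw c) ∨ D.circ ε a = D.circ ε (D.ne c) →
      D.circ ε a = D.circ ε u := by
    intro a ha h1
    rcases h.corners with ⟨h2, h3⟩ | ⟨h2, h3⟩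
    · rw [h3]
      exact h1.resolve_left fun h4 => h.circle.ne h2 ha h4.symm
    · rw [h3]
      exact h1.resolve_right fun h4 => h.circle.ne h2 ha h4.symm
  have hcor' : ∀ a ∈ O, D.circ ε a = D.circ ε (D.nw c) ∨ D.circ ε a = D.circ ε (D.ne c) := by
    intro a ha
    rcases h.corners with ⟨h2, h3⟩ | ⟨h2, h3⟩
    · exact Or.inl ((h.circle.2 _ h2 a).1 ha)
    · exact Or.inr ((h.circle.2 _ h2 a).1 ha)
  rw [key]
  by_cases he : y = resLabel (Function.update ε c true) ε (avoid O u) x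
  · rw [if_pos he]
    have hn : ∀ a, y (D.circ (Function.update ε c true) a) = x (D.circ ε (avoid O u a)) := by
      intro a
      rw [he, hE.res_apply]
    rw [if_pos, if_pos]
    · rw [hut, hn, avoid_of_notMem h.notMem]
    · intro a h1 h2
      rw [hn, avoid_of_notMem]
      intro ha
      exact (hcor' a ha).elim h1 h2
  · rw [if_neg he]
    split_ifs with h3 h4
    · refine absurd ?_ he
      funext γ
      obtain ⟨a, rfl⟩ := circ_surjective γ
      rw [hE.res_apply]
      have hu : y (D.circ (Function.update ε c true) u) = x (D.circ ε u) := by rw [h4, hut]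
      have hiff := hE.iff a u
      rw [avoid_of_notMem h.notMem] at hiff
      by_cases ha : a ∈ O
      · rw [avoid_of_mem ha] at hiff ⊢
        rw [hiff.2 rfl, hu]
      · rw [avoid_of_notMem ha] at hiff ⊢
        by_cases h5 : D.circ ε a = D.circ ε (D.nw c) ∨ D.circ ε a = D.circ ε (D.ne c)
        · rw [hiff.2 (hcor a ha h5), hu, hcor a ha h5]
        · push Not at h5
          exact h3 a h5.1 h5.2
    · rfl
    · rfl

section

variable {x y : D.Basis} {c : Fin D.n} {u : D.Pt}

theorem SplitsOff.edgeCoeff_addCircle (h : SplitsOff x.1 c O u) (hD : D.Good) :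
    D.edgeCoeff c x (addCircle (avoid O u) c true .X x) = 1 :=
  (h.edgeCoeff_label hD fun _ ho => (h.embeds hD).ext_extra x.2 ho).trans (if_pos rfl)

/-- Together with the preceding coefficient this says that the block of the differential into the
vectors labelled `X` on `O` is diagonal with unit entries, as `Based.elim` demands. -/
theorem SplitsOff.eq_addCircle (h : SplitsOff x.1 c O u) (hD : D.Good)
    (hy : y.1 = Function.update x.1 c true) (hX : ∀ o ∈ O, y.2 (D.circ y.1 o) = .X)
    (hxy : D.edgeCoeff c x y ≠ 0) : y = addCircle (avoid O u) c true .X x := by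
  obtain ⟨ε', y⟩ := y
  simp only at hy
  subst hy
  have h1 := h.edgeCoeff_label hD (x := x.2) hX
  by_contra hne
  exact hxy (h1.trans (if_neg fun h2 =>
    hne (congrArg (fun z => (⟨Function.update x.1 c true, z⟩ : D.Basis)) h2)))

theorem MergesIn.edgeCoeff_dropCircle (h : MergesIn x.1 c O u) (hD : D.Good)
    (hX : ∀ o ∈ O, x.2 (D.circ x.1 o) = .one) :
    D.edgeCoeff c x (dropCircle (avoid O u) c true x) = 1 :=
  (h.edgeCoeff_label hD hX).trans (if_pos rfl)

theorem MergesIn.eq_dropCircle (h : MergesIn x.1 c O u) (hD : D.Good)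
    (hX : ∀ o ∈ O, x.2 (D.circ x.1 o) = .one)
    (hy : y.1 = Function.update x.1 c true) (hxy : D.edgeCoeff c x y ≠ 0) :
    y = dropCircle (avoid O u) c true x := by
  obtain ⟨ε', y⟩ := y
  simp only at hy
  subst hy
  have h1 := h.edgeCoeff_label hD (x := x.2) (y := y) hX
  by_contra hne
  exact hxy (h1.trans (if_neg fun h2 =>
    hne (congrArg (fun z => (⟨Function.update x.1 c true, z⟩ : D.Basis)) h2)))

/-- An edge at a crossing away from the circle `O` does not change the label of `O`. -/
theorem label_eq_of_edgeCoeff_ne_zero (h : D.edgeCoeff c x y ≠ 0) (hO : D.IsCircle x.1 O)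
    (hnw : D.nw c ∉ O) (hne : D.ne c ∉ O) {o : D.Pt} (ho : o ∈ O) :
    y.2 (D.circ y.1 o) = x.2 (D.circ x.1 o) :=
  edgeCoeff_agree h (hO.ne ho hnw) (hO.ne ho hne)

end

end Diagram

end Khovanov

namespace Khovanov

namespace Diagram

variable {D : Diagram} {O : Set D.Pt} {τ : Fin D.n → Option Bool}

/-- Faces are convex in the cube: resolutions only increase along edges, so a fixed crossing cannot
change on the way between two vertices of the face. -/
theorem fits_of_coeff {x y z : D.Basis} (hx : Fits τ x.1) (hz : Fits τ z.1)
    (h1 : D.based.coeff x y ≠ 0) (h2 : D.based.coeff y z ≠ 0) : Fits τ y.1 := by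
  obtain ⟨c, hc, hy, -⟩ := based_coeff_ne_zero h1
  obtain ⟨c', hc', hz', -⟩ := based_coeff_ne_zero h2
  intro k v hk
  have h3 := hx k v hk
  have h4 := hz k v hk
  rw [hz'] at h4
  by_cases hkc : k = c'
  · subst hkc
    rw [hc']
    have h5 : y.1 k = x.1 k := by
      rw [hy, Function.update_of_ne]
      rintro rfl
      rw [hy] at hc'
      simp at hc'
    rw [← h3, ← h5, hc']
  · rwa [Function.update_of_ne hkc] at h4

theorem Good.sqZero_face (hD : D.Good) (τ : Fin D.n → Option Bool) :
    D.based.SqZero (D.face τ) :=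
  hD.sqZero fun _ hx _ hz _ h1 h2 => fits_of_coeff hx hz h1 h2

theorem mem_face_update {c : Fin D.n} (hc : τ c = none) (v : Bool) {x : D.based.B} :
    x ∈ D.face (Function.update τ c (some v)) ↔ x.1 c = v ∧ x ∈ D.face τ :=
  fits_update_iff hc v

section Resolve

variable {c : Fin D.n}

theorem mem_face_cover (hc : τ c = none) (x : D.based.B) : x ∈ D.face τ ↔
    x ∈ D.face (Function.update τ c (some false)) ∨
      x ∈ D.face (Function.update τ c (some true)) := by
  rw [mem_face_update hc, mem_face_update hc]
  cases x.1 c <;> simp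

/-- Edges never change a 1-resolution back to a 0-resolution, so the face with `c` resolved to 1 is
a subcomplex. -/
theorem coeff_face_eq_zero (hc : τ c = none) :
    ∀ x ∈ D.face (Function.update τ c (some true)), ∀ y ∈ D.face (Function.update τ c (some false)),
      D.based.coeff x y = 0 := by
  intro x hx y hy
  by_contra h
  obtain ⟨k, h1, h2, -⟩ := based_coeff_ne_zero h
  have h3 := ((mem_face_update hc true).1 hx).1
  have h4 := ((mem_face_update hc false).1 hy).1
  rw [h2] at h4
  by_cases hk : c = k
  · subst hk; simp at h4
  · rw [Function.update_of_ne hk, h3] at h4; simp at h4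

/-- If the face with `c` resolved to `1` has no homology in two adjacent degrees, `c` may be
resolved to `0`. -/
theorem Good.resolve_zero (hD : D.Good) (hc : τ c = none) {i j : ℤ}
    (h0 : Subsingleton (D.based.Hom (D.face (Function.update τ c (some true))) i j))
    (h1 : Subsingleton (D.based.Hom (D.face (Function.update τ c (some true))) (i + 1) j)) :
    Nonempty (D.based.Hom (D.face τ) i j ≃ₗ[ℤ]
      D.based.Hom (D.face (Function.update τ c (some false))) i j) :=
  Based.cone (hD.homogeneous _) (hD.sqZero_face τ) (mem_face_cover hc)
    (fun x hx hx' => by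
      have h3 := ((mem_face_update hc false).1 hx).1
      have h4 := ((mem_face_update hc true).1 hx').1
      rw [h3] at h4; simp at h4)
    (coeff_face_eq_zero hc) h0 h1

theorem Good.subsingleton_of_resolve (hD : D.Good) (hc : τ c = none) {i j : ℤ}
    (h0 : Subsingleton (D.based.Hom (D.face (Function.update τ c (some false))) i j))
    (h1 : Subsingleton (D.based.Hom (D.face (Function.update τ c (some true))) i j)) :
    Subsingleton (D.based.Hom (D.face τ) i j) :=
  Based.cone_subsingleton (hD.homogeneous _) (hD.sqZero_face τ) (mem_face_cover hc)
    (coeff_face_eq_zero hc) h0 h1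

end Resolve

theorem free_of_edge {x y : D.Basis} (hx : Fits τ x.1) (hy : Fits τ y.1) {k : Fin D.n}
    (h1 : x.1 k = false) (h2 : y.1 = Function.update x.1 k true) : τ k = none := by
  cases hk : τ k with
  | none => rfl
  | some v =>
    have h3 := hx k v hk
    have h4 := hy k v hk
    rw [h2, ← h3, h1] at h4
    simp at h4

section Moves

variable {c : Fin D.n}

open Classical in
/-- The corner of `c` opposite to the one in `O`. -/
noncomputable def splitCorner (D : Diagram) (c : Fin D.n) (O : Set D.Pt) : D.Pt :=
  if D.nw c ∈ O then D.sw c else D.nw c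

open Classical in
/-- The corner of `c` beside the one in `O`. -/
noncomputable def mergeCorner (D : Diagram) (c : Fin D.n) (O : Set D.Pt) : D.Pt :=
  if D.nw c ∈ O then D.ne c else D.nw c

theorem SplitsOff.mk' {ε : Fin D.n → Bool} (h0 : ε c = false)
    (hO : D.IsCircle (Function.update ε c true) O) (h : D.nw c ∈ O ↔ D.sw c ∉ O) :
    SplitsOff ε c O (splitCorner D c O) := by
  refine ⟨h0, hO, ?_, ?_⟩ <;> unfold splitCorner <;> split_ifs with h1
  · exact h.1 h1
  · exact h1
  · exact Or.inl ⟨h1, rfl⟩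
  · exact Or.inr ⟨by_contra fun h2 => h1 (h.2 h2), rfl⟩

theorem MergesIn.mk' {ε : Fin D.n → Bool} (h0 : ε c = false)
    (hO : D.IsCircle ε O) (h : D.nw c ∈ O ↔ D.ne c ∉ O) :
    MergesIn ε c O (mergeCorner D c O) := by
  refine ⟨h0, hO, ?_, ?_⟩ <;> unfold mergeCorner <;> split_ifs with h1
  · exact h.1 h1
  · exact h1
  · exact Or.inl ⟨h1, rfl⟩
  · exact Or.inr ⟨by_contra fun h2 => h1 (h.2 h2), rfl⟩

theorem sign_sq_coeff {x y : D.Basis} (hy : y.1 = Function.update x.1 c true)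
    (h : D.edgeCoeff c x y = 1) : D.based.coeff x y * D.based.coeff x y = 1 := by
  rw [based_coeff_of_update hy, h, mul_one, edgeSign_sq]

theorem IsCircle.label {ε : Fin D.n → Bool} (hO : D.IsCircle ε O) {o : D.Pt} (ho : o ∈ O) {g : Gen}
    {x : D.Circle ε → Gen} (h : x (D.circ ε o) = g) : ∀ b ∈ O, x (D.circ ε b) = g :=
  fun b hb => by rw [(hO.2 o ho b).1 hb, h]

theorem Gen.eq_one_or_X (g : Gen) : g = .one ∨ g = .X := by cases g <;> simp

/-- A crossing whose `1`-resolution splits off a circle can be resolved to `0`, up to a shift. -/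
theorem Good.split_circle (hD : D.Good) (hc : τ c = none)
    (hO : ∀ ε, Fits τ ε → ε c = true → D.IsCircle ε O) (hcor : D.nw c ∈ O ↔ D.sw c ∉ O)
    (hfar : ∀ k, τ k = none → k ≠ c → D.nw k ∉ O ∧ D.ne k ∉ O ∧ D.sw k ∉ O) (i j : ℤ) :
    Nonempty (D.based.Hom (D.face (Function.update τ c (some false))) i j ≃ₗ[ℤ]
      D.based.Hom (D.face τ) (i + 1) (j + 2)) := by
  classical
  set u := splitCorner D c O with hu
  have hS : ∀ x : D.Basis, Fits τ x.1 → x.1 c = false → SplitsOff x.1 c O u := fun x hx h0 =>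
    SplitsOff.mk' h0 (hO _ (hx.update hc true) (by simp)) hcor
  have hS' : ∀ x : D.Basis, Fits τ x.1 → x.1 c = true →
      SplitsOff (Function.update x.1 c false) c O u := fun x hx h0 =>
    SplitsOff.mk' (by simp) (hO _ ((hx.update hc false).update hc true) (by simp)) hcor
  obtain ⟨o, ho⟩ : O.Nonempty := by
    by_cases h : D.nw c ∈ O
    · exact ⟨_, h⟩
    · exact ⟨_, by_contra fun h' => h (hcor.2 h')⟩
  -- The part of `Δ` that puts `X` on the new circle is bijective from `P` to `Q`: it takes `1` to
  -- `1 ⊗ X` and `X` to `X ⊗ X`. What survives is the 1-face with label `1` on `O`.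
  set P : Set D.based.B := {x | x ∈ D.face τ ∧ x.1 c = false} with hP
  set M : Set D.based.B := {x | x ∈ D.face (Function.update τ c (some true)) ∧
    ∀ b ∈ O, x.2 (D.circ x.1 b) = .one} with hM
  set Q : Set D.based.B := {x | x ∈ D.face (Function.update τ c (some true)) ∧
    ∀ b ∈ O, x.2 (D.circ x.1 b) = .X} with hQ
  have hE : ∀ x : D.Basis, Fits τ x.1 → x.1 c = true →
      Embeds (Function.update x.1 c false) x.1 (avoid O u) O := by
    intro x hx h0
    have := (hS' x hx h0).embeds hD
    rwa [update_update_self h0] at this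
  have h1 : Nonempty (D.based.Hom M (i + 1) (j + 2) ≃ₗ[ℤ]
      D.based.Hom (D.face τ) (i + 1) (j + 2)) := by
    refine Based.elim (C := D.based) (P := P) (Q := Q) (hD.homogeneous _) (hD.sqZero_face τ)
      ?_ ?_ ?_ ?_ (addCircle (avoid O u) c true .X) (dropCircle (avoid O u) c false)
      ?_ ?_ ?_ ?_ ?_ ?_ ?_ _ _
    · intro x
      rw [mem_face_cover hc]
      constructor
      · rintro (h | h)
        · exact Or.inr (Or.inl ((mem_face_update hc false).1 h).symm)
        · have h' := (mem_face_update hc true).1 h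
          have hO' := hO _ h'.2 h'.1
          rcases Gen.eq_one_or_X (x.2 (D.circ x.1 o)) with h2 | h2
          · exact Or.inl ⟨h, hO'.label ho h2⟩
          · exact Or.inr (Or.inr ⟨h, hO'.label ho h2⟩)
      · rintro (h | h | h)
        · exact Or.inr h.1
        · exact Or.inl ((mem_face_update hc false).2 h.symm)
        · exact Or.inr h.1
    · intro x hx hx'
      have := ((mem_face_update hc true).1 hx.1).1
      rw [hx'.2] at this
      simp at this
    · intro x hx hx'
      have h1 := hx.2 o ho
      rw [hx'.2 o ho] at h1
      simp at h1
    · intro x hx hx'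
      have := ((mem_face_update hc true).1 hx'.1).1
      rw [hx.2] at this
      simp at this
    · intro x hx
      refine ⟨(mem_face_update hc true).2 ⟨by simp [addCircle], Fits.update hx.1 hc true⟩, ?_⟩
      exact fun b hb => ((hS x hx.1 hx.2).embeds hD).ext_extra x.2 hb
    · intro x hx
      have hx1 := (mem_face_update hc true).1 hx.1
      exact ⟨Fits.update hx1.2 hc false, by simp [dropCircle]⟩
    · intro x hx
      exact dropCircle_addCircle hx.2 ((hS x hx.1 hx.2).embeds hD)
    · intro x hx
      have hx1 := (mem_face_update hc true).1 hx.1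
      exact addCircle_dropCircle hx1.1 (hE x hx1.2 hx1.1) hx.2
    · intro x hx
      exact sign_sq_coeff rfl ((hS x hx.1 hx.2).edgeCoeff_addCircle hD)
    · intro x hx y hy hne
      by_contra h
      obtain ⟨k, h2, h3, h4⟩ := based_coeff_ne_zero h
      have hy1 := (mem_face_update hc true).1 hy.1
      have hkc : k = c := by
        by_contra hkc
        have h5 := hy1.1
        rw [h3, Function.update_of_ne (Ne.symm hkc), hx.2] at h5
        simp at h5
      subst hkc
      exact hne ((hS x hx.1 hx.2).eq_addCircle hD h3 hy.2 h4)
    -- A zigzag would need an edge from label `1` on `O` to label `X` on `O` at a crossing other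
    -- than `c`, but such crossings stay away from `O`.
    · intro m hm x hx m' _
      by_contra h
      obtain ⟨k, h2, h3, h4⟩ := based_coeff_ne_zero (left_ne_zero_of_mul h)
      have hm1 := (mem_face_update hc true).1 hm.1
      have hx1 : Fits τ (addCircle (avoid O u) c true .X x).1 := Fits.update hx.1 hc true
      have hk := free_of_edge hm1.2 hx1 h2 h3
      have hkc : k ≠ c := by
        rintro rfl
        rw [hm1.1] at h2
        simp at h2
      have h5 := label_eq_of_edgeCoeff_ne_zero h4 (hO _ hm1.2 hm1.1) (hfar k hk hkc).1
        (hfar k hk hkc).2.1 ho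
      rw [hm.2 o ho] at h5
      have h6 := ((hS x hx.1 hx.2).embeds hD).ext_extra (g := .X) x.2 ho
      have h7 := h6.symm.trans h5
      simp at h7
  -- The surviving part is the 0-face with a circle labelled `1` added. The additional 1-resolution
  -- shifts both degrees by one, and the label shifts the quantum degree by one more.
  have h2 : Nonempty (D.based.Hom (D.face (Function.update τ c (some false))) i j ≃ₗ[ℤ]
      D.based.Hom M (i + 1) (j + 2)) := by
    have hrel : ∀ ε ε', FaceRel (Function.update τ c (some false))
        (Function.update τ c (some true)) (fun k d => τ k = none ∧ k ≠ c ∧ d = k) ε ε' →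
        ε c = false ∧ Fits τ ε ∧ ε' = Function.update ε c true ∧ Fits τ ε' ∧ ε' c = true := by
      intro ε ε' hr
      have h3 := (fits_update_iff hc false).1 hr.fits
      have h4 := (fits_update_iff hc true).1 hr.fits'
      refine ⟨h3.1, h3.2, ?_, h4.2, h4.1⟩
      funext k
      by_cases hk : k = c
      · subst hk; simp [h4.1]
      · rw [Function.update_of_ne hk]
        cases hk' : τ k with
        | none => exact hr.eq k k ⟨hk', hk, rfl⟩
        | some v => rw [h4.2 k v hk', h3.2 k v hk']
    have hfree : ∀ k, Function.update τ c (some false) k = none → τ k = none ∧ k ≠ c := by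
      intro k hk
      by_cases hkc : k = c
      · subst hkc; simp at hk
      · exact ⟨by rwa [Function.update_of_ne hkc] at hk, hkc⟩
    refine compareFaces (R := fun k d => τ k = none ∧ k ≠ c ∧ d = k) (f := avoid O u) (O := O)
      (g := .one) (s := 1) ⟨?_, ?_, ?_, ?_, ?_⟩ ?_ ?_ ?_ ?_ ?_ (Or.inr ⟨⟨o, ho⟩, rfl⟩) ?_ ?_
    · rintro k _ ⟨h3, h4, rfl⟩
      simp [Function.update_of_ne h4, h3]
    · intro k hk
      obtain ⟨h3, h4⟩ := hfree k hk
      exact ⟨k, h3, h4, rfl⟩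
    · intro k hk
      by_cases hkc : k = c
      · subst hkc; simp at hk
      · rw [Function.update_of_ne hkc] at hk
        exact ⟨k, hk, hkc, rfl⟩
    · rintro k d d' ⟨-, -, rfl⟩ ⟨-, -, rfl⟩; rfl
    · rintro k k' d ⟨-, -, rfl⟩ ⟨-, -, rfl⟩; rfl
    · intro ε ε' hr
      obtain ⟨h3, h4, h5, h6⟩ := hrel ε ε' hr
      rw [h5]
      exact (SplitsOff.mk' h3 (hO _ (h4.update hc true) (by simp)) hcor).embeds hD
    · intro b
      by_cases hb : b ∈ O
      · exact Or.inl hb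
      · exact Or.inr ⟨b, fun ε ε' _ => by rw [avoid_of_notMem hb]⟩
    · rintro _ k ⟨h3, h4, rfl⟩ ε ε' _
      rw [avoid_of_notMem (hfar k h3 h4).1]
    · rintro _ k ⟨h3, h4, rfl⟩ ε ε' _
      rw [avoid_of_notMem (hfar k h3 h4).2.1]
    · rintro _ k ⟨h3, h4, rfl⟩ ε ε' _
      rw [avoid_of_notMem (hfar k h3 h4).2.2]
    · rw [ones_update hc, ones_update hc]; simp
    · rw [ones_update hc, ones_update hc]; simp
  exact ⟨h2.some.trans h1.some⟩

/-- A crossing whose `0`-resolution splits off a circle can be resolved to `0`, with label `X` on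
that circle. -/
theorem Good.merge_circle (hD : D.Good) (hc : τ c = none)
    (hO : ∀ ε, Fits τ ε → ε c = false → D.IsCircle ε O) (hcor : D.nw c ∈ O ↔ D.ne c ∉ O)
    (hfar : ∀ k, τ k = none → k ≠ c → D.nw k ∉ O ∧ D.ne k ∉ O) (i j : ℤ) :
    Nonempty (D.based.Hom {x | x ∈ D.face (Function.update τ c (some false)) ∧
      ∀ b ∈ O, x.2 (D.circ x.1 b) = .X} i j ≃ₗ[ℤ] D.based.Hom (D.face τ) i j) := by
  classical
  set u := mergeCorner D c O with hu
  have hS : ∀ x : D.Basis, Fits τ x.1 → x.1 c = false → MergesIn x.1 c O u := fun x hx h0 =>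
    MergesIn.mk' h0 (hO _ hx h0) hcor
  have hS' : ∀ x : D.Basis, Fits τ x.1 → x.1 c = true →
      MergesIn (Function.update x.1 c false) c O u := fun x hx h0 =>
    MergesIn.mk' (by simp) (hO _ (hx.update hc false) (by simp)) hcor
  obtain ⟨o, ho⟩ : O.Nonempty := by
    by_cases h : D.nw c ∈ O
    · exact ⟨_, h⟩
    · exact ⟨_, by_contra fun h' => h (hcor.2 h')⟩
  -- Merging in a circle labelled `1` is multiplication by the unit, hence bijective from `P` to the
  -- whole 1-face `Q`. The label `X` on `O` survives.
  set Q : Set D.based.B := {x | x ∈ D.face τ ∧ x.1 c = true} with hP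
  set M : Set D.based.B := {x | x ∈ D.face (Function.update τ c (some false)) ∧
    ∀ b ∈ O, x.2 (D.circ x.1 b) = .X} with hM
  set P : Set D.based.B := {x | x ∈ D.face (Function.update τ c (some false)) ∧
    ∀ b ∈ O, x.2 (D.circ x.1 b) = .one} with hQ
  have hE : ∀ x : D.Basis, Fits τ x.1 → x.1 c = true →
      Embeds x.1 (Function.update x.1 c false) (avoid O u) O := by
    intro x hx h0
    have := (hS' x hx h0).embeds hD
    rwa [update_update_self h0] at this
  refine Based.elim (C := D.based) (P := P) (Q := Q) (hD.homogeneous _) (hD.sqZero_face τ)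
    ?_ ?_ ?_ ?_ (dropCircle (avoid O u) c true) (addCircle (avoid O u) c false .one)
    ?_ ?_ ?_ ?_ ?_ ?_ ?_ _ _
  · intro x
    rw [mem_face_cover hc]
    constructor
    · rintro (h | h)
      · have h' := (mem_face_update hc false).1 h
        have hO' := hO _ h'.2 h'.1
        rcases Gen.eq_one_or_X (x.2 (D.circ x.1 o)) with h2 | h2
        · exact Or.inr (Or.inl ⟨h, hO'.label ho h2⟩)
        · exact Or.inl ⟨h, hO'.label ho h2⟩
      · exact Or.inr (Or.inr ((mem_face_update hc true).1 h).symm)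
    · rintro (h | h | h)
      · exact Or.inl h.1
      · exact Or.inl h.1
      · exact Or.inr ((mem_face_update hc true).2 h.symm)
  · intro x hx hx'
    have h1 := hx.2 o ho
    rw [hx'.2 o ho] at h1
    simp at h1
  · intro x hx hx'
    have := ((mem_face_update hc false).1 hx.1).1
    rw [hx'.2] at this
    simp at this
  · intro x hx hx'
    have := ((mem_face_update hc false).1 hx.1).1
    rw [hx'.2] at this
    simp at this
  · intro x hx
    have hx1 := (mem_face_update hc false).1 hx.1
    exact ⟨Fits.update hx1.2 hc true, by simp [dropCircle]⟩
  · intro x hx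
    refine ⟨(mem_face_update hc false).2 ⟨by simp [addCircle], Fits.update hx.1 hc false⟩, ?_⟩
    exact fun b hb => (hE x hx.1 hx.2).ext_extra x.2 hb
  · intro x hx
    have hx1 := (mem_face_update hc false).1 hx.1
    exact addCircle_dropCircle hx1.1 ((hS x hx1.2 hx1.1).embeds hD) hx.2
  · intro x hx
    exact dropCircle_addCircle hx.2 (hE x hx.1 hx.2)
  · intro x hx
    have hx1 := (mem_face_update hc false).1 hx.1
    exact sign_sq_coeff rfl ((hS x hx1.2 hx1.1).edgeCoeff_dropCircle hD hx.2)
  · intro x hx y hy hne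
    by_contra h
    obtain ⟨k, h2, h3, h4⟩ := based_coeff_ne_zero h
    have hx1 := (mem_face_update hc false).1 hx.1
    have hkc : k = c := by
      by_contra hkc
      have h5 := hy.2
      rw [h3, Function.update_of_ne (Ne.symm hkc), hx1.1] at h5
      simp at h5
    subst hkc
    exact hne ((hS x hx1.2 hx1.1).eq_dropCircle hD hx.2 h3 h4)
  · intro m _ x hx m' hm
    by_contra h
    obtain ⟨k, h2, h3, h4⟩ := based_coeff_ne_zero (right_ne_zero_of_mul h)
    have hm1 := (mem_face_update hc false).1 hm.1
    have hx1 := (mem_face_update hc false).1 hx.1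
    have hk := free_of_edge hx1.2 hm1.2 h2 h3
    have hkc : k ≠ c := by
      rintro rfl
      have h5 := hm1.1
      rw [h3] at h5
      simp at h5
    have h5 := label_eq_of_edgeCoeff_ne_zero h4 (hO _ hx1.2 hx1.1) (hfar k hk hkc).1
      (hfar k hk hkc).2 ho
    rw [hm.2 o ho, hx.2 o ho] at h5
    simp at h5

end Moves

end Diagram

end Khovanov

namespace Khovanov

namespace Diagram

variable {D : Diagram} {O : Set D.Pt} {τ : Fin D.n → Option Bool} {a b : Fin D.n}

/-- If a circle appears at the `1`-resolution of `a` with the `0`-resolution of `b`, splitting off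
along `a` and merging in along `b`, then `a` may be resolved to `0` and `b` to `1`. -/
theorem Good.slide_circle (hD : D.Good) (ha : τ a = none) (hb : τ b = none) (hab : a ≠ b)
    (hO : ∀ ε, Fits τ ε → ε a = true → ε b = false → D.IsCircle ε O)
    (hcorA : D.nw a ∈ O ↔ D.sw a ∉ O) (hcorB : D.nw b ∈ O ↔ D.ne b ∉ O)
    (hfar : ∀ k, τ k = none → k ≠ a → k ≠ b → D.nw k ∉ O ∧ D.ne k ∉ O) (i j : ℤ) :
    Nonempty (D.based.Hom (D.face (Function.update (Function.update τ a (some false))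
      b (some true))) i j ≃ₗ[ℤ] D.based.Hom (D.face τ) i j) := by
  classical
  set u := splitCorner D a O with hu
  set v := mergeCorner D b O with hv
  have hA : ∀ x : D.Basis, Fits τ x.1 → x.1 a = false → x.1 b = false → SplitsOff x.1 a O u :=
    fun x hx h0 h1 => SplitsOff.mk' h0 (hO _ (hx.update ha true) (by simp)
      (by rw [Function.update_of_ne hab.symm, h1])) hcorA
  have hA' : ∀ x : D.Basis, Fits τ x.1 → x.1 a = true → x.1 b = false →
      SplitsOff (Function.update x.1 a false) a O u := fun x hx h0 h1 =>
    SplitsOff.mk' (by simp) (hO _ ((hx.update ha false).update ha true) (by simp)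
      (by rw [Function.update_of_ne hab.symm, Function.update_of_ne hab.symm, h1])) hcorA
  have hB : ∀ x : D.Basis, Fits τ x.1 → x.1 a = true → x.1 b = false → MergesIn x.1 b O v :=
    fun x hx h0 h1 => MergesIn.mk' h1 (hO _ hx h0 h1) hcorB
  have hB' : ∀ x : D.Basis, Fits τ x.1 → x.1 a = true → x.1 b = true →
      MergesIn (Function.update x.1 b false) b O v := fun x hx h0 h1 =>
    MergesIn.mk' (by simp) (hO _ (hx.update hb false) (by rw [Function.update_of_ne hab, h0])
      (by simp)) hcorB
  obtain ⟨o, ho⟩ : O.Nonempty := by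
    by_cases h : D.nw a ∈ O
    · exact ⟨_, h⟩
    · exact ⟨_, by_contra fun h' => h (hcorA.2 h')⟩
  have hEA : ∀ x : D.Basis, Fits τ x.1 → x.1 a = true → x.1 b = false →
      Embeds (Function.update x.1 a false) x.1 (avoid O u) O := by
    intro x hx h0 h1
    have := (hA' x hx h0 h1).embeds hD
    rwa [update_update_self h0] at this
  have hEB : ∀ x : D.Basis, Fits τ x.1 → x.1 a = true → x.1 b = true →
      Embeds x.1 (Function.update x.1 b false) (avoid O v) O := by
    intro x hx h0 h1
    have := (hB' x hx h0 h1).embeds hD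
    rwa [update_update_self h1] at this
  have hMmem : ∀ x : D.based.B, x ∈ D.face (Function.update (Function.update τ a (some false))
      b (some true)) ↔ x.1 b = true ∧ x.1 a = false ∧ x ∈ D.face τ := by
    intro x
    rw [mem_face_update (by rw [Function.update_of_ne hab.symm, hb]), mem_face_update ha]
  -- Writing faces by the resolutions of `a` and `b`, the circle exists on face 10. Face 00 is
  -- matched with the vectors labelled `X` on 10 by splitting, and those labelled `1` on 10 with
  -- face 11 by merging. Only face 01 remains.
  set P : Set D.Basis := {x | Fits τ x.1 ∧ x.1 b = false ∧
    (x.1 a = true → ∀ p ∈ O, x.2 (D.circ x.1 p) = .one)} with hP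
  set Q : Set D.Basis := {x | Fits τ x.1 ∧ x.1 a = true ∧
    (x.1 b = false → ∀ p ∈ O, x.2 (D.circ x.1 p) = .X)} with hQ
  obtain ⟨φ, hφ0, hφ1⟩ : ∃ φ : D.Basis → D.Basis,
      (∀ x, x.1 a = false → φ x = addCircle (avoid O u) a true .X x) ∧
      ∀ x, x.1 a = true → φ x = dropCircle (avoid O v) b true x := by
    refine ⟨fun x => bif x.1 a then dropCircle (avoid O v) b true x
      else addCircle (avoid O u) a true .X x, fun x h => ?_, fun x h => ?_⟩ <;> simp [h]
  obtain ⟨ψ, hψ0, hψ1⟩ : ∃ ψ : D.Basis → D.Basis,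
      (∀ x, x.1 b = false → ψ x = dropCircle (avoid O u) a false x) ∧
      ∀ x, x.1 b = true → ψ x = addCircle (avoid O v) b false .one x := by
    refine ⟨fun x => bif x.1 b then addCircle (avoid O v) b false .one x
      else dropCircle (avoid O u) a false x, fun x h => ?_, fun x h => ?_⟩ <;> simp [h]
  have hφ : ∀ x ∈ P, φ x ∈ Q := by
    intro x hx
    cases hxa : x.1 a with
    | false =>
      rw [hφ0 x hxa]
      refine ⟨Fits.update hx.1 ha true, by simp [addCircle], fun _ p hp => ?_⟩
      exact ((hA x hx.1 hxa hx.2.1).embeds hD).ext_extra x.2 hp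
    | true =>
      rw [hφ1 x hxa]
      refine ⟨Fits.update hx.1 hb true, ?_, fun h => ?_⟩
      · simp [dropCircle, Function.update_of_ne hab, hxa]
      · simp [dropCircle] at h
  have hψ : ∀ x ∈ Q, ψ x ∈ P := by
    intro x hx
    cases hxb : x.1 b with
    | false =>
      rw [hψ0 x hxb]
      refine ⟨Fits.update hx.1 ha false, ?_, fun h => ?_⟩
      · simp [dropCircle, Function.update_of_ne hab.symm, hxb]
      · simp [dropCircle] at h
    | true =>
      rw [hψ1 x hxb]
      refine ⟨Fits.update hx.1 hb false, by simp [addCircle], fun _ p hp => ?_⟩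
      exact (hEB x hx.1 hx.2.1 hxb).ext_extra x.2 hp
  have hψφ : ∀ x ∈ P, ψ (φ x) = x := by
    intro x hx
    cases hxa : x.1 a with
    | false =>
      rw [hφ0 x hxa, hψ0]
      · exact dropCircle_addCircle hxa ((hA x hx.1 hxa hx.2.1).embeds hD)
      · simp [addCircle, Function.update_of_ne hab.symm, hx.2.1]
    | true =>
      rw [hφ1 x hxa, hψ1 _ (by simp [dropCircle])]
      exact addCircle_dropCircle hx.2.1 ((hB x hx.1 hxa hx.2.1).embeds hD) (hx.2.2 hxa)
  have hφψ : ∀ x ∈ Q, φ (ψ x) = x := by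
    intro x hx
    cases hxb : x.1 b with
    | false =>
      rw [hψ0 x hxb, hφ0 _ (by simp [dropCircle])]
      exact addCircle_dropCircle hx.2.1 (hEA x hx.1 hx.2.1 hxb) (hx.2.2 hxb)
    | true =>
      rw [hψ1 x hxb, hφ1]
      · exact dropCircle_addCircle hxb (hEB x hx.1 hx.2.1 hxb)
      · simp [addCircle, Function.update_of_ne hab, hx.2.1]
  have hunit : ∀ x ∈ P, D.based.coeff x (φ x) * D.based.coeff x (φ x) = 1 := by
    intro x hx
    cases hxa : x.1 a with
    | false =>
      rw [hφ0 x hxa]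
      exact sign_sq_coeff rfl ((hA x hx.1 hxa hx.2.1).edgeCoeff_addCircle hD)
    | true =>
      rw [hφ1 x hxa]
      exact sign_sq_coeff rfl ((hB x hx.1 hxa hx.2.1).edgeCoeff_dropCircle hD (hx.2.2 hxa))
  have hoff : ∀ x ∈ P, ∀ y ∈ Q, y ≠ φ x → D.based.coeff x y = 0 := by
    intro x hx y hy hne
    by_contra h
    obtain ⟨k, h2, h3, h4⟩ := based_coeff_ne_zero h
    cases hxa : x.1 a with
    | false =>
      rw [hφ0 x hxa] at hne
      have hka : k = a := by
        by_contra hka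
        have h5 := hy.2.1
        rw [h3, Function.update_of_ne (Ne.symm hka), hxa] at h5
        simp at h5
      subst hka
      have hyb : y.1 b = false := by rw [h3, Function.update_of_ne hab.symm, hx.2.1]
      exact hne ((hA x hx.1 hxa hx.2.1).eq_addCircle hD h3 (hy.2.2 hyb) h4)
    | true =>
      rw [hφ1 x hxa] at hne
      by_cases hkb : k = b
      · subst hkb
        exact hne ((hB x hx.1 hxa hx.2.1).eq_dropCircle hD (hx.2.2 hxa) h3 h4)
      · have hka : k ≠ a := by
          rintro rfl
          rw [hxa] at h2
          simp at h2
        have hyb : y.1 b = false := by rw [h3, Function.update_of_ne (Ne.symm hkb), hx.2.1]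
        have hk := free_of_edge hx.1 hy.1 h2 h3
        have h5 := label_eq_of_edgeCoeff_ne_zero h4 (hO _ hx.1 hxa hx.2.1) (hfar k hk hka hkb).1
          (hfar k hk hka hkb).2 ho
        rw [hx.2.2 hxa o ho, hy.2.2 hyb o ho] at h5
        simp at h5
  -- Zigzags fail for reasons of resolution alone. If `x` is on 00, then `φ x` is on 10 and cannot
  -- be reached from 01; if `x` is on 10, it has no edge to 01.
  have hzig : ∀ m m' x : D.Basis, m.1 b = true → m'.1 a = false → x ∈ P →
      D.based.coeff m (φ x) * D.based.coeff x m' = 0 := by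
    intro m m' x hm hm' hx
    by_contra h
    obtain ⟨k, h2, h3, h4⟩ := based_coeff_ne_zero (left_ne_zero_of_mul h)
    obtain ⟨k', h2', h3', h4'⟩ := based_coeff_ne_zero (right_ne_zero_of_mul h)
    cases hxa : x.1 a with
    | false =>
      rw [hφ0 x hxa] at h3
      have h5 : (addCircle (avoid O u) a true .X x).1 b = false := by
        simp [addCircle, Function.update_of_ne hab.symm, hx.2.1]
      rw [h3] at h5
      by_cases hkb : b = k
      · subst hkb; simp at h5
      · rw [Function.update_of_ne hkb, hm] at h5
        simp at h5
    | true =>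
      have h5 := hm'
      rw [h3'] at h5
      by_cases hka : a = k'
      · subst hka; simp at h5
      · rw [Function.update_of_ne hka, hxa] at h5
        simp at h5
  refine Based.elim (C := D.based) (P := P) (Q := Q) (hD.homogeneous _) (hD.sqZero_face τ)
    ?_ ?_ ?_ ?_ φ ψ hφ hψ hψφ hφψ hunit hoff ?_ _ _
  · intro x
    rw [hMmem]
    constructor
    · intro h
      cases hxa : x.1 a with
      | false =>
        cases hxb : x.1 b with
        | false => exact Or.inr (Or.inl ⟨h, hxb, fun h' => by rw [hxa] at h'; simp at h'⟩)
        | true => exact Or.inl ⟨rfl, rfl, h⟩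
      | true =>
        cases hxb : x.1 b with
        | false =>
          have hO' := hO _ h hxa hxb
          rcases Gen.eq_one_or_X (x.2 (D.circ x.1 o)) with h2 | h2
          · exact Or.inr (Or.inl ⟨h, hxb, fun _ => hO'.label ho h2⟩)
          · exact Or.inr (Or.inr ⟨h, hxa, fun _ => hO'.label ho h2⟩)
        | true => exact Or.inr (Or.inr ⟨h, hxa, fun h' => by rw [hxb] at h'; simp at h'⟩)
    · rintro (h | h | h)
      · exact h.2.2
      · exact h.1
      · exact h.1
  · intro x hx hx'
    have h1 := ((hMmem x).1 hx).1
    rw [hx'.2.1] at h1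
    simp at h1
  · intro x hx hx'
    have h1 := ((hMmem x).1 hx).2.1
    rw [hx'.2.1] at h1
    simp at h1
  · intro x hx hx'
    have h1 := hx.2.2 hx'.2.1 o ho
    rw [hx'.2.2 hx.2.1 o ho] at h1
    simp at h1
  · intro m hm x hx m' hm'
    exact hzig m m' x ((hMmem m).1 hm).1 ((hMmem m').1 hm').2.1 hx

end Diagram

end Khovanov

/-! ### Circles of braid closures as a relation on pairs of natural numbers -/

namespace Khovanov

section Model

/-- Elementary connections in a resolved braid closure with `n` letters `k` on `p` strands, where
`e` marks the letters that are `1`-resolved; points are pairs of a level and a column. -/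
inductive Step (n p : ℕ) (k : ℕ → ℕ) (e : ℕ → Bool) : ℕ × ℕ → ℕ × ℕ → Prop
  | vert (l i : ℕ) : l < n → i < p → e l = false ∨ (i ≠ k l ∧ i ≠ k l + 1) →
      Step n p k e (l, i) (l + 1, i)
  | top (l : ℕ) : l < n → e l = true → Step n p k e (l, k l) (l, k l + 1)
  | bot (l : ℕ) : l < n → e l = true → Step n p k e (l + 1, k l) (l + 1, k l + 1)
  | close (i : ℕ) : i < p → Step n p k e (n, i) (0, i)

/-- Two points lie on the same circle of a resolved braid closure. -/
def Conn (n p : ℕ) (k : ℕ → ℕ) (e : ℕ → Bool) : ℕ × ℕ → ℕ × ℕ → Prop :=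
  Relation.EqvGen (Step n p k e)

variable {n p : ℕ} {k : ℕ → ℕ} {e : ℕ → Bool} {a b c : ℕ × ℕ}

theorem Conn.refl (a : ℕ × ℕ) : Conn n p k e a a := Relation.EqvGen.refl a

theorem Conn.symm (h : Conn n p k e a b) : Conn n p k e b a := Relation.EqvGen.symm _ _ h

theorem Conn.trans (h : Conn n p k e a b) (h' : Conn n p k e b c) : Conn n p k e a c :=
  Relation.EqvGen.trans _ _ _ h h'

theorem Conn.vert {l i : ℕ} (hl : l < n) (hi : i < p)
    (h : e l = false ∨ (i ≠ k l ∧ i ≠ k l + 1)) : Conn n p k e (l, i) (l + 1, i) :=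
  Relation.EqvGen.rel _ _ (Step.vert l i hl hi h)

theorem Conn.top {l : ℕ} (hl : l < n) (h : e l = true) : Conn n p k e (l, k l) (l, k l + 1) :=
  Relation.EqvGen.rel _ _ (Step.top l hl h)

theorem Conn.bot {l : ℕ} (hl : l < n) (h : e l = true) :
    Conn n p k e (l + 1, k l) (l + 1, k l + 1) :=
  Relation.EqvGen.rel _ _ (Step.bot l hl h)

theorem Conn.close {i : ℕ} (hi : i < p) : Conn n p k e (n, i) (0, i) :=
  Relation.EqvGen.rel _ _ (Step.close i hi)

theorem Conn.lift {n' p' : ℕ} {k' : ℕ → ℕ} {e' : ℕ → Bool} {f : ℕ × ℕ → ℕ × ℕ}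
    (h : ∀ a b, Step n p k e a b → Conn n' p' k' e' (f a) (f b)) (hab : Conn n p k e a b) :
    Conn n' p' k' e' (f a) (f b) := by
  induction hab with
  | rel a b hab => exact h a b hab
  | refl a => exact Conn.refl _
  | symm a b _ ih => exact ih.symm
  | trans a b c _ _ ih ih' => exact ih.trans ih'

end Model

section Circ

variable {p : ℕ} {b : List (Fin (p - 1))} {ε : Fin (braidClosure p b).n → Bool}

/-- This trades the dependent types of marked points and crossings for arithmetic of levels and
columns, in which changes of the word can be written down. -/
theorem circ_pt_iff {l i l' i' : ℕ} {hl : l ≤ b.length} {hi : i < p} {hl' : l' ≤ b.length}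
    {hi' : i' < p} :
    (braidClosure p b).circ ε (pt b l i hl hi) = (braidClosure p b).circ ε (pt b l' i' hl' hi') ↔
      Conn b.length p (letterAt b) (extend ε) (l, i) (l', i') := by
  classical
  constructor
  · intro h
    let F : (braidClosure p b).Pt → ℕ × ℕ :=
      fun x => (((x : Fin (b.length + 1) × Fin p).1 : ℕ), ((x : Fin (b.length + 1) × Fin p).2 : ℕ))
    have key : ∀ x y, (braidClosure p b).Adj ε x y →
        Conn b.length p (letterAt b) (extend ε) (F x) (F y) := by
      intro x y hxy
      refine adj_rec (R := fun x y => Conn b.length p (letterAt b) (extend ε) (F x) (F y))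
        ?_ ?_ ?_ ?_ hxy
      · exact fun l i hl hi h => Conn.vert hl hi h
      · exact fun l hl h => Conn.top hl h
      · exact fun l hl h => Conn.bot hl h
      · exact fun i hi => Conn.close hi
    have h2 : ∀ x y, Relation.EqvGen ((braidClosure p b).Adj ε) x y →
        Conn b.length p (letterAt b) (extend ε) (F x) (F y) := by
      intro x y hxy
      induction hxy with
      | rel x y h => exact key x y h
      | refl x => exact Conn.refl _
      | symm x y _ ih => exact ih.symm
      | trans x y z _ _ ih ih' => exact ih.trans ih'
    exact h2 _ _ (Quot.eqvGen_exact h)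
  · intro h
    -- Pairs outside the diagram receive the value `none`, so that the invariant is defined along
    -- every chain of connections.
    let G : ℕ × ℕ → Option ((braidClosure p b).Circle ε) := fun a =>
      if h : a.1 ≤ b.length ∧ a.2 < p then
        some ((braidClosure p b).circ ε (pt b a.1 a.2 h.1 h.2)) else none
    have hG : ∀ l i (hl : l ≤ b.length) (hi : i < p),
        G (l, i) = some ((braidClosure p b).circ ε (pt b l i hl hi)) := by
      intro l i hl hi
      exact dif_pos (⟨hl, hi⟩ : l ≤ b.length ∧ i < p)
    have key : ∀ x y, Conn b.length p (letterAt b) (extend ε) x y → G x = G y := by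
      intro x y hxy
      induction hxy with
      | rel x y h =>
        cases h with
        | vert l i hl hi h =>
          rw [hG l i hl.le hi, hG (l + 1) i hl hi, circ_vert hl hi h]
        | top l hl h =>
          rw [hG l _ hl.le (Nat.lt_of_succ_lt (letterAt_add_one_lt hl)),
            hG l _ hl.le (letterAt_add_one_lt hl), circ_top hl h]
        | bot l hl h =>
          rw [hG (l + 1) _ hl (Nat.lt_of_succ_lt (letterAt_add_one_lt hl)),
            hG (l + 1) _ hl (letterAt_add_one_lt hl), circ_bot hl h]
        | close i hi =>
          rw [hG _ i le_rfl hi, hG 0 i (Nat.zero_le _) hi, circ_close hi]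
      | refl x => rfl
      | symm x y _ ih => exact ih.symm
      | trans x y z _ _ ih ih' => exact ih.trans ih'
    have := key _ _ h
    rw [hG l i hl hi, hG l' i' hl' hi'] at this
    exact Option.some.inj this

end Circ

section Compare

/-- A correspondence of the circles of two resolved braid closures, up to an extra circle `O`. -/
structure Model (n p : ℕ) (k : ℕ → ℕ) (e : ℕ → Bool) (n' p' : ℕ) (k' : ℕ → ℕ) (e' : ℕ → Bool)
    (f r : ℕ × ℕ → ℕ × ℕ) (O : Set (ℕ × ℕ)) : Prop where
  range : ∀ a, a.1 ≤ n → a.2 < p → (f a).1 ≤ n' ∧ (f a).2 < p'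
  range' : ∀ a ∉ O, a.1 ≤ n' → a.2 < p' → (r a).1 ≤ n ∧ (r a).2 < p
  fwd : ∀ a b, Step n p k e a b → Conn n' p' k' e' (f a) (f b)
  bwd : ∀ a b, Step n' p' k' e' a b → (a ∈ O ↔ b ∈ O) ∧ (a ∉ O → Conn n p k e (r a) (r b))
  rf : ∀ a, a.1 ≤ n → a.2 < p → f a ∉ O ∧ Conn n p k e (r (f a)) a
  fr : ∀ a ∉ O, a.1 ≤ n' → a.2 < p' → Conn n' p' k' e' (f (r a)) a
  single : ∀ a ∈ O, ∀ b ∈ O, a.1 ≤ n' → a.2 < p' → b.1 ≤ n' → b.2 < p' → Conn n' p' k' e' a b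

theorem Model.conn_back {n p : ℕ} {k : ℕ → ℕ} {e : ℕ → Bool} {n' p' : ℕ} {k' : ℕ → ℕ}
    {e' : ℕ → Bool} {f r : ℕ × ℕ → ℕ × ℕ} {O : Set (ℕ × ℕ)} (h : Model n p k e n' p' k' e' f r O)
    {a b : ℕ × ℕ} (hab : Conn n' p' k' e' a b) :
    (a ∈ O ↔ b ∈ O) ∧ (a ∉ O → Conn n p k e (r a) (r b)) := by
  induction hab with
  | rel a b hab => exact h.bwd a b hab
  | refl a => exact ⟨Iff.rfl, fun _ => Conn.refl _⟩
  | symm a b _ ih => exact ⟨ih.1.symm, fun hb => (ih.2 (fun ha => hb (ih.1.1 ha))).symm⟩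
  | trans a b c _ _ ih ih' =>
    exact ⟨ih.1.trans ih'.1, fun ha => (ih.2 ha).trans (ih'.2 fun hb => ha (ih.1.2 hb))⟩

variable {p p' : ℕ} {b : List (Fin (p - 1))} {b' : List (Fin (p' - 1))}

/-- The coordinates of a marked point. -/
def coord (x : (braidClosure p b).Pt) : ℕ × ℕ :=
  (((x : Fin (b.length + 1) × Fin p).1 : ℕ), ((x : Fin (b.length + 1) × Fin p).2 : ℕ))

theorem coord_fst (x : (braidClosure p b).Pt) : (coord x).1 ≤ b.length :=
  Nat.le_of_lt_succ (x : Fin (b.length + 1) × Fin p).1.2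

theorem coord_snd (x : (braidClosure p b).Pt) : (coord x).2 < p :=
  (x : Fin (b.length + 1) × Fin p).2.2

theorem pt_coord (x : (braidClosure p b).Pt) :
    pt b (coord x).1 (coord x).2 (coord_fst x) (coord_snd x) = x := rfl

theorem coord_pt {l i : ℕ} {hl : l ≤ b.length} {hi : i < p} : coord (pt b l i hl hi) = (l, i) := rfl

theorem circ_iff_conn {ε : Fin (braidClosure p b).n → Bool} {x y : (braidClosure p b).Pt} :
    (braidClosure p b).circ ε x = (braidClosure p b).circ ε y ↔
      Conn b.length p (letterAt b) (extend ε) (coord x) (coord y) := by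
  rw [← pt_coord x, ← pt_coord y, circ_pt_iff]; rfl

/-- The partial resolution given by tags of the letters. -/
def tagged (p : ℕ) (b : List (Fin (p - 1))) (t : ℕ → Option Bool) :
    Fin (braidClosure p b).n → Option Bool := fun c => t c

/-- Braid closures with tagged letters and corresponding circles have the same homology. -/
theorem compareBraids {t t' : ℕ → Option Bool} {κ κ' : ℕ → ℕ} {f r : ℕ × ℕ → ℕ × ℕ}
    {O : Set (ℕ × ℕ)} {g : Gen} {s : ℤ}
    (hκ : ∀ l < b.length, κ l < b'.length ∧ t' (κ l) = t l ∧ κ' (κ l) = l)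
    (hκ' : ∀ l < b'.length, t' l = none → κ' l < b.length ∧ κ (κ' l) = l)
    (hones : ones (tagged p' b' t') = ones (tagged p b t))
    (hmodel : ∀ e e' : ℕ → Bool, (∀ l < b.length, e' (κ l) = e l) →
      (∀ l < b'.length, t' l = some false → e' l = false) →
      Model b.length p (letterAt b) e b'.length p' (letterAt b') e' f r O ∧
      ∀ l < b.length,
        Conn b'.length p' (letterAt b') e' (f (l, letterAt b l)) (κ l, letterAt b' (κ l)) ∧
        Conn b'.length p' (letterAt b') e' (f (l, letterAt b l + 1)) (κ l, letterAt b' (κ l) + 1) ∧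
        Conn b'.length p' (letterAt b') e' (f (l + 1, letterAt b l)) (κ l + 1, letterAt b' (κ l)))
    (hs : ((∀ a : ℕ × ℕ, a.1 ≤ b'.length → a.2 < p' → a ∉ O) ∧ s = 0) ∨
      ((∃ a ∈ O, a.1 ≤ b'.length ∧ a.2 < p') ∧ s = g.deg)) (i j : ℤ) :
    Nonempty ((braidClosure p b).based.Hom ((braidClosure p b).face (tagged p b t)) i j ≃ₗ[ℤ]
      (braidClosure p' b').based.Hom
        {y | y ∈ (braidClosure p' b').face (tagged p' b' t') ∧ ∀ x : (braidClosure p' b').Pt,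
          coord x ∈ O → y.2 ((braidClosure p' b').circ y.1 x) = g} i (j + s)) := by
  set D := braidClosure p b with hD
  set D' := braidClosure p' b' with hD'
  let R : Fin D.n → Fin D'.n → Prop := fun c d => t c = none ∧ (d : ℕ) = κ c
  have hm : CrossingMatch (tagged p b t) (tagged p' b' t') R := by
    refine ⟨?_, ?_, ?_, ?_, ?_⟩
    · rintro c d ⟨h1, h2⟩
      refine ⟨h1, ?_⟩
      show t' d = none
      rw [h2, (hκ c (crossing_lt c)).2.1, h1]
    · intro c hc
      exact ⟨⟨κ c, (hκ c (crossing_lt c)).1⟩, hc, rfl⟩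
    · intro d hd
      have h1 := hκ' d (crossing_lt d) hd
      refine ⟨⟨κ' d, h1.1⟩, ?_, h1.2.symm⟩
      show t (κ' d) = none
      rw [← (hκ _ h1.1).2.1, h1.2]
      exact hd
    · rintro c d d' ⟨-, h1⟩ ⟨-, h2⟩
      exact Fin.ext (h1.trans h2.symm)
    · rintro c c' d ⟨-, h1⟩ ⟨-, h2⟩
      refine Fin.ext ?_
      rw [← (hκ c (crossing_lt c)).2.2, ← h1, h2, (hκ c' (crossing_lt c')).2.2]
  have hmod := fun (ε : Fin D.n → Bool) (ε' : Fin D'.n → Bool)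
      (hr : FaceRel (tagged p b t) (tagged p' b' t') R ε ε') =>
    hmodel (extend ε) (extend ε') (by
      intro l hl
      have h1 := hκ l hl
      rw [extend_of_lt (n := D'.n) h1.1, extend_of_lt (n := D.n) hl]
      by_cases hl' : t l = none
      · exact hr.eq ⟨l, hl⟩ ⟨κ l, h1.1⟩ ⟨hl', rfl⟩
      · obtain ⟨v, hl'⟩ := Option.ne_none_iff_exists'.1 hl'
        rw [hr.fits ⟨l, hl⟩ v hl', hr.fits' ⟨κ l, h1.1⟩ v]
        show t' (κ l) = _
        rw [h1.2.1, hl']) (by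
      intro l hl h
      rw [extend_of_lt (n := D'.n) hl]
      exact hr.fits' ⟨l, hl⟩ false h)
  -- The range of `f` does not depend on the resolution, but `hmodel` must be applied to one.
  -- Resolving all free letters to 0 serves.
  have hrange : ∀ x : D.Pt, (f (coord x)).1 ≤ b'.length ∧ (f (coord x)).2 < p' := by
    obtain ⟨h, -⟩ := hmodel (fun l => t l == some true) (fun l => t' l == some true)
      (fun l hl => by rw [(hκ l hl).2.1]) (fun l hl h => by simp [h])
    exact fun x => h.range _ (coord_fst x) (coord_snd x)
  have hrange' : ∀ x : D'.Pt, coord x ∉ O →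
      (r (coord x)).1 ≤ b.length ∧ (r (coord x)).2 < p := by
    obtain ⟨h, -⟩ := hmodel (fun l => t l == some true) (fun l => t' l == some true)
      (fun l hl => by rw [(hκ l hl).2.1]) (fun l hl h => by simp [h])
    exact fun x hx => h.range' _ hx (coord_fst x) (coord_snd x)
  let F : D.Pt → D'.Pt := fun x => pt b' (f (coord x)).1 (f (coord x)).2 (hrange x).1 (hrange x).2
  have hF : ∀ x, coord (F x) = f (coord x) := fun x => rfl
  refine Diagram.compareFaces (D := D) (D' := D') hm (f := F) (O := {x | coord x ∈ O}) (g := g)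
    (s := s) ?_ ?_ ?_ ?_ ?_ ?_ ?_ ?_
  · intro ε ε' hr
    obtain ⟨h, -⟩ := hmod ε ε' hr
    refine ⟨fun x y => ?_, fun y => ?_, fun y hy x => ?_, fun y hy y' hy' => ?_⟩
    · rw [circ_iff_conn, circ_iff_conn, hF, hF]
      have hx := h.rf _ (coord_fst x) (coord_snd x)
      have hy := h.rf _ (coord_fst y) (coord_snd y)
      exact ⟨fun h1 => h1.lift h.fwd,
        fun h1 => hx.2.symm.trans (((h.conn_back h1).2 hx.1).trans hy.2)⟩
    · by_cases hy : coord y ∈ O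
      · exact Or.inl hy
      · refine Or.inr ⟨pt b _ _ (hrange' y hy).1 (hrange' y hy).2, ?_⟩
        rw [circ_iff_conn, hF, coord_pt]
        exact (h.fr _ hy (coord_fst y) (coord_snd y)).symm
    · rw [Ne, circ_iff_conn, hF]
      intro h1
      exact (h.rf _ (coord_fst x) (coord_snd x)).1 ((h.conn_back h1).1.1 hy)
    · rw [circ_iff_conn]
      exact h.single _ hy _ hy' (coord_fst _) (coord_snd _) (coord_fst _) (coord_snd _)
  · intro y
    by_cases hy : coord y ∈ O
    · exact Or.inl hy
    · refine Or.inr ⟨pt b _ _ (hrange' y hy).1 (hrange' y hy).2, fun ε ε' hr => ?_⟩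
      obtain ⟨h, -⟩ := hmod ε ε' hr
      rw [circ_iff_conn, hF, coord_pt]
      exact (h.fr _ hy (coord_fst y) (coord_snd y)).symm
  · rintro c d ⟨-, hd⟩ ε ε' hr
    obtain ⟨-, h⟩ := hmod ε ε' hr
    rw [circ_iff_conn, hF, corner_nw, corner_nw, coord_pt, coord_pt, hd]
    exact (h c (crossing_lt c)).1
  · rintro c d ⟨-, hd⟩ ε ε' hr
    obtain ⟨-, h⟩ := hmod ε ε' hr
    rw [circ_iff_conn, hF, corner_ne, corner_ne, coord_pt, coord_pt, hd]
    exact (h c (crossing_lt c)).2.1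
  · rintro c d ⟨-, hd⟩ ε ε' hr
    obtain ⟨-, h⟩ := hmod ε ε' hr
    rw [circ_iff_conn, hF, corner_sw, corner_sw, coord_pt, coord_pt, hd]
    exact (h c (crossing_lt c)).2.2
  · rcases hs with ⟨h1, h2⟩ | ⟨⟨a, h1, h2, h3⟩, h4⟩
    · refine Or.inl ⟨?_, h2⟩
      ext x
      simpa using h1 _ (coord_fst x) (coord_snd x)
    · exact Or.inr ⟨⟨pt b' a.1 a.2 h2 h3, h1⟩, h4⟩
  · rw [hones]; ring
  · rw [hones]; ring

end Compare

end Khovanov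

/-! ### Circles under inserting, rotating and exchanging letters -/

namespace Khovanov

variable {n p p' L : ℕ} {k k' : ℕ → ℕ} {e e' : ℕ → Bool}

/-- The level in place of `l` after a letter has been inserted at level `L`. -/
def insLevel (L : ℕ) (a : ℕ × ℕ) : ℕ × ℕ := (if a.1 ≤ L then a.1 else a.1 + 1, a.2)

/-- The level in place of `l` after a letter has been deleted at level `L`. -/
def delLevel (L : ℕ) (a : ℕ × ℕ) : ℕ × ℕ := (if a.1 ≤ L then a.1 else a.1 - 1, a.2)

/-- The new position of the letter in position `l` after a letter has been inserted at level `L`. -/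
def insLetter (L l : ℕ) : ℕ := if l < L then l else l + 1

theorem insLevel_le {l i : ℕ} (h : l ≤ L) : insLevel L (l, i) = (l, i) := by simp [insLevel, h]

theorem insLevel_gt {l i : ℕ} (h : L < l) : insLevel L (l, i) = (l + 1, i) := by
  simp [insLevel, h]

theorem delLevel_le {l i : ℕ} (h : l ≤ L) : delLevel L (l, i) = (l, i) := by simp [delLevel, h]

theorem delLevel_gt {l i : ℕ} (h : L ≤ l) : delLevel L (l + 1, i) = (l, i) := by
  simp [delLevel, Nat.not_le.2 (Nat.lt_succ_of_le h)]

/-- A `0`-resolved letter may be inserted, possibly together with a strand on the right. -/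
theorem model_insert (hL : L ≤ n) (hpp : p ≤ p') (hpp' : p' ≤ p + 1) (hk : ∀ l < n, k l + 1 < p)
    (hk' : ∀ l < n, k' (insLetter L l) = k l) (he : ∀ l < n, e' (insLetter L l) = e l)
    (heL : e' L = false) :
    Model n p k e (n + 1) p' k' e' (insLevel L) (delLevel L) {a | p ≤ a.2} ∧ ∀ l < n,
      Conn (n + 1) p' k' e' (insLevel L (l, k l)) (insLetter L l, k' (insLetter L l)) ∧
      Conn (n + 1) p' k' e' (insLevel L (l, k l + 1)) (insLetter L l, k' (insLetter L l) + 1) ∧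
      Conn (n + 1) p' k' e' (insLevel L (l + 1, k l)) (insLetter L l + 1, k' (insLetter L l)) := by
  have klo : ∀ l < n, l < L → k' l = k l := fun l h h' => by
    have := hk' l h; rwa [insLetter, if_pos h'] at this
  have khi : ∀ l < n, L ≤ l → k' (l + 1) = k l := fun l h h' => by
    have := hk' l h; rwa [insLetter, if_neg (by omega)] at this
  have elo : ∀ l < n, l < L → e' l = e l := fun l h h' => by
    have := he l h; rwa [insLetter, if_pos h'] at this
  have ehi : ∀ l < n, L ≤ l → e' (l + 1) = e l := fun l h h' => by
    have := he l h; rwa [insLetter, if_neg (by omega)] at this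
  -- The inserted letter is 0-resolved, so it is crossed vertically in every column, and the choice
  -- of level for the points at `L` does not matter.
  have hmid : ∀ i < p', Conn (n + 1) p' k' e' (L, i) (L + 1, i) := fun i hi =>
    Conn.vert (by omega) hi (Or.inl heL)
  have htop' : ∀ l < n, ∀ i < p',
      Conn (n + 1) p' k' e' (insLevel L (l, i)) (insLetter L l, i) := by
    intro l hl i hi
    rcases lt_trichotomy l L with h | h | h
    · rw [insLevel_le h.le, insLetter, if_pos h]; exact Conn.refl _
    · subst h
      rw [insLevel_le le_rfl, insLetter, if_neg (lt_irrefl _)]; exact hmid i hi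
    · rw [insLevel_gt h, insLetter, if_neg (by omega)]; exact Conn.refl _
  have hbot' : ∀ l < n, ∀ i, insLevel L (l + 1, i) = (insLetter L l + 1, i) := by
    intro l hl i
    by_cases h : l < L
    · rw [insLevel_le h, insLetter, if_pos h]
    · rw [insLevel_gt (by omega), insLetter, if_neg h]
  have hlt : ∀ l < n, insLetter L l < n + 1 := by
    intro l hl
    unfold insLetter
    split_ifs <;> omega
  have hdel : ∀ l < n, ∀ i, delLevel L (insLetter L l, i) = (l, i) := by
    intro l hl i
    by_cases h : l < L
    · rw [insLetter, if_pos h, delLevel_le h.le]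
    · rw [insLetter, if_neg h, delLevel_gt (by omega)]
  have hdel' : ∀ l < n, ∀ i, delLevel L (insLetter L l + 1, i) = (l + 1, i) := by
    intro l hl i
    by_cases h : l < L
    · rw [insLetter, if_pos h, delLevel_le h]
    · rw [insLetter, if_neg h, delLevel_gt (by omega)]
  have hlet : ∀ l < n + 1, l ≠ L → ∃ m < n, l = insLetter L m := by
    intro l hl hlL
    by_cases h : l < L
    · exact ⟨l, by omega, by rw [insLetter, if_pos h]⟩
    · exact ⟨l - 1, by omega, by rw [insLetter, if_neg (by omega)]; omega⟩
  refine ⟨⟨?_, ?_, ?_, ?_, ?_, ?_, ?_⟩, ?_⟩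
  · rintro ⟨l, i⟩ h1 h2
    simp only at h1 h2
    simp only [insLevel]
    split_ifs <;> omega
  · rintro ⟨l, i⟩ h0 h1 h2
    simp only [Set.mem_ofPred_eq] at h0 h1 h2
    simp only [delLevel]
    split_ifs <;> omega
  · rintro a b (⟨l, i, hl, hi, h⟩ | ⟨l, hl, h⟩ | ⟨l, hl, h⟩ | ⟨i, hi⟩)
    · refine (htop' l hl i (by omega)).trans ?_
      rw [hbot' l hl i]
      exact Conn.vert (hlt l hl) (by omega) (by rwa [he l hl, hk' l hl])
    · have h3 := hk l hl
      refine (htop' l hl _ (by omega)).trans (Conn.trans ?_ (htop' l hl _ (by omega)).symm)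
      rw [← hk' l hl]
      exact Conn.top (hlt l hl) (by rwa [he l hl])
    · rw [hbot' l hl, hbot' l hl, ← hk' l hl]
      exact Conn.bot (hlt l hl) (by rwa [he l hl])
    · rw [insLevel_le (Nat.zero_le _)]
      rcases hL.lt_or_eq with h | h
      · rw [insLevel_gt h]; exact Conn.close (by omega)
      · subst h
        rw [insLevel_le le_rfl]
        exact (hmid i (by omega)).trans (Conn.close (by omega))
  · rintro a b (⟨l, i, hl, hi, h⟩ | ⟨l, hl, h⟩ | ⟨l, hl, h⟩ | ⟨i, hi⟩)
    · refine ⟨Iff.rfl, fun h0 => ?_⟩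
      simp only [Set.mem_ofPred_eq] at h0
      by_cases hlL : l = L
      · subst hlL
        rw [delLevel_le le_rfl, delLevel_gt le_rfl]
        exact Conn.refl _
      · obtain ⟨m, hm, rfl⟩ := hlet l hl hlL
        rw [hdel m hm, hdel' m hm]
        rw [he m hm, hk' m hm] at h
        exact Conn.vert hm (by omega) h
    · have hlL : l ≠ L := by
        rintro rfl
        rw [heL] at h
        simp at h
      obtain ⟨m, hm, rfl⟩ := hlet l hl hlL
      rw [hk' m hm, hdel m hm, hdel m hm]
      have h3 := hk m hm
      refine ⟨?_, fun _ => Conn.top hm (by rwa [he m hm] at h)⟩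
      simp only [Set.mem_ofPred_eq]
      omega
    · have hlL : l ≠ L := by
        rintro rfl
        rw [heL] at h
        simp at h
      obtain ⟨m, hm, rfl⟩ := hlet l hl hlL
      rw [hk' m hm, hdel' m hm, hdel' m hm]
      have h3 := hk m hm
      refine ⟨?_, fun _ => Conn.bot hm (by rwa [he m hm] at h)⟩
      simp only [Set.mem_ofPred_eq]
      omega
    · refine ⟨Iff.rfl, fun h0 => ?_⟩
      simp only [Set.mem_ofPred_eq] at h0
      rw [delLevel_gt hL, delLevel_le (Nat.zero_le _)]
      exact Conn.close (by omega)
  · rintro ⟨l, i⟩ h1 h2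
    simp only at h1 h2
    refine ⟨by simpa [insLevel] using h2, ?_⟩
    by_cases h : l ≤ L
    · rw [insLevel_le h, delLevel_le h]; exact Conn.refl _
    · rw [insLevel_gt (by omega), delLevel_gt (by omega)]; exact Conn.refl _
  · rintro ⟨l, i⟩ h0 h1 h2
    simp only [Set.mem_ofPred_eq] at h0 h1 h2
    by_cases h : l ≤ L
    · rw [delLevel_le h, insLevel_le h]; exact Conn.refl _
    · obtain ⟨l, rfl⟩ : ∃ m, l = m + 1 := ⟨l - 1, by omega⟩
      rw [delLevel_gt (by omega)]
      by_cases h' : L < l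
      · rw [insLevel_gt h']; exact Conn.refl _
      · obtain rfl : l = L := by omega
        rw [insLevel_le le_rfl]; exact hmid i h2
  -- A new last column is touched by no letter except the 0-resolved one, so it closes up to a
  -- single circle.
  · have key : ∀ l ≤ n + 1, p < p' → Conn (n + 1) p' k' e' (l, p) (0, p) := by
      intro l
      induction l with
      | zero => exact fun _ _ => Conn.refl _
      | succ l ih =>
        intro hl hp
        refine Conn.trans (Conn.symm ?_) (ih (by omega) hp)
        by_cases hlL : l = L
        · rw [hlL]; exact hmid p hp
        · obtain ⟨m, hm, rfl⟩ := hlet l (by omega) hlL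
          have := hk m hm
          exact Conn.vert (by omega) hp (Or.inr (by rw [hk' m hm]; omega))
    rintro ⟨l, i⟩ h0 ⟨m, j⟩ h0' h1 h2 h3 h4
    simp only [Set.mem_ofPred_eq] at h0 h0' h1 h2 h3 h4
    obtain rfl : i = p := by omega
    obtain rfl : j = i := by omega
    exact (key l h1 h2).trans (key m h3 h2).symm
  · intro l hl
    have := hk l hl
    rw [hk' l hl]
    refine ⟨htop' l hl _ (by omega), htop' l hl _ (by omega), ?_⟩
    rw [hbot' l hl]
    exact Conn.refl _

/-- Moving the first letter to the end. -/
def rotDown (n : ℕ) (a : ℕ × ℕ) : ℕ × ℕ := (if a.1 = 0 then n else a.1 - 1, a.2)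

/-- Moving the last letter to the front. -/
def rotUp (n : ℕ) (a : ℕ × ℕ) : ℕ × ℕ := (if a.1 = n + 1 then 1 else a.1 + 1, a.2)

/-- The closing arcs identify the first level with the last one, so the first letter may be read
after all others. -/
theorem model_rotate (hk : ∀ l < n + 1, k l + 1 < p) (hk' : ∀ l < n, k' l = k (l + 1))
    (hk0 : k' n = k 0) (he : ∀ l < n, e' l = e (l + 1)) (he0 : e' n = e 0) :
    Model (n + 1) p k e (n + 1) p k' e' (rotDown n) (rotUp n) ∅ ∧ ∀ l < n + 1,
      Conn (n + 1) p k' e' (rotDown n (l, k l)) (if l = 0 then n else l - 1,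
        k' (if l = 0 then n else l - 1)) ∧
      Conn (n + 1) p k' e' (rotDown n (l, k l + 1)) (if l = 0 then n else l - 1,
        k' (if l = 0 then n else l - 1) + 1) ∧
      Conn (n + 1) p k' e' (rotDown n (l + 1, k l)) ((if l = 0 then n else l - 1) + 1,
        k' (if l = 0 then n else l - 1)) := by
  have d0 : ∀ i, rotDown n (0, i) = (n, i) := fun i => by simp [rotDown]
  have d1 : ∀ l i, rotDown n (l + 1, i) = (l, i) := fun l i => by simp [rotDown]
  have u1 : ∀ i, rotUp n (n + 1, i) = (1, i) := fun i => by simp [rotUp]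
  have u0 : ∀ l i, l ≤ n → rotUp n (l, i) = (l + 1, i) := fun l i h => by
    simp [rotUp, show l ≠ n + 1 by omega]
  refine ⟨⟨?_, ?_, ?_, ?_, ?_, ?_, ?_⟩, ?_⟩
  · rintro ⟨l, i⟩ h1 h2
    simp only at h1 h2
    simp only [rotDown]
    split_ifs <;> omega
  · rintro ⟨l, i⟩ - h1 h2
    simp only at h1 h2
    simp only [rotUp]
    split_ifs <;> omega
  · rintro a b (⟨l, i, hl, hi, h⟩ | ⟨l, hl, h⟩ | ⟨l, hl, h⟩ | ⟨i, hi⟩)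
    · obtain _ | l := l
      · rw [d0, d1]
        refine (Conn.vert (by omega) hi ?_).trans (Conn.close hi)
        rwa [he0, hk0]
      · rw [d1, d1]
        exact Conn.vert (by omega) hi (by rwa [he l (by omega), hk' l (by omega)])
    · obtain _ | l := l
      · rw [d0, d0, ← hk0]
        exact Conn.top (by omega) (by rwa [he0])
      · rw [d1, d1, ← hk' l (by omega)]
        exact Conn.top (by omega) (by rwa [he l (by omega)])
    · have h3 := hk l hl
      obtain _ | l := l
      · rw [d1, d1, ← hk0]
        refine (Conn.close (by omega)).symm.trans ((Conn.bot (by omega) (by rwa [he0])).trans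
          (Conn.close (by omega)))
      · rw [d1, d1, ← hk' l (by omega)]
        exact Conn.bot (by omega) (by rwa [he l (by omega)])
    · rw [d0, d1]; exact Conn.refl _
  · rintro a b (⟨l, i, hl, hi, h⟩ | ⟨l, hl, h⟩ | ⟨l, hl, h⟩ | ⟨i, hi⟩)
    · refine ⟨Iff.rfl, fun _ => ?_⟩
      rw [u0 l i (by omega)]
      by_cases hln : l = n
      · subst hln
        rw [u1]
        exact (Conn.close hi).trans (Conn.vert (by omega) hi (by rwa [← he0, ← hk0]))
      · rw [u0 _ _ (by omega)]
        exact Conn.vert (by omega) hi (by rwa [← he l (by omega), ← hk' l (by omega)])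
    · refine ⟨Iff.rfl, fun _ => ?_⟩
      rw [u0 l _ (by omega), u0 l _ (by omega)]
      by_cases hln : l = n
      · subst hln
        rw [hk0]
        have := hk 0 (by omega)
        exact (Conn.close (by omega)).trans ((Conn.top (by omega) (by rwa [← he0])).trans
          (Conn.close (by omega)).symm)
      · rw [hk' l (by omega)]
        exact Conn.top (by omega) (by rwa [← he l (by omega)])
    · refine ⟨Iff.rfl, fun _ => ?_⟩
      by_cases hln : l = n
      · subst hln
        rw [u1, u1, hk0]
        exact Conn.bot (by omega) (by rwa [← he0])
      · rw [u0 _ _ (by omega), u0 _ _ (by omega), hk' l (by omega)]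
        exact Conn.bot (by omega) (by rwa [← he l (by omega)])
    · refine ⟨Iff.rfl, fun _ => ?_⟩
      rw [u1, u0 _ _ (by omega)]
      exact Conn.refl _
  · rintro ⟨l, i⟩ h1 h2
    simp only at h1 h2
    refine ⟨fun h => h, ?_⟩
    obtain _ | l := l
    · rw [d0, u0 _ _ le_rfl]
      exact Conn.close h2
    · rw [d1, u0 _ _ (by omega)]; exact Conn.refl _
  · rintro ⟨l, i⟩ - h1 h2
    simp only at h1 h2
    by_cases hl : l = n + 1
    · subst hl
      rw [u1, d1]
      exact (Conn.close h2).symm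
    · rw [u0 _ _ (by omega), d1]; exact Conn.refl _
  · rintro a ha
    exact absurd ha id
  · intro l hl
    have h3 := hk l hl
    obtain _ | l := l
    · rw [if_pos rfl, hk0, d0, d0, d1]
      exact ⟨Conn.refl _, Conn.refl _, (Conn.close (by omega)).symm⟩
    · rw [if_neg (by omega), Nat.add_sub_cancel, hk' l (by omega), d1, d1, d1]
      exact ⟨Conn.refl _, Conn.refl _, Conn.refl _⟩

/-- The transposition of two adjacent positions. -/
def swapLetter (L l : ℕ) : ℕ := if l = L then L + 1 else if l = L + 1 then L else l

/-- The levels after the letters in positions `L` and `L + 1` have been exchanged, the second letter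
being `j`. -/
def swapLevel (L j : ℕ) (a : ℕ × ℕ) : ℕ × ℕ :=
  (if a.1 = L + 1 then (if a.2 = j ∨ a.2 = j + 1 then L else L + 2) else a.1, a.2)

/-- Only the points at level `L + 1`, between the two letters, need a new place. In the columns of
the second letter they go up to its new top; in the other columns they go down to level `L + 2`,
below both letters. Distance of the letters makes these moves vertical. -/
theorem conn_swap (hL : L + 1 < n) (hk : ∀ l < n, k l + 1 < p)
    (hfar : k L + 1 < k (L + 1) ∨ k (L + 1) + 1 < k L)
    (hk' : ∀ l, l ≠ L → l ≠ L + 1 → k' l = k l) (hkL : k' L = k (L + 1)) (hkL' : k' (L + 1) = k L)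
    (he' : ∀ l < n, l ≠ L → l ≠ L + 1 → e' l = e l) (heL : e' L = e (L + 1))
    (heL' : e' (L + 1) = e L) :
    (∀ a b, Step n p k e a b →
      Conn n p k' e' (swapLevel L (k (L + 1)) a) (swapLevel L (k (L + 1)) b)) ∧
    ∀ l < n,
      Conn n p k' e' (swapLevel L (k (L + 1)) (l, k l)) (swapLetter L l, k' (swapLetter L l)) ∧
      Conn n p k' e' (swapLevel L (k (L + 1)) (l, k l + 1))
        (swapLetter L l, k' (swapLetter L l) + 1) ∧
      Conn n p k' e' (swapLevel L (k (L + 1)) (l + 1, k l))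
        (swapLetter L l + 1, k' (swapLetter L l)) := by
  set j := k (L + 1) with hj
  have s0 : ∀ l i, l ≠ L + 1 → swapLevel L j (l, i) = (l, i) := fun l i h => by
    simp [swapLevel, h]
  have s1 : swapLevel L j (L + 1, j) = (L, j) := by simp [swapLevel]
  have s2 : swapLevel L j (L + 1, j + 1) = (L, j + 1) := by simp [swapLevel]
  have s3 : ∀ i, i ≠ j → i ≠ j + 1 → swapLevel L j (L + 1, i) = (L + 2, i) := fun i h h' => by
    simp [swapLevel, h, h']
  have hjp := hk (L + 1) hL
  have hkp := hk L (by omega)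
  rw [← hj] at hjp
  have v0 : ∀ i, i < p → (e (L + 1) = false ∨ (i ≠ j ∧ i ≠ j + 1)) →
      Conn n p k' e' (L, i) (L + 1, i) := fun i hi h =>
    Conn.vert (by omega) hi (by rwa [heL, hkL])
  have v1 : ∀ i, i < p → (e L = false ∨ (i ≠ k L ∧ i ≠ k L + 1)) →
      Conn n p k' e' (L + 1, i) (L + 2, i) := fun i hi h =>
    Conn.vert (by omega) hi (by rwa [heL', hkL'])
  constructor
  · rintro a b (⟨l, i, hl, hi, h⟩ | ⟨l, hl, h⟩ | ⟨l, hl, h⟩ | ⟨i, hi⟩)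
    · by_cases h1 : l = L
      · subst h1
        rw [s0 _ _ (by omega)]
        by_cases h2 : i = j
        · rw [h2, s1]; exact Conn.refl _
        · by_cases h3 : i = j + 1
          · rw [h3, s2]; exact Conn.refl _
          · rw [s3 i h2 h3]
            exact (v0 i hi (Or.inr ⟨h2, h3⟩)).trans (v1 i hi h)
      · by_cases h1' : l = L + 1
        · subst h1'
          rw [s0 (L + 1 + 1) _ (by omega)]
          by_cases h2 : i = j
          · rw [h2, s1]
            exact (v0 j (by omega) (by rwa [h2] at h)).trans
              (v1 j (by omega) (Or.inr (by omega)))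
          · by_cases h3 : i = j + 1
            · rw [h3, s2]
              exact (v0 _ (by omega) (by rwa [h3] at h)).trans
                (v1 _ (by omega) (Or.inr (by omega)))
            · rw [s3 i h2 h3]; exact Conn.refl _
        · rw [s0 _ _ (by omega), s0 _ _ (by omega)]
          exact Conn.vert hl hi (by rwa [he' l hl h1 h1', hk' l h1 h1'])
    · by_cases h1 : l = L
      · subst h1
        rw [s0 _ _ (by omega), s0 _ _ (by omega)]
        refine (v0 _ (by omega) (Or.inr (by omega))).trans (Conn.trans ?_
          (v0 _ (by omega) (Or.inr (by omega))).symm)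
        rw [← hkL']
        exact Conn.top (by omega) (by rwa [heL'])
      · by_cases h1' : l = L + 1
        · subst h1'
          rw [← hj, s1, s2, ← hkL]
          exact Conn.top (by omega) (by rwa [heL])
        · rw [s0 _ _ (by omega), s0 _ _ (by omega), ← hk' l h1 h1']
          exact Conn.top hl (by rwa [he' l hl h1 h1'])
    · by_cases h1 : l = L
      · subst h1
        rw [s3 _ (by omega) (by omega), s3 _ (by omega) (by omega), ← hkL']
        exact Conn.bot (by omega) (by rwa [heL'])
      · by_cases h1' : l = L + 1
        · subst h1'
          rw [s0 _ _ (by omega), s0 _ _ (by omega), ← hj]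
          refine (v1 _ (by omega) (Or.inr (by omega))).symm.trans (Conn.trans ?_
            (v1 _ (by omega) (Or.inr (by omega))))
          rw [← hkL]
          exact Conn.bot (by omega) (by rwa [heL])
        · rw [s0 _ _ (by omega), s0 _ _ (by omega), ← hk' l h1 h1']
          exact Conn.bot hl (by rwa [he' l hl h1 h1'])
    · rw [s0 _ _ (by omega), s0 _ _ (by omega)]
      exact Conn.close hi
  · intro l hl
    by_cases h1 : l = L
    · subst h1
      rw [swapLetter, if_pos rfl, s0 _ _ (by omega), s0 _ _ (by omega),
        s3 _ (by omega) (by omega), hkL']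
      exact ⟨v0 _ (by omega) (Or.inr (by omega)), v0 _ (by omega) (Or.inr (by omega)),
        Conn.refl _⟩
    · by_cases h1' : l = L + 1
      · subst h1'
        rw [swapLetter, if_neg h1, if_pos rfl, ← hj, s1, s2, s0 _ _ (by omega), hkL]
        exact ⟨Conn.refl _, Conn.refl _, (v1 _ (by omega) (Or.inr (by omega))).symm⟩
      · rw [swapLetter, if_neg h1, if_neg h1', s0 _ _ (by omega), s0 _ _ (by omega),
          s0 _ _ (by omega), hk' l h1 h1']
        exact ⟨Conn.refl _, Conn.refl _, Conn.refl _⟩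

/-- `conn_swap` applies in both directions. The two level maps compose to the identity up to a
vertical move between levels `L`, `L + 1` and `L + 2`. -/
theorem model_swap (hL : L + 1 < n) (hk : ∀ l < n, k l + 1 < p)
    (hfar : k L + 1 < k (L + 1) ∨ k (L + 1) + 1 < k L)
    (hk' : ∀ l, l ≠ L → l ≠ L + 1 → k' l = k l) (hkL : k' L = k (L + 1)) (hkL' : k' (L + 1) = k L)
    (he' : ∀ l < n, l ≠ L → l ≠ L + 1 → e' l = e l) (heL : e' L = e (L + 1))
    (heL' : e' (L + 1) = e L) :
    Model n p k e n p k' e' (swapLevel L (k (L + 1))) (swapLevel L (k L)) ∅ ∧ ∀ l < n,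
      Conn n p k' e' (swapLevel L (k (L + 1)) (l, k l)) (swapLetter L l, k' (swapLetter L l)) ∧
      Conn n p k' e' (swapLevel L (k (L + 1)) (l, k l + 1))
        (swapLetter L l, k' (swapLetter L l) + 1) ∧
      Conn n p k' e' (swapLevel L (k (L + 1)) (l + 1, k l))
        (swapLetter L l + 1, k' (swapLetter L l)) := by
  obtain ⟨h1, h2⟩ := conn_swap hL hk hfar hk' hkL hkL' he' heL heL'
  have hk2 : ∀ l < n, k' l + 1 < p := by
    intro l hl
    by_cases h3 : l = L
    · rw [h3, hkL]; exact hk _ hL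
    · by_cases h4 : l = L + 1
      · rw [h4, hkL']; exact hk _ (by omega)
      · rw [hk' l h3 h4]; exact hk l hl
  obtain ⟨h3, -⟩ := conn_swap (k := k') (k' := k) (e := e') (e' := e) hL hk2
    (by rw [hkL, hkL']; exact hfar.symm) (fun l h h' => (hk' l h h').symm) hkL'.symm hkL.symm
    (fun l hl h h' => (he' l hl h h').symm) heL'.symm heL.symm
  rw [hkL'] at h3
  have hrange : ∀ j (a : ℕ × ℕ), a.1 ≤ n → a.2 < p →
      (swapLevel L j a).1 ≤ n ∧ (swapLevel L j a).2 < p := by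
    rintro j ⟨l, i⟩ h4 h5
    simp only at h4 h5
    simp only [swapLevel]
    split_ifs <;> omega
  have hinv : ∀ (k k' : ℕ → ℕ) (e : ℕ → Bool), k' (L + 1) = k L → k' L = k (L + 1) →
      (k L + 1 < k (L + 1) ∨ k (L + 1) + 1 < k L) → ∀ a : ℕ × ℕ, a.1 ≤ n → a.2 < p →
      Conn n p k e (swapLevel L (k L) (swapLevel L (k (L + 1)) a)) a := by
    rintro k k' e hkL hkL' hfar ⟨l, i⟩ h5 h6
    simp only at h5 h6
    by_cases h7 : l = L + 1
    · subst h7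
      by_cases h8 : i = k (L + 1) ∨ i = k (L + 1) + 1
      · have h9 : swapLevel L (k L) (swapLevel L (k (L + 1)) (L + 1, i)) = (L, i) := by
          simp [swapLevel, h8]
        rw [h9]
        exact Conn.vert (by omega) h6 (Or.inr (by omega))
      · have h9 : swapLevel L (k L) (swapLevel L (k (L + 1)) (L + 1, i)) = (L + 2, i) := by
          simp [swapLevel, h8]
        rw [h9]
        exact (Conn.vert hL h6 (Or.inr (by omega))).symm
    · have h9 : swapLevel L (k L) (swapLevel L (k (L + 1)) (l, i)) = (l, i) := by
        simp [swapLevel, h7]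
      rw [h9]
      exact Conn.refl _
  refine ⟨⟨hrange _, fun a _ => hrange _ a, h1, fun a b h => ⟨Iff.rfl, fun _ => h3 a b h⟩,
    fun a h4 h5 => ⟨fun h => h, hinv k k' e hkL' hkL hfar a h4 h5⟩, fun a _ h4 h5 => ?_,
    fun a ha => absurd ha id⟩, h2⟩
  have := hinv k' k e' hkL.symm hkL'.symm (by rw [hkL, hkL']; exact hfar.symm) a h4 h5
  rwa [hkL, hkL'] at this

end Khovanov

/-! ### Words with partially resolved letters -/

namespace Khovanov

section

variable {p p' : ℕ} {b : List (Fin (p - 1))} {b' : List (Fin (p' - 1))}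

/-- The homology of the face of the cube of a braid closure given by tags of the letters. -/
abbrev FaceHom (p : ℕ) (b : List (Fin (p - 1))) (t : ℕ → Option Bool) (i j : ℤ) : Type :=
  (braidClosure p b).based.Hom ((braidClosure p b).face (tagged p b t)) i j

theorem compareBraids_of_empty {t t' : ℕ → Option Bool} {κ κ' : ℕ → ℕ} {f r : ℕ × ℕ → ℕ × ℕ}
    {O : Set (ℕ × ℕ)}
    (hκ : ∀ l < b.length, κ l < b'.length ∧ t' (κ l) = t l ∧ κ' (κ l) = l)
    (hκ' : ∀ l < b'.length, t' l = none → κ' l < b.length ∧ κ (κ' l) = l)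
    (hones : ones (tagged p' b' t') = ones (tagged p b t))
    (hmodel : ∀ e e' : ℕ → Bool, (∀ l < b.length, e' (κ l) = e l) →
      (∀ l < b'.length, t' l = some false → e' l = false) →
      Model b.length p (letterAt b) e b'.length p' (letterAt b') e' f r O ∧
      ∀ l < b.length,
        Conn b'.length p' (letterAt b') e' (f (l, letterAt b l)) (κ l, letterAt b' (κ l)) ∧
        Conn b'.length p' (letterAt b') e' (f (l, letterAt b l + 1)) (κ l, letterAt b' (κ l) + 1) ∧
        Conn b'.length p' (letterAt b') e' (f (l + 1, letterAt b l)) (κ l + 1, letterAt b' (κ l)))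
    (hO : ∀ a : ℕ × ℕ, a.1 ≤ b'.length → a.2 < p' → a ∉ O) (i j : ℤ) :
    Nonempty (FaceHom p b t i j ≃ₗ[ℤ] FaceHom p' b' t' i j) := by
  have h := compareBraids (g := .one) hκ hκ' hones hmodel (Or.inl ⟨hO, rfl⟩) i j
  have hset : {y : (braidClosure p' b').based.B | y ∈ (braidClosure p' b').face (tagged p' b' t') ∧
      ∀ x : (braidClosure p' b').Pt, coord x ∈ O →
        y.2 ((braidClosure p' b').circ y.1 x) = .one} = (braidClosure p' b').face (tagged p' b' t') :=
    Set.ext fun y => ⟨fun h => h.1, fun h => ⟨h, fun x hx =>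
      absurd hx (hO _ (coord_fst x) (coord_snd x))⟩⟩
  rw [hset, add_zero] at h
  exact h

end

/-- Words in the letters of the braid group on `M + 2` strands, with an optional resolution for each
letter. Letters exceeding `M` are read as `M`. -/
abbrev TWord := List (ℕ × Option Bool)

/-- The letters of a tagged word. -/
def letters (M : ℕ) (w : TWord) : List (Fin (M + 2 - 1)) :=
  w.map fun a => ⟨min a.1 M, Nat.lt_succ_of_le (min_le_right _ _)⟩

/-- The tags of a tagged word. -/
def tags (w : TWord) (l : ℕ) : Option Bool := (w[l]?).elim none Prod.snd

/-- The number of letters with the tag `1`. -/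
def tagOnes (w : TWord) : ℕ := (w.map fun a => if a.2 = some true then 1 else 0).sum

/-- The homology of the face of the cube of the closure of a tagged word. -/
abbrev WHom (M : ℕ) (w : TWord) (i j : ℤ) : Type := FaceHom (M + 2) (letters M w) (tags w) i j

variable {M : ℕ} {s t w w' : TWord} {a a' a'' : ℕ × Option Bool}

theorem length_letters : (letters M w).length = w.length := List.length_map _

theorem letterAt_letters (l : ℕ) :
    letterAt (letters M w) l = (w[l]?).elim 0 fun a => min a.1 M := by
  by_cases h : l < w.length
  · rw [letterAt, dif_pos (by rwa [length_letters]), List.getElem?_eq_getElem h]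
    simp [letters]
  · rw [letterAt, dif_neg (by rwa [length_letters]), List.getElem?_eq_none (by omega)]
    rfl

theorem ones_tags : ones (tagged (M + 2) (letters M w) (tags w)) = tagOnes w := by
  have h1 : ones (tagged (M + 2) (letters M w) (tags w)) =
      ∑ c : Fin (letters M w).length, if tags w c = some true then 1 else 0 := by
    unfold ones
    rw [Finset.card_filter]
    rfl
  have h2 : ∀ (n : ℕ), n = w.length → (∑ c : Fin n, if tags w c = some true then 1 else 0) =
      tagOnes w := by
    rintro _ rfl
    rw [tagOnes, ← List.sum_ofFn]
    congr 1
    refine List.ext_getElem (by simp) fun l h h' => ?_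
    simp only [List.length_ofFn] at h
    simp [tags]
  rw [h1, h2 _ length_letters]

section GetElem

theorem getElem?_mid : (s ++ a :: t)[s.length]? = some a := by simp

theorem getElem?_mid_one : (s ++ a :: a' :: t)[s.length + 1]? = some a' := by
  rw [List.getElem?_append_right (by omega)]; simp

theorem getElem?_mid_two : (s ++ a :: a' :: a'' :: t)[s.length + 2]? = some a'' := by
  rw [List.getElem?_append_right (by omega)]; simp

theorem getElem?_insLetter (l : ℕ) : (s ++ a :: t)[insLetter s.length l]? = (s ++ t)[l]? := by
  unfold insLetter
  split_ifs with h
  · rw [List.getElem?_append_left h, List.getElem?_append_left h]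
  · rw [List.getElem?_append_right (by omega), List.getElem?_append_right (by omega),
      show l + 1 - s.length = (l - s.length) + 1 by omega, List.getElem?_cons_succ]

theorem getElem?_swapLetter (l : ℕ) :
    (s ++ a' :: a :: t)[swapLetter s.length l]? = (s ++ a :: a' :: t)[l]? := by
  unfold swapLetter
  split_ifs with h h'
  · rw [h, getElem?_mid, getElem?_mid_one]
  · rw [h', getElem?_mid, getElem?_mid_one]
  · rcases lt_or_ge l s.length with h1 | h1
    · rw [List.getElem?_append_left h1, List.getElem?_append_left h1]
    · rw [List.getElem?_append_right h1, List.getElem?_append_right h1]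
      obtain ⟨m, hm⟩ : ∃ m, l - s.length = m + 2 := ⟨l - s.length - 2, by omega⟩
      rw [hm]; simp

theorem getElem?_congr_tag {k : ℕ} {v v' : Option Bool} {l : ℕ} (h : l ≠ s.length) :
    (s ++ (k, v) :: t)[l]? = (s ++ (k, v') :: t)[l]? := by
  rcases lt_or_ge l s.length with h1 | h1
  · rw [List.getElem?_append_left h1, List.getElem?_append_left h1]
  · rw [List.getElem?_append_right h1, List.getElem?_append_right h1]
    obtain ⟨m, hm⟩ : ∃ m, l - s.length = m + 1 := ⟨l - s.length - 1, by omega⟩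
    rw [hm]; simp

end GetElem

theorem tags_mid : tags (s ++ a :: t) s.length = a.2 := by rw [tags, getElem?_mid]; rfl

theorem tags_mid_one : tags (s ++ a :: a' :: t) (s.length + 1) = a'.2 := by
  rw [tags, getElem?_mid_one]; rfl

theorem tags_mid_two : tags (s ++ a :: a' :: a'' :: t) (s.length + 2) = a''.2 := by
  rw [tags, getElem?_mid_two]; rfl

theorem letterAt_mid : letterAt (letters M (s ++ a :: t)) s.length = min a.1 M := by
  rw [letterAt_letters, getElem?_mid]; rfl

theorem letterAt_mid_one :
    letterAt (letters M (s ++ a :: a' :: t)) (s.length + 1) = min a'.1 M := by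
  rw [letterAt_letters, getElem?_mid_one]; rfl

theorem letterAt_mid_two :
    letterAt (letters M (s ++ a :: a' :: a'' :: t)) (s.length + 2) = min a''.1 M := by
  rw [letterAt_letters, getElem?_mid_two]; rfl

theorem tagOnes_append : tagOnes (s ++ t) = tagOnes s + tagOnes t := by simp [tagOnes]

theorem tagOnes_cons : tagOnes (a :: t) = (if a.2 = some true then 1 else 0) + tagOnes t := by
  simp [tagOnes]

theorem letterAt_add_one_lt' {l : ℕ} (h : l < w.length) :
    letterAt (letters M w) l + 1 < M + 2 := letterAt_add_one_lt (by rwa [length_letters])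

/-- A letter that is resolved to `0` may be deleted. -/
theorem whom_insert (s t : TWord) (k : ℕ) (i j : ℤ) :
    Nonempty (WHom M (s ++ t) i j ≃ₗ[ℤ] WHom M (s ++ (k, some false) :: t) i j) := by
  have hn : (letters M (s ++ (k, some false) :: t)).length = (letters M (s ++ t)).length + 1 := by
    rw [length_letters, length_letters]; simp; omega
  have hL : s.length ≤ (letters M (s ++ t)).length := by rw [length_letters]; simp
  refine compareBraids_of_empty (κ := insLetter s.length)
    (κ' := fun l => if l < s.length then l else l - 1)
    (f := insLevel s.length) (r := delLevel s.length) (O := {a | M + 2 ≤ a.2}) ?_ ?_ ?_ ?_ ?_ i j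
  · intro l hl
    refine ⟨?_, ?_, ?_⟩
    · rw [hn]; unfold insLetter; split_ifs <;> omega
    · rw [tags, getElem?_insLetter]; rfl
    · unfold insLetter; split_ifs <;> omega
  · intro l hl h
    have hl' : l ≠ s.length := by
      rintro rfl
      rw [tags_mid] at h
      simp at h
    rw [hn] at hl
    unfold insLetter
    constructor
    · split_ifs <;> omega
    · split_ifs <;> omega
  · rw [ones_tags, ones_tags, tagOnes_append, tagOnes_append, tagOnes_cons]; simp
  · intro e e' he he'
    rw [hn]
    refine model_insert hL le_rfl (Nat.le_succ _) (fun l hl => letterAt_add_one_lt hl) ?_ he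
      (he' _ (by rw [hn]; omega) tags_mid)
    intro l _
    rw [letterAt_letters, letterAt_letters, getElem?_insLetter]
  · intro a _ h h'
    exact absurd h (not_lt.2 h')

/-- Words are considered up to rotation. -/
theorem whom_rotate (a : ℕ × Option Bool) (t : TWord) (i j : ℤ) :
    Nonempty (WHom M (a :: t) i j ≃ₗ[ℤ] WHom M (t ++ [a]) i j) := by
  have hn : (letters M (a :: t)).length = t.length + 1 := by rw [length_letters]; simp
  have hn' : (letters M (t ++ [a])).length = t.length + 1 := by rw [length_letters]; simp
  have hg : ∀ l < t.length + 1, (t ++ [a])[if l = 0 then t.length else l - 1]? = (a :: t)[l]? := by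
    intro l hl
    split_ifs with h
    · subst h; simp
    · obtain ⟨m, rfl⟩ : ∃ m, l = m + 1 := ⟨l - 1, by omega⟩
      rw [List.getElem?_cons_succ, Nat.add_sub_cancel, List.getElem?_append_left (by omega)]
  refine compareBraids_of_empty (κ := fun l => if l = 0 then t.length else l - 1)
    (κ' := fun l => if l = t.length then 0 else l + 1)
    (f := rotDown t.length) (r := rotUp t.length) (O := ∅) ?_ ?_ ?_ ?_ (fun _ _ _ h => h) i j
  · intro l hl
    rw [hn] at hl
    refine ⟨?_, ?_, ?_⟩
    · rw [hn']; split_ifs <;> omega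
    · rw [tags, hg l hl]; rfl
    · split_ifs <;> omega
  · intro l hl _
    rw [hn'] at hl
    rw [hn]
    by_cases h : l = t.length
    · simp [h]
    · simp [h]; omega
  · rw [ones_tags, ones_tags, tagOnes_append, tagOnes_cons, tagOnes_cons]
    simp [tagOnes, add_comm]
  · intro e e' he _
    rw [hn] at he
    rw [hn, hn']
    have hk : ∀ l < t.length + 1, letterAt (letters M (t ++ [a]))
        (if l = 0 then t.length else l - 1) = letterAt (letters M (a :: t)) l := by
      intro l hl
      rw [letterAt_letters, hg l hl, letterAt_letters]
    refine model_rotate (fun l hl => letterAt_add_one_lt' hl) ?_ ?_ ?_ ?_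
    · intro l hl
      simpa using hk (l + 1) (by omega)
    · simpa using hk 0 (by omega)
    · intro l hl
      simpa using he (l + 1) (by omega)
    · simpa using he 0 (by omega)

/-- Distant letters commute. -/
theorem whom_swap (s t : TWord) {a a' : ℕ × Option Bool} (ha : a.1 ≤ M) (ha' : a'.1 ≤ M)
    (hfar : a.1 + 1 < a'.1 ∨ a'.1 + 1 < a.1) (i j : ℤ) :
    Nonempty (WHom M (s ++ a :: a' :: t) i j ≃ₗ[ℤ] WHom M (s ++ a' :: a :: t) i j) := by
  have hn : (letters M (s ++ a :: a' :: t)).length = s.length + (t.length + 2) := by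
    rw [length_letters]; simp
  have hn' : (letters M (s ++ a' :: a :: t)).length = s.length + (t.length + 2) := by
    rw [length_letters]; simp
  refine compareBraids_of_empty (κ := swapLetter s.length) (κ' := swapLetter s.length)
    (f := swapLevel s.length (letterAt (letters M (s ++ a :: a' :: t)) (s.length + 1)))
    (r := swapLevel s.length (letterAt (letters M (s ++ a :: a' :: t)) s.length)) (O := ∅)
    ?_ ?_ ?_ ?_ (fun _ _ _ h => h) i j
  · intro l hl
    rw [hn] at hl
    refine ⟨?_, ?_, ?_⟩
    · rw [hn']; unfold swapLetter; split_ifs <;> omega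
    · rw [tags, getElem?_swapLetter]; rfl
    · unfold swapLetter; split_ifs <;> omega
  · intro l hl _
    rw [hn'] at hl
    rw [hn]
    unfold swapLetter
    constructor
    · split_ifs <;> omega
    · split_ifs <;> omega
  · rw [ones_tags, ones_tags]
    simp [tagOnes]; omega
  · intro e e' he _
    rw [hn] at he
    rw [hn, hn']
    refine model_swap (by omega) (fun l hl => letterAt_add_one_lt (by rwa [hn])) ?_ ?_ ?_ ?_ ?_ ?_ ?_
    · rw [letterAt_mid, letterAt_mid_one]; omega
    · intro l h h'
      have := getElem?_swapLetter (s := s) (t := t) (a := a) (a' := a') l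
      rw [swapLetter, if_neg h, if_neg h'] at this
      rw [letterAt_letters, letterAt_letters, this]
    · rw [letterAt_mid, letterAt_mid_one]
    · rw [letterAt_mid, letterAt_mid_one]
    · intro l hl h h'
      have := he l hl
      rwa [swapLetter, if_neg h, if_neg h'] at this
    · have := he (s.length + 1) (by omega)
      simpa [swapLetter] using this
    · have := he s.length (by omega)
      simpa [swapLetter] using this

theorem letters_tag (s t : TWord) (k : ℕ) (v v' : Option Bool) :
    letters M (s ++ (k, v) :: t) = letters M (s ++ (k, v') :: t) := by simp [letters]

theorem update_tagged {p : ℕ} {b : List (Fin (p - 1))} {k : ℕ} {v : Option Bool} {v' : Bool}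
    {c : Fin (braidClosure p b).n} (hc : (c : ℕ) = s.length) :
    Function.update (tagged p b (tags (s ++ (k, v) :: t))) c (some v') =
      tagged p b (tags (s ++ (k, some v') :: t)) := by
  funext d
  by_cases hd : d = c
  · subst hd
    rw [Function.update_self]
    show _ = tags _ d
    rw [hc, tags_mid]
  · rw [Function.update_of_ne hd]
    show tags _ d = tags _ d
    rw [tags, getElem?_congr_tag (v' := some v')]
    · rfl
    · exact fun h => hd (Fin.ext (h.trans hc.symm))

end Khovanov

/-! ### Local moves at a turnback -/

namespace Khovanov

section Circle

variable {p : ℕ} {b : List (Fin (p - 1))} {ε : Fin (braidClosure p b).n → Bool}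

/-- A nonempty set that is saturated under elementary connections and connected is a single class.
-/
theorem isCircle_of_steps {O : Set (ℕ × ℕ)}
    (hstep : ∀ a a', Step b.length p (letterAt b) (extend ε) a a' → (a ∈ O ↔ a' ∈ O))
    (hne : ∃ a ∈ O, a.1 ≤ b.length ∧ a.2 < p)
    (hconn : ∀ a ∈ O, ∀ a' ∈ O, Conn b.length p (letterAt b) (extend ε) a a') :
    (braidClosure p b).IsCircle ε {x | coord x ∈ O} := by
  have hO : ∀ a a', Conn b.length p (letterAt b) (extend ε) a a' → (a ∈ O ↔ a' ∈ O) := by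
    intro a a' h
    induction h with
    | rel a a' h => exact hstep a a' h
    | refl a => exact Iff.rfl
    | symm a a' _ ih => exact ih.symm
    | trans a a' a'' _ _ ih ih' => exact ih.trans ih'
  obtain ⟨a, ha, h1, h2⟩ := hne
  refine ⟨⟨pt b a.1 a.2 h1 h2, ha⟩, fun x hx y => ?_⟩
  rw [circ_iff_conn]
  exact ⟨fun hy => hconn _ hy _ hx, fun h => (hO _ _ h).2 hx⟩

/-- The points in the columns `m` and `m + 1` between the levels `L` and `H`. -/
def bigon (L H m : ℕ) : Set (ℕ × ℕ) := {a | L < a.1 ∧ a.1 ≤ H ∧ (a.2 = m ∨ a.2 = m + 1)}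

theorem mem_bigon {L H m l i : ℕ} : (l, i) ∈ bigon L H m ↔ L < l ∧ l ≤ H ∧ (i = m ∨ i = m + 1) :=
  Iff.rfl

/-- Two turnbacks in the same columns bound a circle. -/
theorem isCircle_bigon {L H m : ℕ} (hLH : L < H) (hH : H < b.length) (hL : letterAt b L = m)
    (hHm : letterAt b H = m) (heL : extend ε L = true) (heH : extend ε H = true)
    (hmid : ∀ l, L < l → l < H → extend ε l = false) :
    (braidClosure p b).IsCircle ε {x | coord x ∈ bigon L H m} := by
  have hm : m + 1 < p := by
    rw [← hL]; exact letterAt_add_one_lt (by omega)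
  refine isCircle_of_steps ?_ ⟨(H, m), ⟨hLH, le_rfl, Or.inl rfl⟩, hH.le, by simp only; omega⟩ ?_
  · rintro a a' (⟨l, i, hl, hi, h⟩ | ⟨l, hl, h⟩ | ⟨l, hl, h⟩ | ⟨i, hi⟩)
    · rw [mem_bigon, mem_bigon]
      by_cases h1 : l = L
      · subst h1
        rw [heL, hL] at h
        simp only [Bool.true_eq_false, false_or] at h
        omega
      · by_cases h2 : l = H
        · subst h2
          rw [heH, hHm] at h
          simp only [Bool.true_eq_false, false_or] at h
          omega
        · omega
    · rw [mem_bigon, mem_bigon]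
      by_cases h1 : l = H
      · subst h1; omega
      · by_cases h2 : L < l ∧ l < H
        · rw [hmid l h2.1 h2.2] at h; simp at h
        · omega
    · rw [mem_bigon, mem_bigon]
      by_cases h1 : l = L
      · subst h1; omega
      · by_cases h2 : L < l ∧ l < H
        · rw [hmid l h2.1 h2.2] at h; simp at h
        · omega
    · rw [mem_bigon, mem_bigon]; omega
  · have h1 : ∀ l i, i < p → L < l → l ≤ H →
        Conn b.length p (letterAt b) (extend ε) (l, i) (L + 1, i) := by
      intro l i hi hl
      induction l, hl using Nat.le_induction with
      | base => exact fun _ => Conn.refl _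
      | succ l hl ih =>
        intro h2
        exact (Conn.vert (by omega) hi (Or.inl (hmid l (by omega) (by omega)))).symm.trans
          (ih (by omega))
    -- Each column of the bigon runs up to level `L + 1`, where the lower arc of the turnback at `L`
    -- joins the two columns.
    have h2 : ∀ a ∈ bigon L H m, Conn b.length p (letterAt b) (extend ε) a (L + 1, m) := by
      rintro ⟨l, i⟩ ⟨h3, h4, h5⟩
      simp only at h3 h4 h5
      rcases h5 with rfl | rfl
      · exact h1 l _ (by omega) h3 h4
      · refine (h1 l _ (by omega) h3 h4).trans ?_
        have := Conn.bot (p := p) (k := letterAt b) (e := extend ε) (l := L) (n := b.length)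
          (by omega) heL
        rw [hL] at this
        exact this.symm
    exact fun a ha a' ha' => (h2 a ha).trans (h2 a' ha').symm

theorem nw_mem {c : Fin (braidClosure p b).n} {O : Set (ℕ × ℕ)} :
    (braidClosure p b).nw c ∈ {x | coord x ∈ O} ↔ ((c : ℕ), letterAt b c) ∈ O := by
  rw [corner_nw]; rfl

theorem ne_mem {c : Fin (braidClosure p b).n} {O : Set (ℕ × ℕ)} :
    (braidClosure p b).ne c ∈ {x | coord x ∈ O} ↔ ((c : ℕ), letterAt b c + 1) ∈ O := by
  rw [corner_ne]; rfl

theorem sw_mem {c : Fin (braidClosure p b).n} {O : Set (ℕ × ℕ)} :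
    (braidClosure p b).sw c ∈ {x | coord x ∈ O} ↔ ((c : ℕ) + 1, letterAt b c) ∈ O := by
  rw [corner_sw]; rfl

end Circle

variable {M : ℕ}

/-- Changing a tag leaves the word of letters only provably equal; this moves different tags onto
one common diagram. -/
theorem whom_of_letters {w : TWord} {b : List (Fin (M + 2 - 1))} (h : letters M w = b)
    (i j : ℤ) : Nonempty (WHom M w i j ≃ₗ[ℤ] FaceHom (M + 2) b (tags w) i j) := by
  subst h
  exact ⟨LinearEquiv.refl _ _⟩

/-- The crossing in a given position of a braid closure. -/
def crossing {p : ℕ} (b : List (Fin (p - 1))) (l : ℕ) (h : l < b.length) :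
    Fin (braidClosure p b).n := ⟨l, h⟩

theorem fits_extend {b : List (Fin (M + 2 - 1))} {w : TWord}
    {ε : Fin (braidClosure (M + 2) b).n → Bool} (h : Fits (tagged (M + 2) b (tags w)) ε) {l : ℕ}
    (hl : l < b.length) {v : Bool} (hv : tags w l = some v) : extend ε l = v := by
  rw [extend_of_lt (n := (braidClosure (M + 2) b).n) hl]
  exact h ⟨l, hl⟩ v hv

/-- A crossing next to a parallel turnback is absorbed by it. -/
theorem whom_absorb (s t : TWord) (m : ℕ) (i j : ℤ) :
    Nonempty (WHom M (s ++ (m, some true) :: t) i j ≃ₗ[ℤ]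
      WHom M (s ++ (m, none) :: (m, some true) :: t) (i + 1) (j + 2)) := by
  set w : TWord := s ++ (m, none) :: (m, some true) :: t with hw
  set b := letters M w with hb
  have hlen : b.length = s.length + t.length + 2 := by
    rw [hb, length_letters, hw]; simp; omega
  have hL : s.length < b.length := by omega
  let c := crossing b s.length hL
  have hc : tagged (M + 2) b (tags w) c = none := tags_mid
  have hU : tags w (s.length + 1) = some true := tags_mid_one
  have hk : letterAt b s.length = min m M := letterAt_mid
  have hk1 : letterAt b (s.length + 1) = min m M := letterAt_mid_one
  -- With the free letter 1-resolved, it and the turnback below it bound a circle.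
  have h := (good_braidClosure (M + 2) b).split_circle
    (O := {x | coord x ∈ bigon s.length (s.length + 1) (min m M)}) hc ?_ ?_ ?_ i j
  · rw [update_tagged (s := s) (c := c) rfl] at h
    have h1 := whom_of_letters (w := s ++ (m, some false) :: (m, some true) :: t) (b := b)
      (letters_tag _ _ _ _ _) i j
    exact ⟨((whom_insert s ((m, some true) :: t) m i j).some.trans h1.some).trans h.some⟩
  · intro ε hε hεc
    refine isCircle_bigon (by omega) (by omega) hk hk1 (by
      rw [extend_of_lt (n := (braidClosure (M + 2) b).n) hL]; exact hεc)
      (fits_extend hε (by omega) hU) (fun l h1 h2 => by omega)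
  · rw [nw_mem, sw_mem, mem_bigon, mem_bigon]
    show s.length < s.length ∧ _ ↔ ¬ (s.length < s.length + 1 ∧ s.length + 1 ≤ s.length + 1 ∧
      (letterAt b s.length = _ ∨ letterAt b s.length = _))
    rw [hk]
    simp
  · intro d hd hdc
    have h1 : (d : ℕ) ≠ s.length := fun h => hdc (Fin.ext h)
    have h2 : (d : ℕ) ≠ s.length + 1 := by
      intro h
      have hd' : tags w d = none := hd
      rw [h, hU] at hd'
      simp at hd'
    rw [nw_mem, ne_mem, sw_mem, mem_bigon, mem_bigon, mem_bigon]
    omega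

theorem free_ne {b : List (Fin (M + 2 - 1))} {w : TWord} {d : Fin (braidClosure (M + 2) b).n}
    (hd : tagged (M + 2) b (tags w) d = none) {l : ℕ} {v : Bool} (hl : tags w l = some v) :
    (d : ℕ) ≠ l := by
  rintro rfl
  have hd' : tags w d = none := hd
  rw [hl] at hd'
  simp at hd'

/-- Two crossings above a turnback slide off, leaving two adjacent turnbacks. -/
theorem whom_slide_down (s t : TWord) {m m' : ℕ} (hm : m ≤ M) (hm' : m' ≤ M)
    (hadj : m' = m + 1 ∨ m = m' + 1) (i j : ℤ) :
    Nonempty (WHom M (s ++ (m', some true) :: (m, some true) :: t) i j ≃ₗ[ℤ]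
      WHom M (s ++ (m, none) :: (m', none) :: (m, some true) :: t) i j) := by
  set w : TWord := s ++ (m, none) :: (m', none) :: (m, some true) :: t with hw
  set b := letters M w with hb
  have hlen : b.length = s.length + t.length + 3 := by
    rw [hb, length_letters, hw]; simp; omega
  let c := crossing b s.length (by omega)
  let d := crossing b (s.length + 1) (by omega)
  have hcd : c ≠ d := fun h => by
    have : s.length = s.length + 1 := congrArg Fin.val h
    omega
  have hU : tags w (s.length + 2) = some true := tags_mid_two
  have hk : letterAt b s.length = m := letterAt_mid.trans (min_eq_left hm)
  have hk1 : letterAt b (s.length + 1) = m' := letterAt_mid_one.trans (min_eq_left hm')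
  have hk2 : letterAt b (s.length + 2) = m := letterAt_mid_two.trans (min_eq_left hm)
  -- The bigon appears when the outer letter is 1-resolved and the middle one is 0-resolved.
  -- Eliminating it leaves the outer letter deleted and the middle one turned into a turnback.
  have h := (good_braidClosure (M + 2) b).slide_circle (a := c) (b := d)
    (τ := tagged (M + 2) b (tags w))
    (O := {x | coord x ∈ bigon s.length (s.length + 2) m}) tags_mid tags_mid_one hcd ?_ ?_ ?_ ?_ i j
  · rw [update_tagged (s := s) (c := c) rfl,
      show s ++ (m, some false) :: (m', none) :: (m, some true) :: t =
        (s ++ [(m, some false)]) ++ (m', none) :: (m, some true) :: t by simp,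
      update_tagged (c := d) (by simp; rfl)] at h
    have h1 := whom_of_letters
      (w := (s ++ [(m, some false)]) ++ (m', some true) :: (m, some true) :: t) (b := b)
      (by simp [letters, hb, hw]) i j
    have h2 := whom_insert (M := M) s ((m', some true) :: (m, some true) :: t) m i j
    rw [show s ++ (m, some false) :: (m', some true) :: (m, some true) :: t =
        (s ++ [(m, some false)]) ++ (m', some true) :: (m, some true) :: t by simp] at h2
    exact ⟨(h2.some.trans h1.some).trans h.some⟩
  · intro ε hε hεc hεd
    refine isCircle_bigon (by omega) (by omega) hk hk2 ?_ (fits_extend hε (by omega) hU)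
      (fun l h1 h2 => ?_)
    · rw [extend_of_lt (n := (braidClosure (M + 2) b).n) (l := s.length)
        (show s.length < b.length by omega)]
      exact hεc
    · obtain rfl : l = s.length + 1 := by omega
      rw [extend_of_lt (n := (braidClosure (M + 2) b).n) (l := s.length + 1)
        (show s.length + 1 < b.length by omega)]
      exact hεd
  · rw [nw_mem, sw_mem, mem_bigon, mem_bigon]
    show s.length < s.length ∧ _ ↔ ¬ (s.length < s.length + 1 ∧ s.length + 1 ≤ s.length + 2 ∧
      (letterAt b s.length = _ ∨ letterAt b s.length = _))
    rw [hk]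
    simp
  · rw [nw_mem, ne_mem, mem_bigon, mem_bigon]
    show (s.length < s.length + 1 ∧ s.length + 1 ≤ s.length + 2 ∧
      (letterAt b (s.length + 1) = m ∨ letterAt b (s.length + 1) = m + 1)) ↔
      ¬ (s.length < s.length + 1 ∧ s.length + 1 ≤ s.length + 2 ∧
      (letterAt b (s.length + 1) + 1 = m ∨ letterAt b (s.length + 1) + 1 = m + 1))
    rw [hk1]
    omega
  · intro x hx hxc hxd
    have h1 : (x : ℕ) ≠ s.length := fun h => hxc (Fin.ext h)
    have h2 : (x : ℕ) ≠ s.length + 1 := fun h => hxd (Fin.ext h)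
    have h3 := free_ne hx hU
    rw [nw_mem, ne_mem, mem_bigon, mem_bigon]
    omega

/-- Two crossings below a turnback slide off, leaving two adjacent turnbacks. -/
theorem whom_slide_up (s t : TWord) {m m' : ℕ} (hm : m ≤ M) (hm' : m' ≤ M)
    (hadj : m' = m + 1 ∨ m = m' + 1) (i j : ℤ) :
    Nonempty (WHom M (s ++ (m, some true) :: (m', some true) :: t) i j ≃ₗ[ℤ]
      WHom M (s ++ (m, some true) :: (m', none) :: (m, none) :: t) i j) := by
  set w : TWord := s ++ (m, some true) :: (m', none) :: (m, none) :: t with hw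
  set b := letters M w with hb
  have hlen : b.length = s.length + t.length + 3 := by
    rw [hb, length_letters, hw]; simp; omega
  -- In the mirrored situation the fixed turnback is on top, so the splitting letter is the lowest
  -- of the three.
  let c := crossing b (s.length + 2) (by omega)
  let d := crossing b (s.length + 1) (by omega)
  have hcd : c ≠ d := fun h => by
    have : s.length + 2 = s.length + 1 := congrArg Fin.val h
    omega
  have hU : tags w s.length = some true := tags_mid
  have hk : letterAt b s.length = m := letterAt_mid.trans (min_eq_left hm)
  have hk1 : letterAt b (s.length + 1) = m' := letterAt_mid_one.trans (min_eq_left hm')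
  have hk2 : letterAt b (s.length + 2) = m := letterAt_mid_two.trans (min_eq_left hm)
  have h := (good_braidClosure (M + 2) b).slide_circle (a := c) (b := d)
    (τ := tagged (M + 2) b (tags w))
    (O := {x | coord x ∈ bigon s.length (s.length + 2) m}) tags_mid_two tags_mid_one hcd ?_ ?_ ?_ ?_
    i j
  · rw [show w = (s ++ [(m, some true), (m', none)]) ++ (m, none) :: t by simp [hw],
      update_tagged (c := c) (by simp; rfl),
      show (s ++ [(m, some true), (m', none)]) ++ (m, some false) :: t =
        (s ++ [(m, some true)]) ++ (m', none) :: (m, some false) :: t by simp,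
      update_tagged (c := d) (by simp; rfl)] at h
    have h1 := whom_of_letters
      (w := (s ++ [(m, some true)]) ++ (m', some true) :: (m, some false) :: t) (b := b)
      (by simp [letters, hb, hw]) i j
    have h2 := whom_insert (M := M) (s ++ [(m, some true), (m', some true)]) t m i j
    rw [show (s ++ [(m, some true), (m', some true)]) ++ t =
        s ++ (m, some true) :: (m', some true) :: t by simp,
      show (s ++ [(m, some true), (m', some true)]) ++ (m, some false) :: t =
        (s ++ [(m, some true)]) ++ (m', some true) :: (m, some false) :: t by simp] at h2
    have h3 : Nonempty (WHom M (s ++ (m, some true) :: (m', some true) :: t) i j ≃ₗ[ℤ]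
        FaceHom (M + 2) b (tags ((s ++ [(m, some true), (m', none)]) ++ (m, none) :: t)) i j) :=
      ⟨(h2.some.trans h1.some).trans h.some⟩
    rwa [show (s ++ [(m, some true), (m', none)]) ++ (m, none) :: t = w by simp [hw]] at h3
  · intro ε hε hεc hεd
    refine isCircle_bigon (by omega) (by omega) hk hk2 (fits_extend hε (by omega) hU) ?_
      (fun l h1 h2 => ?_)
    · rw [extend_of_lt (n := (braidClosure (M + 2) b).n) (l := s.length + 2)
        (show s.length + 2 < b.length by omega)]
      exact hεc
    · obtain rfl : l = s.length + 1 := by omega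
      rw [extend_of_lt (n := (braidClosure (M + 2) b).n) (l := s.length + 1)
        (show s.length + 1 < b.length by omega)]
      exact hεd
  · rw [nw_mem, sw_mem, mem_bigon, mem_bigon]
    show (s.length < s.length + 2 ∧ s.length + 2 ≤ s.length + 2 ∧
      (letterAt b (s.length + 2) = _ ∨ letterAt b (s.length + 2) = _)) ↔
      ¬ (s.length < s.length + 2 + 1 ∧ s.length + 2 + 1 ≤ s.length + 2 ∧ _)
    rw [hk2]
    simp
  · rw [nw_mem, ne_mem, mem_bigon, mem_bigon]
    show (s.length < s.length + 1 ∧ s.length + 1 ≤ s.length + 2 ∧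
      (letterAt b (s.length + 1) = m ∨ letterAt b (s.length + 1) = m + 1)) ↔
      ¬ (s.length < s.length + 1 ∧ s.length + 1 ≤ s.length + 2 ∧
      (letterAt b (s.length + 1) + 1 = m ∨ letterAt b (s.length + 1) + 1 = m + 1))
    rw [hk1]
    omega
  · intro x hx hxc hxd
    have h1 : (x : ℕ) ≠ s.length + 2 := fun h => hxc (Fin.ext h)
    have h2 : (x : ℕ) ≠ s.length + 1 := fun h => hxd (Fin.ext h)
    have h3 := free_ne hx hU
    rw [nw_mem, ne_mem, mem_bigon, mem_bigon]
    omega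

/-- If the word with a letter resolved to `1` has no homology in two adjacent degrees, the letter
may be deleted. -/
theorem whom_resolve_zero (s t : TWord) (m : ℕ) {i j : ℤ}
    (h0 : Subsingleton (WHom M (s ++ (m, some true) :: t) i j))
    (h1 : Subsingleton (WHom M (s ++ (m, some true) :: t) (i + 1) j)) :
    Nonempty (WHom M (s ++ (m, none) :: t) i j ≃ₗ[ℤ] WHom M (s ++ t) i j) := by
  set b := letters M (s ++ (m, none) :: t) with hb
  have hlen : b.length = s.length + t.length + 1 := by
    rw [hb, length_letters]; simp; omega
  let c := crossing b s.length (by omega)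
  have e1 := whom_of_letters (w := s ++ (m, some true) :: t) (b := b)
    (letters_tag _ _ _ _ _)
  have e0 := whom_of_letters (w := s ++ (m, some false) :: t) (b := b)
    (letters_tag _ _ _ _ _) i j
  have h := (good_braidClosure (M + 2) b).resolve_zero (c := c)
    (τ := tagged (M + 2) b (tags (s ++ (m, none) :: t))) tags_mid (i := i) (j := j)
  rw [update_tagged (s := s) (c := c) rfl, update_tagged (s := s) (c := c) rfl] at h
  exact ⟨(h ((e1 i j).some.symm.toEquiv.subsingleton)
    ((e1 (i + 1) j).some.symm.toEquiv.subsingleton)).some.trans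
    (e0.some.symm.trans (whom_insert s t m i j).some.symm)⟩

theorem whom_subsingleton_of_resolve (s t : TWord) (m : ℕ) {i j : ℤ}
    (h0 : Subsingleton (WHom M (s ++ t) i j))
    (h1 : Subsingleton (WHom M (s ++ (m, some true) :: t) i j)) :
    Subsingleton (WHom M (s ++ (m, none) :: t) i j) := by
  set b := letters M (s ++ (m, none) :: t) with hb
  have hlen : b.length = s.length + t.length + 1 := by
    rw [hb, length_letters]; simp; omega
  let c := crossing b s.length (by omega)
  have e1 := whom_of_letters (w := s ++ (m, some true) :: t) (b := b)
    (letters_tag _ _ _ _ _) i j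
  have e0 := whom_of_letters (w := s ++ (m, some false) :: t) (b := b)
    (letters_tag _ _ _ _ _) i j
  have h := (good_braidClosure (M + 2) b).subsingleton_of_resolve (c := c)
    (τ := tagged (M + 2) b (tags (s ++ (m, none) :: t))) tags_mid (i := i) (j := j)
  rw [update_tagged (s := s) (c := c) rfl, update_tagged (s := s) (c := c) rfl] at h
  exact h ((e0.some.symm.trans (whom_insert s t m i j).some.symm).toEquiv.subsingleton)
    e1.some.symm.toEquiv.subsingleton

end Khovanov

/-! ### Vanishing ranges for words with turnbacks -/

namespace Khovanov

variable {M : ℕ} {s t w : TWord} {μ ν : ℤ}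

/-- The height of a resolution is at least the number of crossings fixed at 1, so there are no
chains in these degrees. -/
theorem subsingleton_whom_of_lt {i j : ℤ} (h : i < tagOnes w) : Subsingleton (WHom M w i j) := by
  rw [Based.subsingleton_hom_iff]
  rintro f ⟨hf, -⟩
  have : f = 0 := by
    ext x
    by_contra hx
    obtain ⟨h1, h2, -⟩ := hf x hx
    have h3 := Diagram.height_eq_ones_add (D := braidClosure (M + 2) (letters M w))
      (Diagram.mem_face.1 h1)
    rw [ones_tags] at h3
    have h4 : ((braidClosure (M + 2) (letters M w)).height x.1 : ℤ) = i := h2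
    omega
  rw [this]
  exact Submodule.zero_mem _

/-- The homology of a tagged word vanishes in relative homological degrees below `μ`. -/
def Vanishes (M : ℕ) (w : TWord) (μ : ℤ) : Prop :=
  ∀ i j, i < μ → Subsingleton (WHom M w (i + tagOnes w) j)

theorem Vanishes.mono (h : Vanishes M w μ) (hν : ν ≤ μ) : Vanishes M w ν :=
  fun i j hi => h i j (by omega)

theorem vanishes_of_nonpos (h : μ ≤ 0) : Vanishes M w μ :=
  fun i j hi => subsingleton_whom_of_lt (by omega)

theorem vanishes_congr {w' : TWord} (h : tagOnes w = tagOnes w')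
    (e : ∀ i j, Nonempty (WHom M w i j ≃ₗ[ℤ] WHom M w' i j)) :
    Vanishes M w μ ↔ Vanishes M w' μ := by
  constructor
  · intro hv i j hi
    rw [← h]
    have := hv i j hi
    exact (e _ _).some.symm.toEquiv.subsingleton
  · intro hv i j hi
    rw [h]
    have := hv i j hi
    exact (e _ _).some.toEquiv.subsingleton

theorem vanishes_rotate (s t : TWord) : Vanishes M (s ++ t) μ ↔ Vanishes M (t ++ s) μ := by
  induction s generalizing t with
  | nil => simp
  | cons a s ih =>
    rw [show t ++ a :: s = (t ++ [a]) ++ s by simp, ← ih (t ++ [a])]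
    rw [show s ++ (t ++ [a]) = (s ++ t) ++ [a] by simp]
    refine vanishes_congr ?_ (whom_rotate a (s ++ t))
    rw [List.cons_append, tagOnes_cons, tagOnes_append (t := [a]), tagOnes_cons]
    simp [tagOnes, add_comm]

theorem vanishes_swap {a a' : ℕ × Option Bool} (ha : a.1 ≤ M) (ha' : a'.1 ≤ M)
    (hfar : a.1 + 1 < a'.1 ∨ a'.1 + 1 < a.1) :
    Vanishes M (s ++ a :: a' :: t) μ ↔ Vanishes M (s ++ a' :: a :: t) μ := by
  refine vanishes_congr ?_ (whom_swap s t ha ha' hfar)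
  simp only [tagOnes_append, tagOnes_cons]
  omega

/-- A letter may be moved past distant letters. -/
theorem vanishes_move {u : ℕ × Option Bool} (hu : u.1 ≤ M) (r : TWord)
    (hr : ∀ a ∈ r, a.1 ≤ M ∧ (a.1 + 1 < u.1 ∨ u.1 + 1 < a.1)) :
    Vanishes M (s ++ (r ++ u :: t)) μ ↔ Vanishes M (s ++ u :: (r ++ t)) μ := by
  induction r generalizing s with
  | nil => simp
  | cons a r ih =>
    have h1 := hr a (by simp)
    rw [show s ++ (a :: r ++ u :: t) = (s ++ [a]) ++ (r ++ u :: t) by simp,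
      ih (fun a' ha' => hr a' (by simp [ha'])),
      show (s ++ [a]) ++ u :: (r ++ t) = s ++ a :: u :: (r ++ t) by simp,
      vanishes_swap h1.1 hu h1.2]
    simp

/-- Absorbing shifts the homological degree by one and keeps the number of turnbacks, so the range
improves by one. -/
theorem Vanishes.absorb {m : ℕ} (h : Vanishes M (s ++ (m, some true) :: t) μ) :
    Vanishes M (s ++ (m, none) :: (m, some true) :: t) (μ + 1) := by
  intro i j hi
  have h1 : tagOnes (s ++ (m, none) :: (m, some true) :: t) =
      tagOnes (s ++ (m, some true) :: t) := by
    simp [tagOnes_append, tagOnes_cons]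
  have := h (i - 1) (j - 2) (by omega)
  have e := (whom_absorb (M := M) s t m (i - 1 + tagOnes (s ++ (m, some true) :: t)) (j - 2)).some
  rw [show i - 1 + (tagOnes (s ++ (m, some true) :: t) : ℤ) + 1 =
    i + tagOnes (s ++ (m, none) :: (m, some true) :: t) by rw [h1]; ring,
    show j - 2 + 2 = j by ring] at e
  exact e.symm.toEquiv.subsingleton

/-- Sliding preserves the homological degree while the number of turnbacks rises by one, which is
the shift of the relative range. -/
theorem vanishes_slide_down {m m' : ℕ} (hm : m ≤ M) (hm' : m' ≤ M)
    (hadj : m' = m + 1 ∨ m = m' + 1) :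
    Vanishes M (s ++ (m, none) :: (m', none) :: (m, some true) :: t) (μ + 1) ↔
      Vanishes M (s ++ (m', some true) :: (m, some true) :: t) μ := by
  have h1 : tagOnes (s ++ (m', some true) :: (m, some true) :: t) =
      tagOnes (s ++ (m, none) :: (m', none) :: (m, some true) :: t) + 1 := by
    simp [tagOnes_append, tagOnes_cons]; omega
  constructor
  · intro h i j hi
    have e := (whom_slide_down (M := M) s t hm hm' hadj
      (i + tagOnes (s ++ (m', some true) :: (m, some true) :: t)) j).some
    have := h (i + 1) j (by omega)
    rw [show i + 1 + (tagOnes (s ++ (m, none) :: (m', none) :: (m, some true) :: t) : ℤ) =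
      i + tagOnes (s ++ (m', some true) :: (m, some true) :: t) by rw [h1]; push_cast; ring] at this
    exact e.toEquiv.subsingleton
  · intro h i j hi
    have e := (whom_slide_down (M := M) s t hm hm' hadj
      (i + tagOnes (s ++ (m, none) :: (m', none) :: (m, some true) :: t)) j).some
    have := h (i - 1) j (by omega)
    rw [show i - 1 + (tagOnes (s ++ (m', some true) :: (m, some true) :: t) : ℤ) =
      i + tagOnes (s ++ (m, none) :: (m', none) :: (m, some true) :: t) by
        rw [h1]; push_cast; ring] at this
    exact e.symm.toEquiv.subsingleton

theorem vanishes_slide_up {m m' : ℕ} (hm : m ≤ M) (hm' : m' ≤ M)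
    (hadj : m' = m + 1 ∨ m = m' + 1) :
    Vanishes M (s ++ (m, some true) :: (m', none) :: (m, none) :: t) (μ + 1) ↔
      Vanishes M (s ++ (m, some true) :: (m', some true) :: t) μ := by
  have h1 : tagOnes (s ++ (m, some true) :: (m', some true) :: t) =
      tagOnes (s ++ (m, some true) :: (m', none) :: (m, none) :: t) + 1 := by
    simp [tagOnes_append, tagOnes_cons]; omega
  constructor
  · intro h i j hi
    have e := (whom_slide_up (M := M) s t hm hm' hadj
      (i + tagOnes (s ++ (m, some true) :: (m', some true) :: t)) j).some
    have := h (i + 1) j (by omega)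
    rw [show i + 1 + (tagOnes (s ++ (m, some true) :: (m', none) :: (m, none) :: t) : ℤ) =
      i + tagOnes (s ++ (m, some true) :: (m', some true) :: t) by rw [h1]; push_cast; ring] at this
    exact e.toEquiv.subsingleton
  · intro h i j hi
    have e := (whom_slide_up (M := M) s t hm hm' hadj
      (i + tagOnes (s ++ (m, some true) :: (m', none) :: (m, none) :: t)) j).some
    have := h (i - 1) j (by omega)
    rw [show i - 1 + (tagOnes (s ++ (m, some true) :: (m', some true) :: t) : ℤ) =
      i + tagOnes (s ++ (m, some true) :: (m', none) :: (m, none) :: t) by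
        rw [h1]; push_cast; ring] at this
    exact e.symm.toEquiv.subsingleton

/-- The word with the letter 1-resolved has one more turnback, so its hypothesis reaches one
absolute degree further than necessary. -/
theorem Vanishes.of_resolve {m : ℕ} (h : Vanishes M (s ++ t) μ)
    (h' : Vanishes M (s ++ (m, some true) :: t) μ) : Vanishes M (s ++ (m, none) :: t) μ := by
  intro i j hi
  have h1 : tagOnes (s ++ (m, none) :: t) = tagOnes (s ++ t) := by
    simp [tagOnes_append, tagOnes_cons]
  have h2 : tagOnes (s ++ (m, some true) :: t) = tagOnes (s ++ t) + 1 := by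
    simp [tagOnes_append, tagOnes_cons]; omega
  rw [h1]
  refine whom_subsingleton_of_resolve s t m (h i j hi) ?_
  have := h' (i - 1) j (by omega)
  rwa [show i - 1 + (tagOnes (s ++ (m, some true) :: t) : ℤ) = i + tagOnes (s ++ t) by
    rw [h2]; push_cast; ring] at this

/-- The word `σ_1 ⋯ σ_n`. -/
def staircase (n : ℕ) : TWord := (List.range n).map fun k => (k, none)

theorem staircase_succ (n : ℕ) : staircase (n + 1) = staircase n ++ [(n, none)] := by
  simp [staircase, List.range_succ]

theorem mem_staircase {n : ℕ} {a : ℕ × Option Bool} (h : a ∈ staircase n) :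
    a.1 < n ∧ a.2 = none := by
  simp only [staircase, List.mem_map, List.mem_range] at h
  obtain ⟨k, hk, rfl⟩ := h
  exact ⟨hk, rfl⟩

theorem staircase_split {n k : ℕ} (h : k + 1 < n) : ∃ r : TWord,
    staircase n = staircase k ++ (k, none) :: (k + 1, none) :: r ∧ ∀ a ∈ r, k + 1 < a.1 ∧ a.1 < n := by
  induction n, h using Nat.le_induction with
  | base => exact ⟨[], by rw [staircase_succ, staircase_succ]; simp, by simp⟩
  | succ n hn ih =>
    obtain ⟨r, h1, h2⟩ := ih
    refine ⟨r ++ [(n, none)], by rw [staircase_succ, h1]; simp, fun a ha => ?_⟩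
    rw [List.mem_append, List.mem_singleton] at ha
    rcases ha with ha | rfl
    · exact ⟨(h2 a ha).1, by have := (h2 a ha).2; omega⟩
    · exact ⟨by simp only; omega, by simp⟩

/-- A staircase followed by a turnback that is not in its last position. -/
theorem vanishes_staircase_turnback {n k : ℕ} (hk : k + 1 < n) (hn : n ≤ M + 1) : ∃ r : TWord,
    staircase n = staircase k ++ (k, none) :: (k + 1, none) :: r ∧
    ∀ s t μ, Vanishes M (s ++ (staircase n ++ (k, some true) :: t)) (μ + 1) ↔
      Vanishes M (s ++ (staircase k ++ (k + 1, some true) :: (k, some true) :: (r ++ t))) μ := by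
  obtain ⟨r, h1, h2⟩ := staircase_split hk
  refine ⟨r, h1, fun s t μ => ?_⟩
  rw [h1, show s ++ (staircase k ++ (k, none) :: (k + 1, none) :: r ++ (k, some true) :: t) =
    (s ++ (staircase k ++ [(k, none), (k + 1, none)])) ++ (r ++ (k, some true) :: t) by simp,
    vanishes_move (by simp only; omega) r (fun a ha => by have := h2 a ha; simp only; omega),
    show (s ++ (staircase k ++ [(k, none), (k + 1, none)])) ++ (k, some true) :: (r ++ t) =
    (s ++ staircase k) ++ (k, none) :: (k + 1, none) :: (k, some true) :: (r ++ t) by simp,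
    vanishes_slide_down (by omega) (by omega) (Or.inl rfl)]
  simp

/-- A turnback may be pushed through a full staircase. -/
theorem vanishes_push {k : ℕ} (hk : k < M) :
    Vanishes M (s ++ (staircase (M + 1) ++ (k, some true) :: t)) μ ↔
      Vanishes M (s ++ (k + 1, some true) :: (staircase (M + 1) ++ t)) μ := by
  obtain ⟨r, h1, h2⟩ := vanishes_staircase_turnback (M := M) (n := M + 1) (k := k) (by omega) le_rfl
  -- Both words reduce to the one with the adjacent turnbacks U_{k+1} U_k. Sliding down on one side
  -- and sliding up on the other change the range equally.
  rw [show μ = (μ - 1) + 1 by ring, h2, h1,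
    show s ++ (k + 1, some true) :: ((staircase k ++ (k, none) :: (k + 1, none) :: r) ++ t) =
      s ++ (k + 1, some true) :: (staircase k ++ (k, none) :: (k + 1, none) :: (r ++ t)) by simp,
    ← vanishes_move (by simp only; omega) (staircase k) (fun a ha => by
      have := (mem_staircase ha).1; simp only; omega),
    show s ++ (staircase k ++ (k + 1, some true) :: (k, none) :: (k + 1, none) :: (r ++ t)) =
      (s ++ staircase k) ++ (k + 1, some true) :: (k, none) :: (k + 1, none) :: (r ++ t) by simp,
    vanishes_slide_up (by omega) (by omega) (Or.inr rfl)]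
  simp

/-- The word of turnbacks `U_1 ⋯ U_n`. -/
def turnbacks (n : ℕ) : TWord := (List.range n).map fun k => (k, some true)

theorem turnbacks_succ (n : ℕ) : turnbacks (n + 1) = turnbacks n ++ [(n, some true)] := by
  simp [turnbacks, List.range_succ]

theorem turnbacks_succ_eq_cons (n : ℕ) : ∃ t, turnbacks (n + 1) = (0, some true) :: t := by
  exact ⟨_, by rw [turnbacks, List.range_succ_eq_map]; rfl⟩

/-- Two staircases absorbed by a turnback. -/
theorem Vanishes.two_staircases {n : ℕ} (hn : n ≤ M)
    (h : Vanishes M (s ++ (turnbacks (n + 1) ++ t)) μ) :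
    Vanishes M (s ++ (staircase (n + 1) ++ (staircase n ++ (n, some true) :: t)))
      (μ + (n + 1 : ℕ)) := by
  induction n generalizing t μ with
  | zero =>
    have := Vanishes.absorb (M := M) (s := s) (t := t) (m := 0) (μ := μ) (by simpa [turnbacks] using h)
    simpa [staircase] using this
  | succ n ih =>
    rw [turnbacks_succ, List.append_assoc, List.singleton_append] at h
    have h1 := ih (by omega) h
    have h2 := (vanishes_slide_down (M := M) (s := s ++ (staircase (n + 1) ++ staircase n)) (t := t)
      (m := n + 1) (m' := n) (by omega) (by omega) (Or.inr rfl)).2 (by simpa using h1)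
    have h3 : (s ++ (staircase (n + 1) ++ staircase n)) ++ (n + 1, none) :: (n, none) ::
        (n + 1, some true) :: t = (s ++ staircase (n + 1)) ++ (staircase n ++ (n + 1, none) ::
        (n, none) :: (n + 1, some true) :: t) := by simp
    -- The last letter σ_{n+1} of the first staircase commutes past σ_0 ⋯ σ_{n-1}, so that it stands
    -- next to σ_n and the pair slides off U_{n+1}, leaving U_n for the induction.
    rw [h3, vanishes_move (by simp only; omega) (staircase n) (fun a ha => by
      have := (mem_staircase ha).1; simp only; omega)] at h2
    rw [show (μ + (n + 1 + 1 : ℕ) : ℤ) = μ + (n + 1 : ℕ) + 1 by push_cast; ring,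
      staircase_succ (n + 1), staircase_succ n]
    rw [staircase_succ n] at h2
    simpa using h2

/-- Every word that continues `s` by a turnback in a position below `L` has vanishing homology in
relative degrees below `μ`. -/
def TurnVanishes (M L : ℕ) (s : TWord) (μ : ℤ) : Prop :=
  ∀ k < L, ∀ t, Vanishes M (s ++ (k, some true) :: t) μ

theorem turnVanishes_nil {L : ℕ} : TurnVanishes M L s 0 :=
  fun _ _ _ => vanishes_of_nonpos le_rfl

variable {L : ℕ}

/-- Resolve the added letter. In either resolution `s` is directly followed by a turnback in a
position below `L`: the given one, or the one created by the letter. -/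
theorem TurnVanishes.letter (h : TurnVanishes M L s μ) {k : ℕ} (hk : k < L) :
    TurnVanishes M L (s ++ [(k, none)]) μ := by
  intro m hm t
  rw [List.append_assoc, List.singleton_append]
  exact (h m hm t).of_resolve (h k hk _)

theorem TurnVanishes.letters (h : TurnVanishes M L s μ) (r : TWord)
    (hr : ∀ a ∈ r, a.1 < L ∧ a.2 = none) : TurnVanishes M L (s ++ r) μ := by
  induction r generalizing s with
  | nil => simpa using h
  | cons a r ih =>
    obtain ⟨k, v⟩ := a
    obtain ⟨h1, rfl⟩ := hr _ (List.mem_cons_self)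
    have := ih (h.letter h1) (fun a ha => hr a (List.mem_cons_of_mem _ ha))
    simpa using this

/-- The turnback at `k` pulls σ_k σ_{k+1} off the staircase and leaves a turnback at `k + 1` behind
σ_0 ⋯ σ_{k-1}. That position must still be below `L`, and the slide gains one degree. -/
theorem TurnVanishes.staircase_aux (h : TurnVanishes M L s μ) {n k : ℕ} (hk : k + 1 < n)
    (hn : n ≤ M + 1) (hkL : k + 1 < L) :
    Vanishes M (s ++ (staircase n ++ (k, some true) :: t)) (μ + 1) := by
  obtain ⟨r, -, h2⟩ := vanishes_staircase_turnback hk hn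
  rw [h2, ← List.append_assoc]
  exact h.letters (staircase k)
    (fun a ha => ⟨by have := (mem_staircase ha).1; omega, (mem_staircase ha).2⟩) _ hkL _

/-- A turnback in the last position of the staircase absorbs the final letter; in all other
positions a pair of letters slides off. Both cases gain one degree. -/
theorem TurnVanishes.staircase (h : TurnVanishes M L s μ) (hL : L ≤ M + 1) :
    TurnVanishes M L (s ++ staircase L) (μ + 1) := by
  intro k hk t
  by_cases hkL : k + 1 < L
  · rw [List.append_assoc]
    exact h.staircase_aux hkL hL hkL
  · obtain rfl : L = k + 1 := by omega
    rw [staircase_succ, List.append_assoc, List.append_assoc, List.singleton_append,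
      ← List.append_assoc]
    exact (h.letters (Khovanov.staircase k)
      (fun a ha => ⟨by have := (mem_staircase ha).1; omega, (mem_staircase ha).2⟩) _ hk _).absorb

/-- If the staircase is longer than the range of allowed positions, sliding raises the position of
the turnback by one, so one position is lost for each degree gained. -/
theorem TurnVanishes.full_staircase (h : TurnVanishes M (L + 1) s μ) (hL : L ≤ M) :
    TurnVanishes M L (s ++ Khovanov.staircase (M + 1)) (μ + 1) := by
  intro k hk t
  rw [List.append_assoc]
  exact h.staircase_aux (by omega) le_rfl (by omega)

/-- Powers of a word. -/
def wpow (a : ℕ) (w : TWord) : TWord := (List.replicate a w).flatten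

theorem wpow_zero : wpow 0 w = [] := rfl

theorem wpow_succ (a : ℕ) : wpow (a + 1) w = w ++ wpow a w := by
  simp [wpow, List.replicate_succ]

theorem wpow_succ' (a : ℕ) : wpow (a + 1) w = wpow a w ++ w := by
  simp [wpow, List.replicate_succ']

theorem wpow_add (a b : ℕ) : wpow (a + b) w = wpow a w ++ wpow b w := by
  rw [wpow, ← List.replicate_append_replicate, List.flatten_append]; rfl

theorem TurnVanishes.staircases (h : TurnVanishes M L s μ) (hL : L ≤ M + 1) (a : ℕ) :
    TurnVanishes M L (s ++ wpow a (Khovanov.staircase L)) (μ + a) := by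
  induction a with
  | zero => simpa [wpow] using h
  | succ a ih =>
    rw [wpow_succ', ← List.append_assoc,
      show (μ + (a + 1 : ℕ) : ℤ) = μ + a + 1 by push_cast; ring]
    exact ih.staircase hL

theorem TurnVanishes.full_staircases (a : ℕ) (h : TurnVanishes M (L + a) s μ) (hL : L + a ≤ M + 1) :
    TurnVanishes M L (s ++ wpow a (Khovanov.staircase (M + 1))) (μ + a) := by
  induction a generalizing L with
  | zero => simpa [wpow] using h
  | succ a ih =>
    rw [wpow_succ', ← List.append_assoc,
      show (μ + (a + 1 : ℕ) : ℤ) = μ + a + 1 by push_cast; ring]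
    refine TurnVanishes.full_staircase (ih (L := L + 1) ?_ (by omega)) (by omega)
    rwa [show L + 1 + a = L + (a + 1) by omega]

/-- Each full staircase that the turnback passes moves it one column to the right, without changing
the range. -/
theorem vanishes_push_pow {k : ℕ} (c : ℕ) (hk : k + c ≤ M) :
    Vanishes M (s ++ (wpow c (staircase (M + 1)) ++ (k, some true) :: t)) μ ↔
      Vanishes M (s ++ (k + c, some true) :: (wpow c (staircase (M + 1)) ++ t)) μ := by
  induction c generalizing k t with
  | zero => simp [wpow]
  | succ c ih =>
    rw [wpow_succ', show s ++ (wpow c (staircase (M + 1)) ++ staircase (M + 1) ++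
      (k, some true) :: t) = (s ++ wpow c (staircase (M + 1))) ++ (staircase (M + 1) ++
        (k, some true) :: t) by simp, vanishes_push (by omega),
      show (s ++ wpow c (staircase (M + 1))) ++ (k + 1, some true) :: (staircase (M + 1) ++ t) =
        s ++ (wpow c (staircase (M + 1)) ++ (k + 1, some true) :: (staircase (M + 1) ++ t)) by simp,
      ih (by omega), show k + 1 + c = k + (c + 1) by omega]
    simp

/-- The vanishing behind the comparison of `D_{p,q}` and `D_{p,q-1}`. -/
theorem vanishes_last_block {a k : ℕ} (ha : M + 2 ≤ a) (hk : k ≤ M) (r : TWord)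
    (hr : ∀ x ∈ r, x.1 ≤ M ∧ x.2 = none) :
    Vanishes M (wpow a (staircase (M + 1)) ++ (k, some true) :: r) (M + a) := by
  obtain ⟨c, hc⟩ : ∃ c, c + k = M := ⟨M - k, by omega⟩
  -- `c` staircases bring the turnback to position `M`, two are consumed by `two_staircases` and one
  -- absorption, and `d` remain; `M + 2 ≤ a` ensures that there are enough.
  obtain ⟨d, rfl⟩ : ∃ d, a = d + 2 + c := ⟨a - 2 - c, by omega⟩
  rw [wpow_add, List.append_assoc, vanishes_push_pow c (by omega), show k + c = M by omega,
    wpow_succ', wpow_succ',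
    show (M + (d + 2 + c : ℕ) : ℤ) = ((d + c : ℕ) + (M + 1 : ℕ)) + 1 by push_cast; ring]
  -- After a rotation the turnbacks come last, and each of the remaining `c + d` staircases in front
  -- of U_0 gains one degree. The letters of `r` do no harm.
  have hT : Vanishes M (wpow d (staircase (M + 1)) ++ (turnbacks (M + 1) ++
      (wpow c (staircase (M + 1)) ++ r))) (d + c : ℕ) := by
    rw [vanishes_rotate]
    obtain ⟨u, hu⟩ := turnbacks_succ_eq_cons M
    rw [show (turnbacks (M + 1) ++ (wpow c (staircase (M + 1)) ++ r)) ++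
      wpow d (staircase (M + 1)) = turnbacks (M + 1) ++ (wpow c (staircase (M + 1)) ++ r ++
      wpow d (staircase (M + 1))) by simp, vanishes_rotate, hu]
    have h1 := (((turnVanishes_nil (M := M) (L := M + 1) (s := [])).staircases le_rfl c).letters r
      (fun x hx => ⟨by have := (hr x hx).1; omega, (hr x hx).2⟩)).staircases le_rfl d
    have h2 := h1 0 (Nat.succ_pos _) u
    rw [List.nil_append] at h2
    exact h2.mono (by push_cast; omega)
  -- This gains `M + 1` degrees; absorbing the letter σ_M next to U_M gains the last one.
  have h1 := hT.two_staircases le_rfl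
  have h2 := Vanishes.absorb (M := M) (m := M)
    (s := wpow d (staircase (M + 1)) ++ (staircase (M + 1) ++ staircase M))
    (t := wpow c (staircase (M + 1)) ++ r) (by simpa using h1)
  rw [show (wpow d (staircase (M + 1)) ++ staircase (M + 1) ++ staircase (M + 1) ++
      (M, some true) :: (wpow c (staircase (M + 1)) ++ r)) =
      (wpow d (staircase (M + 1)) ++ staircase (M + 1) ++ (staircase M ++ [(M, none)]) ++
      (M, some true) :: (wpow c (staircase (M + 1)) ++ r)) by rw [staircase_succ M]]
  simpa using h2

/-- The vanishing behind the comparison of `D_{p,p}` and `D_{p-1,p}`. -/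
theorem vanishes_short_blocks {a b : ℕ} (hab : a + b = M) :
    Vanishes M (wpow (a + 1) (staircase (M + 1)) ++ (staircase M ++ (M, some true) ::
      wpow b (staircase M))) (2 * M + 1) := by
  have hT : Vanishes M (wpow a (staircase (M + 1)) ++ (turnbacks (M + 1) ++ wpow b (staircase M)))
      M := by
    obtain ⟨u, hu⟩ := turnbacks_succ_eq_cons M
    rw [vanishes_rotate,
      show (turnbacks (M + 1) ++ wpow b (staircase M)) ++ wpow a (staircase (M + 1)) =
      turnbacks (M + 1) ++ (wpow b (staircase M) ++ wpow a (staircase (M + 1))) by simp,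
      vanishes_rotate, hu]
    -- The `a` full staircases shrink the admissible positions from `a + b` to `b`, which still
    -- contain 0 only if `b` is positive. For `b = 0` all staircases are full and no position is
    -- lost.
    rcases Nat.eq_zero_or_pos b with rfl | hb
    · have h1 := (turnVanishes_nil (M := M) (L := M + 1) (s := [])).staircases le_rfl a
      have h2 := h1 0 (Nat.succ_pos _) u
      rw [wpow_zero]
      exact h2.mono (by omega)
    · have h1 := (turnVanishes_nil (M := M) (L := b + a) (s := [])).staircases (by omega) b
      rw [List.nil_append] at h1
      have h2 := h1.full_staircases a (by omega) 0 hb u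
      rw [show b + a = M by omega] at h2
      exact h2.mono (by omega)
  have h1 := hT.two_staircases le_rfl
  rw [wpow_succ', show (2 * M + 1 : ℤ) = M + (M + 1 : ℕ) by push_cast; ring]
  simpa using h1

end Khovanov

/-! ### Homology of torus links -/

namespace Khovanov

section

variable {p : ℕ} {b : List (Fin (p - 1))}

/-- The extra set of a model is a single circle as soon as it meets the diagram; for a kink this is
the last strand. -/
theorem Model.isCircle {ε : Fin (braidClosure p b).n → Bool} {n q : ℕ} {k : ℕ → ℕ} {e : ℕ → Bool}
    {f r : ℕ × ℕ → ℕ × ℕ} {O : Set (ℕ × ℕ)}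
    (h : Model n q k e b.length p (letterAt b) (extend ε) f r O)
    (hne : ∃ a ∈ O, a.1 ≤ b.length ∧ a.2 < p) :
    (braidClosure p b).IsCircle ε {x | coord x ∈ O} := by
  obtain ⟨a, ha, h1, h2⟩ := hne
  refine ⟨⟨pt b a.1 a.2 h1 h2, ha⟩, fun x hx y => ?_⟩
  rw [circ_iff_conn]
  exact ⟨fun hy => h.single _ hy _ hx (coord_fst _) (coord_snd _) (coord_fst _) (coord_snd _),
    fun h' => (h.conn_back h').1.2 hx⟩

theorem nonempty_H_equiv_faceHom (p : ℕ) (b : List (Fin (p - 1))) (i j : ℤ) :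
    Nonempty ((braidClosure p b).H i j ≃ₗ[ℤ] FaceHom p b (fun _ => none) i j) := by
  have h := (good_braidClosure p b).nonempty_H_equiv i j
  have hset : (Set.univ : Set (braidClosure p b).based.B) =
      (braidClosure p b).face (tagged p b fun _ => none) := by
    ext x
    simp only [Set.mem_univ, true_iff]
    intro c v h
    simp [tagged] at h
  rwa [hset] at h

end

variable {M : ℕ} {s t w : TWord}

theorem tags_eq_none (hw : ∀ a ∈ w, a.2 = none) : tags w = fun _ => none := by
  funext l
  unfold tags
  cases h : w[l]? with
  | none => rfl
  | some a => exact hw a (List.mem_of_getElem? h)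

theorem mem_wpow {a : ℕ} {x : ℕ × Option Bool} (h : x ∈ wpow a w) : x ∈ w := by
  simp only [wpow, List.mem_flatten, List.mem_replicate] at h
  obtain ⟨l, ⟨-, rfl⟩, h⟩ := h
  exact h

theorem letters_wpow (a : ℕ) : letters M (wpow a w) = (List.replicate a (letters M w)).flatten := by
  simp only [letters, wpow, List.map_flatten, List.map_replicate]

theorem letters_staircase : letters M (staircase (M + 1)) = List.finRange (M + 2 - 1) := by
  refine List.ext_getElem ?_ fun l h h' => ?_
  · rw [length_letters]; simp [staircase]
  · rw [length_letters] at h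
    have : l < M + 1 := by simpa [staircase] using h
    apply Fin.ext
    simp [letters, staircase]
    omega

theorem nonempty_torus_equiv (M q : ℕ) (i j : ℤ) :
    Nonempty ((torusDiagram (M + 2) q).H i j ≃ₗ[ℤ] WHom M (wpow q (staircase (M + 1))) i j) := by
  have h := nonempty_H_equiv_faceHom (M + 2) (letters M (wpow q (staircase (M + 1)))) i j
  rw [← tags_eq_none (w := wpow q (staircase (M + 1)))
    (fun a ha => (mem_staircase (mem_wpow ha)).2)] at h
  have h2 : torusDiagram (M + 2) q =
      braidClosure (M + 2) (letters M (wpow q (staircase (M + 1)))) := by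
    rw [letters_wpow, letters_staircase]; rfl
  rw [h2]
  exact h

/-- Deleting a block of letters after many full staircases. -/
theorem whom_delete_block {a : ℕ} (ha : M + 2 ≤ a) (r : TWord)
    (hr : ∀ x ∈ r, x.1 ≤ M ∧ x.2 = none) {i : ℤ} (hi : i < M + a) (j : ℤ) :
    Nonempty (WHom M (wpow a (staircase (M + 1)) ++ r) i j ≃ₗ[ℤ]
      WHom M (wpow a (staircase (M + 1))) i j) := by
  induction r with
  | nil => rw [List.append_nil]; exact ⟨LinearEquiv.refl _ _⟩
  | cons x r ih =>
    obtain ⟨k, v⟩ := x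
    obtain ⟨hk, rfl⟩ := hr _ List.mem_cons_self
    have hr' : ∀ x ∈ r, x.1 ≤ M ∧ x.2 = none := fun x hx => hr x (List.mem_cons_of_mem _ hx)
    have hv := vanishes_last_block ha hk r hr'
    have ho : tagOnes (wpow a (staircase (M + 1)) ++ (k, some true) :: r) = 1 := by
      have h0 : ∀ w : TWord, (∀ x ∈ w, x.2 = none) → tagOnes w = 0 := by
        intro w hw
        simp only [tagOnes, List.sum_eq_zero_iff, List.mem_map]
        rintro _ ⟨x, hx, rfl⟩
        simp [hw x hx]
      rw [tagOnes_append, tagOnes_cons, h0 _ fun x hx => (mem_staircase (mem_wpow hx)).2,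
        h0 r fun x hx => (hr' x hx).2]
      rfl
    -- The word has one turnback, so the absolute degrees `i` and `i + 1` are the relative degrees
    -- `i - 1` and `i`.
    have h0 := hv (i - 1) j (by omega)
    have h1 := hv i j hi
    rw [ho] at h0 h1
    rw [show i - 1 + (1 : ℕ) = i by push_cast; ring] at h0
    exact ⟨(whom_resolve_zero _ r k h0 (by simpa using h1)).some.trans (ih hr').some⟩

theorem tagOnes_eq_zero (hw : ∀ x ∈ w, x.2 = none) : tagOnes w = 0 := by
  simp only [tagOnes, List.sum_eq_zero_iff, List.mem_map]
  rintro _ ⟨x, hx, rfl⟩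
  simp [hw x hx]

/-- Deleting the last letters of all but the first staircase. -/
theorem whom_shorten_blocks {b : ℕ} (hb : b ≤ M + 1) {i : ℤ} (hi : i < 2 * M + 1) (j : ℤ) :
    Nonempty (WHom M (wpow (M + 2) (staircase (M + 1))) i j ≃ₗ[ℤ]
      WHom M (wpow (M + 2 - b) (staircase (M + 1)) ++ wpow b (staircase M)) i j) := by
  induction b with
  | zero => rw [wpow_zero, List.append_nil]; exact ⟨LinearEquiv.refl _ _⟩
  | succ b ih =>
    obtain ⟨a, ha⟩ : ∃ a, a + b = M := ⟨M - b, by omega⟩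
    have e := (ih (by omega)).some
    have hv := vanishes_short_blocks ha
    have ho : tagOnes (wpow (a + 1) (staircase (M + 1)) ++ (staircase M ++ (M, some true) ::
      wpow b (staircase M))) = 1 := by
      rw [tagOnes_append, tagOnes_append, tagOnes_cons,
        tagOnes_eq_zero fun x hx => (mem_staircase (mem_wpow hx)).2,
        tagOnes_eq_zero fun x hx => (mem_staircase hx).2,
        tagOnes_eq_zero fun x hx => (mem_staircase (mem_wpow hx)).2]
      rfl
    have h0 := hv (i - 1) j (by omega)
    have h1 := hv i j hi
    rw [ho] at h0 h1
    rw [show i - 1 + (1 : ℕ) = i by push_cast; ring] at h0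
    rw [← List.append_assoc] at h0 h1
    have e2 := (whom_resolve_zero _ _ M h0 (by simpa using h1)).some
    -- The letter to delete is the last one of the last full staircase, in front of the blocks
    -- already shortened.
    have heq : wpow (a + 1 + 1) (staircase (M + 1)) ++ wpow b (staircase M) =
        (wpow (a + 1) (staircase (M + 1)) ++ staircase M) ++
          (M, none) :: wpow b (staircase M) := by
      rw [wpow_succ' (a + 1), List.append_assoc, List.append_assoc, staircase_succ M,
        List.append_assoc, List.singleton_append]
    rw [show M + 2 - b = a + 1 + 1 by omega, heq] at e
    rw [show M + 2 - (b + 1) = a + 1 by omega, wpow_succ b]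
    rw [List.append_assoc (wpow (a + 1) (staircase (M + 1))) (staircase M) (wpow b (staircase M))]
      at e2
    exact ⟨e.trans e2⟩

/-- A letter that is the only one in the last column is a kink, which may be removed together with
the last strand. -/
theorem whom_kink (s t : TWord) (hst : ∀ a ∈ s ++ t, a.1 < M ∧ a.2 = none)
    {b : List (Fin (M + 1 - 1))}
    (hb : List.map (fun x : Fin (M + 1 - 1) => (x : ℕ)) b = List.map Prod.fst (s ++ t)) (i j : ℤ) :
    Nonempty (WHom M (s ++ (M, none) :: t) i j ≃ₗ[ℤ]
      FaceHom (M + 1) b (fun _ => none) i (j + 1)) := by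
  classical
  set B := letters M (s ++ (M, none) :: t) with hB
  have hbl : b.length = s.length + t.length := by
    have := congrArg List.length hb
    simpa using this
  have hBl : B.length = b.length + 1 := by
    rw [hB, length_letters, hbl]; simp; omega
  have hbk : ∀ l < b.length, letterAt B (insLetter s.length l) = letterAt b l := by
    intro l hl
    rw [letterAt_letters, getElem?_insLetter, letterAt, dif_pos hl]
    have h1 : l < (s ++ t).length := by rw [List.length_append]; omega
    rw [List.getElem?_eq_getElem h1]
    have h2 := congrArg (fun w => w[l]?) hb
    beta_reduce at h2
    rw [List.getElem?_map, List.getElem?_map, List.getElem?_eq_getElem hl,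
      List.getElem?_eq_getElem h1] at h2
    have h3 : ((b[l] : Fin (M + 1 - 1)) : ℕ) = ((s ++ t)[l]).1 := by simpa using h2
    have h4 := (hst _ (List.getElem_mem h1)).1
    rw [h3]
    exact min_eq_left h4.le
  have htag : tagOnes (s ++ (M, some false) :: t) = 0 := by
    have h1 := tagOnes_eq_zero fun x hx => (hst x hx).2
    rw [tagOnes_append] at h1 ⊢
    rw [tagOnes_cons]
    simpa using h1
  have hmodel : ∀ e e' : ℕ → Bool, (∀ l < b.length, e' (insLetter s.length l) = e l) →
      e' s.length = false → _ := fun e e' he heL =>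
    model_insert (n := b.length) (p := M + 1) (p' := M + 2) (L := s.length) (k := letterAt b)
      (k' := letterAt B) (e := e) (e' := e') (by omega) (by omega) le_rfl
      (fun l hl => letterAt_add_one_lt hl) hbk he heL
  let c := crossing B s.length (by omega)
  -- With σ_M resolved to 0 the last strand is a circle of its own, and elimination leaves it with
  -- label `X`.
  have h1 := (good_braidClosure (M + 2) B).merge_circle (c := c)
    (τ := tagged (M + 2) B (tags (s ++ (M, none) :: t)))
    (O := {x | coord x ∈ {a : ℕ × ℕ | M + 1 ≤ a.2}}) tags_mid ?_ ?_ ?_ i j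
  · rw [update_tagged (s := s) (c := c) rfl] at h1
    -- Adding the circle labelled `X` lowers the quantum degree by one, so degree `j` of the kinked
    -- diagram corresponds to degree `j + 1` on one strand fewer.
    have h2 := compareBraids (b := b) (b' := B) (t := fun _ => none)
      (t' := tags (s ++ (M, some false) :: t)) (κ := insLetter s.length)
      (κ' := fun l => if l < s.length then l else l - 1)
      (f := insLevel s.length) (r := delLevel s.length) (O := {a | M + 1 ≤ a.2}) (g := .X)
      (s := -1) ?_ ?_ ?_ ?_
      (Or.inr ⟨⟨(0, M + 1), Nat.le_refl (M + 1), Nat.zero_le _, Nat.lt_succ_self _⟩, rfl⟩)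
      i (j + 1)
    · rw [show j + 1 + -1 = j by ring] at h2
      exact ⟨h1.some.symm.trans h2.some.symm⟩
    · intro l hl
      refine ⟨?_, ?_, ?_⟩
      · rw [hBl]; unfold insLetter; split_ifs <;> omega
      · rw [tags, getElem?_insLetter]
        exact congrFun (tags_eq_none fun x hx => (hst x hx).2) l
      · unfold insLetter; split_ifs <;> omega
    · intro l hl h
      have hl' : l ≠ s.length := by
        rintro rfl
        rw [tags_mid] at h
        simp at h
      rw [hBl] at hl
      unfold insLetter
      constructor
      · split_ifs <;> omega
      · split_ifs <;> omega
    · have h3 : ones (tagged (M + 2) B (tags (s ++ (M, some false) :: t))) = 0 := by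
        rw [← htag, ← ones_tags (M := M), letters_tag s t M (some false) none]
      rw [h3]
      simp [ones, tagged]
    · intro e e' he he'
      rw [hBl]
      exact hmodel e e' he (he' _ (by omega) tags_mid)
  · intro ε hε hεc
    have h2 := (hmodel (fun l => extend ε (insLetter s.length l)) (extend ε) (fun _ _ => rfl) (by
      rw [extend_of_lt (n := (braidClosure (M + 2) B).n) (show s.length < B.length by omega)]
      exact hεc)).1
    rw [← hBl] at h2
    exact h2.isCircle ⟨(0, M + 1), Nat.le_refl (M + 1), Nat.zero_le _, Nat.lt_succ_self _⟩
  · rw [nw_mem, ne_mem]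
    have h2 : letterAt B c = M := letterAt_mid.trans (min_self M)
    rw [h2]
    simp
  · intro d hd hdc
    have h2 : (d : ℕ) ≠ s.length := fun h => hdc (Fin.ext h)
    have hdl : (d : ℕ) < B.length := crossing_lt d
    obtain ⟨l, hl, hdl'⟩ : ∃ l < b.length, (d : ℕ) = insLetter s.length l := by
      by_cases h : (d : ℕ) < s.length
      · exact ⟨d, by omega, by rw [insLetter, if_pos h]⟩
      · exact ⟨d - 1, by omega, by rw [insLetter, if_neg (by omega)]; omega⟩
    have h3 : letterAt b l + 1 < M + 1 := letterAt_add_one_lt hl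
    rw [nw_mem, ne_mem, hdl', hbk l hl]
    simp only [Set.mem_ofPred_eq]
    omega

/-- After shortening, σ_M occurs only at the end of the first staircase. Removing this kink leaves
`M + 2` staircases on `M + 1` strands. -/
theorem torus_full_twist (M : ℕ) {i : ℤ} (hi : i < 2 * M + 1) (j : ℤ) :
    Nonempty ((torusDiagram (M + 2) (M + 2)).H i j ≃ₗ[ℤ]
      (torusDiagram (M + 1) (M + 2)).H i (j + 1)) := by
  have e1 := (nonempty_torus_equiv M (M + 2) i j).some
  have e2 := (whom_shorten_blocks (b := M + 1) le_rfl hi j).some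
  rw [show M + 2 - (M + 1) = 0 + 1 by omega, wpow_succ 0, wpow_zero, List.append_nil,
    staircase_succ M, List.append_assoc, List.singleton_append] at e2
  rw [← staircase_succ M] at e2
  have e3 := (whom_kink (M := M) (staircase M) (wpow (M + 1) (staircase M)) (by
    intro a ha
    rw [← wpow_succ] at ha
    exact mem_staircase (mem_wpow ha))
    (b := (List.replicate (M + 2) (List.finRange (M + 1 - 1))).flatten)
    (by
      rw [← wpow_succ]
      simp only [wpow, List.map_flatten, List.map_replicate]
      congr 2
      simp [staircase, Function.comp_def]) i j).some
  exact ⟨((e1.trans e2).trans e3).trans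
    (nonempty_H_equiv_faceHom (M + 1) _ i (j + 1)).some.symm⟩

theorem torus_drop_block {p q : ℕ} {i : ℤ} (hp : 2 ≤ p) (hpq : p < q) (hi : i < (p : ℤ) + q - 3)
    (j : ℤ) : Nonempty ((torusDiagram p q).H i j ≃ₗ[ℤ] (torusDiagram p (q - 1)).H i j) := by
  obtain ⟨M, rfl⟩ : ∃ M, p = M + 2 := ⟨p - 2, by omega⟩
  obtain ⟨a, rfl⟩ : ∃ a, q = a + 1 := ⟨q - 1, by omega⟩
  have e1 := (nonempty_torus_equiv M (a + 1) i j).some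
  have e2 := (nonempty_torus_equiv M a i j).some
  rw [wpow_succ'] at e1
  have e3 := (whom_delete_block (M := M) (a := a) (by omega) (staircase (M + 1))
    (fun x hx => ⟨by have := (mem_staircase hx).1; omega, (mem_staircase hx).2⟩) (i := i)
    (by push_cast at hi; omega) j).some
  exact ⟨(e1.trans e3).trans e2.symm⟩

/-- Going from `r + 1` to `r` requires `i < p + r - 2`, and the right-hand side is at least `2p - 1`
because `r ≥ p + 1`. -/
theorem torus_stable {p r : ℕ} {i : ℤ} (hp : 2 ≤ p) (hr : p + 1 ≤ r) (hi : i < 2 * (p : ℤ) - 1)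
    (j : ℤ) : Nonempty ((torusDiagram p r).H i j ≃ₗ[ℤ] (torusDiagram p (p + 1)).H i j) := by
  induction r, hr using Nat.le_induction with
  | base => exact ⟨LinearEquiv.refl _ _⟩
  | succ r hr ih =>
    have e := torus_drop_block (p := p) (q := r + 1) (i := i) hp (by omega) (by push_cast; omega) j
    exact ⟨e.some.trans ih.some⟩

end Khovanov

theorem theorem23 :
    (∀ (p q : ℕ) (i : ℤ), 2 ≤ p → p < q → i < (p : ℤ) + q - 3 → ∀ j : ℤ,
      Nonempty ((Khovanov.torusDiagram p q).H i j ≃ₗ[ℤ]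
        (Khovanov.torusDiagram p (q - 1)).H i j)) ∧
    (∀ (p q : ℕ) (i j : ℤ), 2 ≤ p → p < q → i < 2 * (p : ℤ) - 1 →
      ∀ r s : ℕ, p + 1 ≤ r → r ≤ q → p + 1 ≤ s → s ≤ q →
        Nonempty ((Khovanov.torusDiagram p r).H i j ≃ₗ[ℤ]
          (Khovanov.torusDiagram p s).H i j)) ∧
    (∀ (p : ℕ) (i j : ℤ), 2 ≤ p → i < 2 * (p : ℤ) - 3 →
      Nonempty ((Khovanov.torusDiagram p p).H i j ≃ₗ[ℤ]
        (Khovanov.torusDiagram (p - 1) p).H i (j + 1))) := by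
  refine ⟨fun p q i hp hpq hi j => Khovanov.torus_drop_block hp hpq hi j,
    fun p q i j hp _ hi r s hr _ hs _ =>
      ⟨(Khovanov.torus_stable hp hr hi j).some.trans (Khovanov.torus_stable hp hs hi j).some.symm⟩,
    fun p i j hp hi => ?_⟩
  obtain ⟨M, rfl⟩ : ∃ M, p = M + 2 := ⟨p - 2, by omega⟩
  exact Khovanov.torus_full_twist M (by push_cast at hi; omega) j
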